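/- **Setting.** Write $[k]=\{0,\dots,k-1\}$. Let $d,n,p,E,G\ge 1$ and $D$ be integers with $Ep+1=2^n$, and put $m=\lceil\log_2(p+1)\rceil$, $h=1/E$. *Mesh.* Divide $\Omega^d=[0,1]^d$ into the $E^d$ elements $\Omega^e=\prod_i[he_i,h(e_i+1)]$, $e\in[E]^d$. The local nodes of an element are $j\in[p+1]^d$, and the global number of the local node $j$ of $e$ is $\mathrm{IX}(j,e)=(e_ip+j_i)_i\in[2^n]^d$. The basis function $N_j^e$ is $x\mapsto\prod_i L_{j_i}(x_i/h-e_i)$ on $\Omega^e$ and $0$ elsewhere, where $L_0,\dots,L_p$ are the Lagrange polynomials for the nodes $0,\frac1p,\dots,1$ ($\mathcal Q_p$ elements). *Array.* Let $B:\mathcal U\times\mathcal U\to L^1(\Omega^d)$ be bilinear, with values that are functions defined at every point, on a real vector space $\mathcal U$ of functions that contains all $N_j^e$. For $f:\Omega^d\to\mathbb R$ let $$F=\sum_{e}\sum_{j,k}F^e_{jk}\,|\mathrm{IX}(j,e)\rangle\langle\mathrm{IX}(k,e)|,\qquad F^e_{jk}=\int_{\Omega^e}f(x)\,B[N_j^e,N_k^e](x)\,dx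 .$$ *Quadrature.* For $\ell\in[G]^d$ let $x_\ell^e\in\Omega^e$ and $w_\ell$ be the points and weights of the tensor-product Gauss–Legendre rule on $\Omega^e$ with $G$ points per direction: with $t_0<\dots<t_{G-1}$ the zeros of the Legendre polynomial $P_G$, $(x^e_\ell)_i=h\big(\tfrac{t_{\ell_i}+1}2+e_i\big)$ and $w_\ell=\prod_i\tfrac h2\,\tfrac{2}{(1-t_{\ell_i}^2)P_G'(t_{\ell_i})^2}$. Let $F_G$ be the array that is assembled in the same way from $\sum_\ell w_\ell B[N^e_j,N^e_k](x^e_\ell)f(x^e_\ell)$ in place of $F^e_{jk}$. *Circuits.* A circuit is a sequence of arbitrary one-qubit gates, CNOT gates, Toffoli gates (together: "Toffoli or simpler gates") and queries; its cost is the total number of gates and queries. Only ancilla qubits that need post-selection are counted: the circuit may use further work qubits that start in $|0\rangle$, provided that they are back in $|0\rangle$ whenever all counted ancilla qubits are found in $|0\rangle$. With this convention, a circuit $U$ with $a$ counted ancilla qubits is an $(\alpha,a,\epsilon')$-block-encoding of a $2^{dn}\times2^{dn}$ matrix $A$ if $\alpha>0$ and $\|A-\alpha(\langle0|^{\otimes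 a}\otimes I)U(|0\rangle^{\otimes a}\otimes I)\|\le\epsilon'$ in operator norm, with the work qubits in $|0\rangle$; for $\epsilon'=0$ it is an (exact) $(\alpha,a)$-block-encoding. **Hypotheses.** 1. The values $B_{jk\ell}=B[N_j^e,N_k^e](x_\ell^e)$ do not depend on the element $e$. 2. $f\in L^\infty(\Omega^d)$, $f$ is not almost everywhere $0$, and there are $\epsilon\ge 0$ and a real polynomial $q$ in $d$ variables, of degree less than $D$ in each variable, with $|f-q|\le\epsilon$ on $\Omega^d$. 3. For a fixed reference element $\Omega^{e,d}$, with basis functions $N^e_j$, one has $S:=\sum_{j,k\in[p+1]^d}\int_{\Omega^{e,d}}|B[N_j^e,N_k^e](x)|\,dx>0$. 4. The numerical integration has tolerances $\delta,\eta\ge 0$: for all $j,k$ the rule integrates $fB[N_j^{e'},N_k^{e'}]$ over every element $\Omega^{e'}$ with error at most $\delta$, and it integrates $|B[N_j^e,N_k^e]|$ over the reference element with error at most $\eta$. 5. The precomputed coefficients $c_{\ell jk}=w_\ell B_{jk\ell}$ are accessed through a state-preparation pair: unitaries $P_L,P_R$ on $d(\lceil\log_2G\rceil+\lceil2\log_2(p+1)\rceil)$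 qubits such that, writing $P_L|0\rangle=\sum_sc_s|s\rangle$ and $P_R|0\rangle=\sum_sd_s|s\rangle$, one has $\|c\|_1\,\overline{c_s}d_s=c_{\ell jk}$ if $s$ is the binary code of $(\ell,j,k)$, and $\overline{c_s}d_s=0$ for all other $s$. Here $\|c\|_1=\sum_{\ell,j,k}|c_{\ell jk}|$. A query applies $P_R$ or $P_L^\dagger$. **Theorem.** There is an absolute constant $C$ such that in this situation there is a circuit of cost at most $$C\,dn\left(D^dG^d+p^{2d}m\right),$$ with at most two queries, and a number $\alpha>0$ with $$\alpha\le(D+2)^{d-1}\,\|f\|_{L^\infty(\Omega^d)}\left(\sum_{j,k\in[p+1]^d}\int_{\Omega^{e,d}}\left|B[N^e_j,N^e_k](x)\right|dx+(p+1)^{2d}\eta\right),$$ such that, with $$a=d\left(\lceil\log_2n\rceil+\lceil\log_2G\rceil+\lceil2\log_2(p+1)\rceil+3\right),$$ the circuit is both an $(\alpha,a,\epsilon_1)$-block-encoding of $F_G$ and an $(\alpha,a,\epsilon_1+(p+1)^{2d}\delta)$-block-encoding of $F$, where $\epsilon_1=2\epsilon\,(S+(p+1)^{2d}\eta)$. In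 particular, if $f$ is such a polynomial and the numerical integration is exact ($\epsilon=\delta=\eta=0$), it is an exact $(\alpha,a)$-block-encoding of $F$ with $\alpha\le(D+2)^{d-1}\|f\|_{L^\infty(\Omega^d)}\sum_{j,k}\int_{\Omega^{e,d}}|B[N_j^e,N_k^e](x)|\,dx$. -/

import Mathlib

open MeasureTheory

noncomputable section

namespace QuFEM

/-! ## Gauss-Legendre quadrature -/

/-- The Legendre polynomial of degree `G` (Rodrigues' formula, so that `P_G(1) = 1`). -/
def legendre (G : ℕ) : Polynomial ℝ :=
  Polynomial.C (1 / ((2 : ℝ) ^ G * (G.factorial : ℝ))) *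
    (Polynomial.derivative^[G] ((Polynomial.X ^ 2 - 1) ^ G))

/-- The `ℓ`-th Gauss point on `[-1,1]`: the `ℓ`-th root of the Legendre polynomial, the roots
being listed in increasing order. -/
def gaussNode (G : ℕ) (ℓ : Fin G) : ℝ :=
  ((legendre G).roots.sort (· ≤ ·)).getD ℓ 0

/-- The `ℓ`-th Gauss weight on `[-1,1]`. -/
def gaussWeight (G : ℕ) (ℓ : Fin G) : ℝ :=
  2 / ((1 - gaussNode G ℓ ^ 2) * ((legendre G).derivative.eval (gaussNode G ℓ)) ^ 2)

/-! ## The mesh of `E ^ d` tensor-product Lagrange elements of order `p` on `[0,1]^d`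

Multi-indices of elements are functions `Fin d → Fin E`, those of local nodes are functions
`Fin d → Fin (p + 1)`, those of global nodes are functions `Fin d → Fin (2 ^ n)`, and those of
quadrature points are functions `Fin d → Fin G`. -/

/-- The domain `[0,1]^d`. -/
def unitCube (d : ℕ) : Set (Fin d → ℝ) := Set.Icc 0 1

/-- The element with multi-index `e`, of side length `h = 1 / E`. -/
def element {d E : ℕ} (e : Fin d → Fin E) : Set (Fin d → ℝ) :=
  Set.Icc (fun i => ((e i : ℕ) : ℝ) / E) (fun i => (((e i : ℕ) : ℝ) + 1) / E)

/-- The `j`-th Lagrange basis polynomial on `[0,1]` for the nodes `0, 1/p, …, 1`. -/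
def lagrange1 (p : ℕ) (j : Fin (p + 1)) (t : ℝ) : ℝ :=
  ∏ s ∈ Finset.univ.erase j,
    (t - ((s : ℕ) : ℝ) / p) / (((j : ℕ) : ℝ) / p - ((s : ℕ) : ℝ) / p)

open Classical in
/-- The tensor-product basis function of the local node `j` of the element `e`; it is supported
on the element. -/
def elemBasis {d E : ℕ} (p : ℕ) (e : Fin d → Fin E) (j : Fin d → Fin (p + 1)) :
    (Fin d → ℝ) → ℝ := fun x =>
  if x ∈ element e then ∏ i, lagrange1 p (j i) ((E : ℝ) * x i - ((e i : ℕ) : ℝ)) else 0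

/-- The Gauss point `ℓ` of the element `e`: coordinates `h ((x_ℓ + 1) / 2 + e)`. -/
def quadPoint {d E G : ℕ} (e : Fin d → Fin E) (ℓ : Fin d → Fin G) : Fin d → ℝ :=
  fun i => ((gaussNode G (ℓ i) + 1) / 2 + ((e i : ℕ) : ℝ)) / E

/-- The Gauss weight `ℓ` of any element: the product of the one-dimensional weights
`(h / 2) w_ℓ`. -/
def quadWeight {d : ℕ} (E : ℕ) {G : ℕ} (ℓ : Fin d → Fin G) : ℝ :=
  ∏ i, gaussWeight G (ℓ i) / (2 * (E : ℝ))

/-- `IsConn e j J` says that `J` is the global node number `IX(j, e)` of the local node `j` of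
the element `e`; in every direction this number is `e p + j`. -/
def IsConn {d n p E : ℕ} (e : Fin d → Fin E) (j : Fin d → Fin (p + 1))
    (J : Fin d → Fin (2 ^ n)) : Prop :=
  ∀ i, (J i : ℕ) = (e i : ℕ) * p + (j i : ℕ)

open Classical in
/-- Assembly of elemental arrays: `∑_e ∑_{j,k} a^e_{jk} |IX(j,e)⟩⟨IX(k,e)|`. -/
def assemble {d p E : ℕ} (n : ℕ)
    (a : (Fin d → Fin E) → (Fin d → Fin (p + 1)) → (Fin d → Fin (p + 1)) → ℝ) :
    Matrix (Fin d → Fin (2 ^ n)) (Fin d → Fin (2 ^ n)) ℂ := fun J K =>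
  ∑ e, ∑ j, ∑ k, if IsConn e j J ∧ IsConn e k K then ((a e j k : ℝ) : ℂ) else 0

section Form

variable {d p E : ℕ} {V : Submodule ℝ ((Fin d → ℝ) → ℝ)}

/-- The function `B[N_j^e, N_k^e]`. -/
def basisForm (B : V →ₗ[ℝ] V →ₗ[ℝ] ((Fin d → ℝ) → ℝ))
    (hV : ∀ (e : Fin d → Fin E) (j : Fin d → Fin (p + 1)), elemBasis p e j ∈ V)
    (e : Fin d → Fin E) (j k : Fin d → Fin (p + 1)) : (Fin d → ℝ) → ℝ :=
  B ⟨elemBasis p e j, hV e j⟩ ⟨elemBasis p e k, hV e k⟩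

/-- The elemental array `F^e_{jk} = ∫_{Ω^e} f(x) B[N_j^e, N_k^e](x) dx`. -/
def elemArray (B : V →ₗ[ℝ] V →ₗ[ℝ] ((Fin d → ℝ) → ℝ))
    (hV : ∀ (e : Fin d → Fin E) (j : Fin d → Fin (p + 1)), elemBasis p e j ∈ V)
    (f : (Fin d → ℝ) → ℝ) (e : Fin d → Fin E) (j k : Fin d → Fin (p + 1)) : ℝ :=
  ∫ x in element e, f x * basisForm B hV e j k x

/-- The LCU coefficient `w_ℓ B[N_j^e, N_k^e](x_ℓ^e)` of the quadrature point `ℓ`. -/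
def quadCoeff (G : ℕ) (B : V →ₗ[ℝ] V →ₗ[ℝ] ((Fin d → ℝ) → ℝ))
    (hV : ∀ (e : Fin d → Fin E) (j : Fin d → Fin (p + 1)), elemBasis p e j ∈ V)
    (e : Fin d → Fin E) (ℓ : Fin d → Fin G) (j k : Fin d → Fin (p + 1)) : ℝ :=
  quadWeight E ℓ * basisForm B hV e j k (quadPoint e ℓ)

/-- The elemental array evaluated with the `G`-point (per direction) Gauss-Legendre rule. -/
def quadArray (G : ℕ) (B : V →ₗ[ℝ] V →ₗ[ℝ] ((Fin d → ℝ) → ℝ))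
    (hV : ∀ (e : Fin d → Fin E) (j : Fin d → Fin (p + 1)), elemBasis p e j ∈ V)
    (f : (Fin d → ℝ) → ℝ) (e : Fin d → Fin E) (j k : Fin d → Fin (p + 1)) : ℝ :=
  ∑ ℓ : Fin d → Fin G, quadCoeff G B hV e ℓ j k * f (quadPoint e ℓ)

/-- `∑_{j,k} ∫_{Ω^e} |B[N_j^e, N_k^e](x)| dx`. -/
def absMass (B : V →ₗ[ℝ] V →ₗ[ℝ] ((Fin d → ℝ) → ℝ))
    (hV : ∀ (e : Fin d → Fin E) (j : Fin d → Fin (p + 1)), elemBasis p e j ∈ V)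
    (e : Fin d → Fin E) : ℝ :=
  ∑ j, ∑ k, ∫ x in element e, |basisForm B hV e j k x|

end Form

/-- The norm of `L^∞([0,1]^d)`. -/
def supNorm {d : ℕ} (f : (Fin d → ℝ) → ℝ) : ℝ :=
  (eLpNorm f ⊤ (volume.restrict (unitCube d))).toReal

/-! ## Circuits

A register with wire set `Q` has the computational basis `Q → Bool`. -/

/-- Gates: an arbitrary one-qubit unitary, CNOT, Toffoli, and queries to a pair of unitaries
`(P_L, P_R)` acting on a register with wire set `R` (placed on the wires of `Q` by an
embedding): a query applies `P_R` or the adjoint of `P_L`. -/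
inductive Gate (R Q : Type) : Type
  | single (q : Q) (u : Matrix.unitaryGroup Bool ℂ) : Gate R Q
  | cnot (c t : Q) (h : c ≠ t) : Gate R Q
  | toffoli (c₁ c₂ t : Q) (h : c₁ ≠ c₂) (h₁ : c₁ ≠ t) (h₂ : c₂ ≠ t) : Gate R Q
  | prepR (r : R ↪ Q) : Gate R Q
  | prepLAdj (r : R ↪ Q) : Gate R Q

/-- Whether a gate is a query. -/
def Gate.isQuery {R Q : Type} : Gate R Q → Bool
  | .prepR _ => true
  | .prepLAdj _ => true
  | _ => false

open Classical in
/-- The matrix `u` acting on the wires in the image of `r`, and trivially on all others. -/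
def actOn {R Q : Type} (r : R → Q) (u : Matrix (R → Bool) (R → Bool) ℂ) :
    Matrix (Q → Bool) (Q → Bool) ℂ := fun x y =>
  if ∀ q, q ∉ Set.range r → x q = y q then u (x ∘ r) (y ∘ r) else 0

open Classical in
/-- The matrix that maps the basis state `y` to the basis state `g y`. -/
def basisMap {Q : Type} (g : (Q → Bool) → (Q → Bool)) : Matrix (Q → Bool) (Q → Bool) ℂ :=
  fun x y => if x = g y then 1 else 0

/-- The matrix of a gate. -/
def Gate.mat {R Q : Type} [Fintype R] [DecidableEq R] [DecidableEq Q]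
    (PL PR : Matrix.unitaryGroup (R → Bool) ℂ) : Gate R Q → Matrix (Q → Bool) (Q → Bool) ℂ
  | .single q u => actOn (fun _ : Unit => q) (fun x y => u.1 (x ()) (y ()))
  | .cnot c t _ => basisMap fun y => Function.update y t (xor (y t) (y c))
  | .toffoli c₁ c₂ t _ _ _ => basisMap fun y => Function.update y t (xor (y t) (y c₁ && y c₂))
  | .prepR r => actOn r PR.1
  | .prepLAdj r => actOn r PL.1.conjTranspose

/-- The matrix of a circuit, given as the list of its gates in the order of application. -/
def circuitMat {R Q : Type} [Fintype R] [DecidableEq R] [Fintype Q] [DecidableEq Q]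
    (PL PR : Matrix.unitaryGroup (R → Bool) ℂ) (c : List (Gate R Q)) :
    Matrix (Q → Bool) (Q → Bool) ℂ :=
  c.foldl (fun M g => g.mat PL PR * M) 1

/-- The number of queries of a circuit. -/
def queryCount {R Q : Type} (c : List (Gate R Q)) : ℕ := c.countP Gate.isQuery

/-! ## Block-encodings -/

/-- The wires: `n` system qubits for each of the `d` directions, `a` ancilla qubits that are
post-selected, and `w` work qubits that are not. -/
abbrev Wires (d n a w : ℕ) : Type := (Fin d × Fin n) ⊕ (Fin a ⊕ Fin w)

/-- The basis state of `Wires` in which the system holds the binary digits of the global node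
`J`, all ancilla qubits are `0`, and the work qubits hold `z`. -/
def basisState {d n a w : ℕ} (J : Fin d → Fin (2 ^ n)) (z : Fin w → Bool) :
    Wires d n a w → Bool
  | .inl (i, r) => (J i : ℕ).testBit r
  | .inr (.inl _) => false
  | .inr (.inr r) => z r

/-- The block `(⟨0^a| ⊗ I) U (|0^a⟩ ⊗ I)` of `U`, with all work qubits in the state `0`. -/
def topBlock {d n a w : ℕ} (U : Matrix (Wires d n a w → Bool) (Wires d n a w → Bool) ℂ) :
    Matrix (Fin d → Fin (2 ^ n)) (Fin d → Fin (2 ^ n)) ℂ := fun J K =>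
  U (basisState J fun _ => false) (basisState K fun _ => false)

/-- `U` is an `(α, a, ε)`-block-encoding of `A`, where only the ancilla qubits that need
post-selection are counted: `U` may use `w` further work qubits that start in the state `0`,
provided that they are back in the state `0` whenever the `a` ancilla qubits are found in the
state `0`. The norm is the operator norm for the Euclidean vector norm. -/
def IsBlockEncoding {d n a w : ℕ} (α ε : ℝ)
    (U : Matrix (Wires d n a w → Bool) (Wires d n a w → Bool) ℂ)
    (A : Matrix (Fin d → Fin (2 ^ n)) (Fin d → Fin (2 ^ n)) ℂ) : Prop :=
  U ∈ Matrix.unitaryGroup (Wires d n a w → Bool) ℂ ∧ 0 < α ∧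
    (∀ (J K : Fin d → Fin (2 ^ n)) (z : Fin w → Bool), z ≠ (fun _ => false) →
      U (basisState J z) (basisState K fun _ => false) = 0) ∧
    ‖Matrix.toEuclideanCLM (n := Fin d → Fin (2 ^ n)) (𝕜 := ℂ)
      (A - (α : ℂ) • topBlock U)‖ ≤ ε

/-! ## State-preparation pairs for the LCU coefficients -/

/-- The wires of the register that holds an LCU index `(ℓ, j, k)`: for each direction,
`⌈log₂ G⌉` qubits for `ℓ` and `⌈2 log₂ (p + 1)⌉` qubits for the pair `(j, k)`. -/
abbrev LCUWires (d p G : ℕ) : Type :=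
  Fin d × (Fin (Nat.clog 2 G) ⊕ Fin (Nat.clog 2 ((p + 1) ^ 2)))

/-- The basis state of the LCU register that holds the index `(ℓ, j, k)`. -/
def lcuState {d p G : ℕ} (ℓ : Fin d → Fin G) (j k : Fin d → Fin (p + 1)) :
    LCUWires d p G → Bool
  | (i, .inl r) => (ℓ i : ℕ).testBit r
  | (i, .inr r) => ((j i : ℕ) * (p + 1) + (k i : ℕ)).testBit r

/-- `(P_L, P_R)` is an exact state-preparation pair for the vector `y` of LCU coefficients, with
`β = ‖y‖₁`: if `P_L |0⟩ = ∑ c_s |s⟩` and `P_R |0⟩ = ∑ d_s |s⟩`, then `β c̄_s d_s = y_s` for every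
LCU index `s`, and `c̄_s d_s = 0` for every other basis state `s`. -/
def IsStatePrepPair {d p G : ℕ} (PL PR : Matrix.unitaryGroup (LCUWires d p G → Bool) ℂ)
    (y : (Fin d → Fin G) → (Fin d → Fin (p + 1)) → (Fin d → Fin (p + 1)) → ℝ) : Prop :=
  (∀ ℓ j k, (((∑ ℓ', ∑ j', ∑ k', |y ℓ' j' k'| : ℝ)) : ℂ) *
      (star (PL.1 (lcuState ℓ j k) fun _ => false) * PR.1 (lcuState ℓ j k) fun _ => false) =
        ((y ℓ j k : ℝ) : ℂ)) ∧
  ∀ s : LCUWires d p G → Bool, (∀ ℓ j k, s ≠ lcuState ℓ j k) →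
    star (PL.1 s fun _ => false) * (PR.1 s fun _ => false) = 0

end QuFEM

end

open MeasureTheory

noncomputable section

/-! The array with quadrature is a linear combination, with the coefficients `c_{ℓjk}`, of the
operators `∑_e f(x_ℓ^e) |IX(j,e)⟩⟨IX(k,e)|`. The state-preparation pair turns the sum over `(ℓ,j,k)`
into a block-encoding with normalization `‖c‖₁`, so it suffices to realize these operators
coherently in `(ℓ,j,k)`. A column node `K = e p + k` determines `e`, hence the end nodes `K - k = e
p` and `K - k + p = (e+1) p` of its element and the row node `K - k + j`. All of them are small
shifts of `K`, and `K` can be recovered from the row node, so the column node is replaced by the row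
node reversibly; range and divisibility tests mark the nodes `K` that are not of this form
(`mainState_eq_coreMap_iff`).

The weight `f(x)` is produced without storing `x`. Since `E p = 2^n - 1`, a coordinate of a Gauss
point is `((1-t) A + t B) / (2^n - 1)`, where `A` and `B` are the end nodes and `t` is the Gauss
node on `[0,1]`. This is the probability of reading a `1` if the binary digit number `r` is chosen
with probability `2^r / (2^n - 1)`, from `B` with probability `t` and from `A` otherwise. With a
product state of coins that realizes these choices, the conjugated sign of the digit is a reflection
`V` with diagonal entry `1 - 2 x` (`signConj_placeBit`). If `Z` reflects about the zero state of the
coins, then `U = Z V` satisfies `U + U⁻¹ = 2 - 4 x` on the plane spanned by the zero state and its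
image under `V`.

Hence polynomials in `x` become Laurent polynomials in `U`. For a real polynomial `P` of degree at
most `N` with `|P| ≤ 1` on `[0,1]`, the function `z^N P(x)` with `z + z⁻¹ = 2 - 4 x` is a polynomial
of degree at most `2 N` that is bounded by one on the circle. A factorization of Fejér–Riesz type
gives a complementary polynomial (`exists_complement`), the pair is decomposed into rotations by
lowering the degree (`exists_rotPoly`), and the inverse walk `U^{-N}` then leaves exactly `P(x)`
(`qspMat_apply_self`).

In several variables, a polynomial bounded by one is a sum of only `D^(d-1)` products of univariate
polynomials bounded by one: all variables but one are interpolated at nodes that maximize the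
Vandermonde determinant, where the Lagrange basis is bounded by one (`exists_sum_prod_eq`). Further
coins select one of the products with equal probability, which costs the factor `D^(d-1)`. Gauss
weights are nonnegative, so `‖c‖₁` is the quadrature of the absolute values of the form. The
approximating polynomial is rescaled so that `‖f‖` rather than `‖f‖ + ε` enters the normalization,
at the price of a pointwise error `2 ε`; the Schur test turns entrywise errors into operator norms
(`norm_assemble_le`).

For the cost, Boolean functions are given by straight-line programs, whose values are computed on
work wires, used and uncomputed. Addition and divisibility tests are automata with `O(p)` states in
one-hot encoding that read the `n` digits, and decoding a pair `(j,k)` takes `O(p²)` steps. Finally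
one flag records whether any other wire that should be zero is not; this is the only ancilla that
has to be post-selected. -/

namespace QuFEM

set_option linter.unusedSectionVars false

/-! ## Matrices acting on part of the wires -/

section ActOn

variable {R Q Q' : Type}

open Classical in
/-- The basis state that agrees with `s` on the wires in the image of `r` and with `x` elsewhere. -/
def overwrite (r : R → Q) (s : R → Bool) (x : Q → Bool) : Q → Bool := fun q =>
  if h : ∃ a, r a = q then s h.choose else x q

lemma overwrite_apply {r : R → Q} (hr : Function.Injective r) (s : R → Bool) (x : Q → Bool)
    (a : R) : overwrite r s x (r a) = s a := by
  have h : ∃ b, r b = r a := ⟨a, rfl⟩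
  simp only [overwrite, h, dif_pos]
  rw [hr h.choose_spec]

lemma overwrite_off {r : R → Q} (s : R → Bool) (x : Q → Bool) {q : Q} (hq : q ∉ Set.range r) :
    overwrite r s x q = x q := by
  have h : ¬ ∃ b, r b = q := hq
  simp only [overwrite, h, dif_neg, not_false_eq_true]

lemma overwrite_comp {r : R → Q} (hr : Function.Injective r) (s : R → Bool) (x : Q → Bool) :
    overwrite r s x ∘ r = s := by
  funext a; exact overwrite_apply hr s x a

lemma overwrite_eq {r : R → Q} (hr : Function.Injective r) {s : R → Bool} {x z : Q → Bool}
    (h1 : ∀ q, q ∉ Set.range r → x q = z q) (h2 : z ∘ r = s) : overwrite r s x = z := by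
  funext q
  by_cases hq : q ∈ Set.range r
  · obtain ⟨a, rfl⟩ := hq
    rw [overwrite_apply hr, ← h2]; rfl
  · rw [overwrite_off _ _ hq, h1 q hq]

lemma overwrite_injective {r : R → Q} (hr : Function.Injective r) (x : Q → Bool) :
    Function.Injective fun s => overwrite r s x := fun s t h => by
  rw [← overwrite_comp hr s x, ← overwrite_comp hr t x]; exact congrArg (· ∘ r) h

/-- A matrix acting on a register connects only states that agree off the register. The sum over
intermediate states in a matrix product therefore collapses to a sum over the contents of the
register. -/
lemma sum_agree [Fintype R] [DecidableEq R] [Fintype Q] [DecidableEq Q] {r : R → Q}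
    (hr : Function.Injective r) (x : Q → Bool) (F : (Q → Bool) → ℂ)
    (hF : ∀ z, F z ≠ 0 → ∀ q, q ∉ Set.range r → x q = z q) :
    ∑ z, F z = ∑ s, F (overwrite r s x) := by
  symm
  refine Fintype.sum_of_injective (fun s => overwrite r s x) (overwrite_injective hr x) _ _ ?_
    (fun _ => rfl)
  intro z hz
  by_contra h
  exact hz ⟨z ∘ r, overwrite_eq hr (hF z h) rfl⟩

lemma actOn_apply_of_agree {r : R → Q} (u : Matrix (R → Bool) (R → Bool) ℂ) {x y : Q → Bool}
    (h : ∀ q, q ∉ Set.range r → x q = y q) : actOn r u x y = u (x ∘ r) (y ∘ r) := by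
  simp only [actOn]; rw [if_pos h]

lemma agree_of_actOn_ne_zero {r : R → Q} {u : Matrix (R → Bool) (R → Bool) ℂ} {x y : Q → Bool}
    (h : actOn r u x y ≠ 0) : ∀ q, q ∉ Set.range r → x q = y q := by
  by_contra h'
  exact h (by simp only [actOn]; rw [if_neg h'])

lemma actOn_overwrite_right {r : R → Q} (hr : Function.Injective r)
    (u : Matrix (R → Bool) (R → Bool) ℂ) (x : Q → Bool) (s : R → Bool) :
    actOn r u x (overwrite r s x) = u (x ∘ r) s := by
  rw [actOn_apply_of_agree u (fun q hq => (overwrite_off s x hq).symm), overwrite_comp hr]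

lemma actOn_overwrite_left {r : R → Q} (hr : Function.Injective r)
    (u : Matrix (R → Bool) (R → Bool) ℂ) (x : Q → Bool) (s : R → Bool) :
    actOn r u (overwrite r s x) x = u s (x ∘ r) := by
  rw [actOn_apply_of_agree u (fun q hq => (overwrite_off s x hq)), overwrite_comp hr]

lemma actOn_mul_apply [Fintype R] [DecidableEq R] [Fintype Q] [DecidableEq Q]
    {r : R → Q} (hr : Function.Injective r)
    (u : Matrix (R → Bool) (R → Bool) ℂ) (A : Matrix (Q → Bool) (Q → Bool) ℂ) (x y : Q → Bool) :
    (actOn r u * A) x y = ∑ s, u (x ∘ r) s * A (overwrite r s x) y := by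
  rw [Matrix.mul_apply, sum_agree hr x]
  · simp_rw [actOn_overwrite_right hr]
  · intro z hz
    exact agree_of_actOn_ne_zero (left_ne_zero_of_mul hz)

lemma mul_actOn_apply [Fintype R] [DecidableEq R] [Fintype Q] [DecidableEq Q]
    {r : R → Q} (hr : Function.Injective r)
    (u : Matrix (R → Bool) (R → Bool) ℂ) (A : Matrix (Q → Bool) (Q → Bool) ℂ) (x y : Q → Bool) :
    (A * actOn r u) x y = ∑ s, A x (overwrite r s y) * u s (y ∘ r) := by
  rw [Matrix.mul_apply, sum_agree hr y]
  · simp_rw [actOn_overwrite_left hr]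
  · intro z hz q hq
    exact (agree_of_actOn_ne_zero (right_ne_zero_of_mul hz) q hq).symm

lemma actOn_mul [Fintype R] [DecidableEq R] [Fintype Q] [DecidableEq Q]
    {r : R → Q} (hr : Function.Injective r)
    (u v : Matrix (R → Bool) (R → Bool) ℂ) : actOn r (u * v) = actOn r u * actOn r v := by
  ext x y
  rw [actOn_mul_apply hr]
  by_cases h : ∀ q, q ∉ Set.range r → x q = y q
  · rw [actOn_apply_of_agree _ h, Matrix.mul_apply]
    refine Finset.sum_congr rfl fun s _ => ?_
    rw [actOn_apply_of_agree, overwrite_comp hr]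
    intro q hq
    rw [overwrite_off _ _ hq, h q hq]
  · rw [Finset.sum_eq_zero]
    · simp only [actOn]; rw [if_neg h]
    · intro s _
      simp only [actOn]
      rw [if_neg, mul_zero]
      intro h'
      exact h fun q hq => by rw [← h' q hq, overwrite_off _ _ hq]

lemma actOn_conjTranspose (r : R → Q) (u : Matrix (R → Bool) (R → Bool) ℂ) :
    (actOn r u).conjTranspose = actOn r u.conjTranspose := by
  ext x y
  rw [Matrix.conjTranspose_apply]
  by_cases h : ∀ q, q ∉ Set.range r → x q = y q
  · rw [actOn_apply_of_agree _ h, actOn_apply_of_agree _ fun q hq => (h q hq).symm]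
    rfl
  · simp only [actOn]
    rw [if_neg h, if_neg fun h' => h fun q hq => (h' q hq).symm, star_zero]

lemma actOn_one [Fintype R] [DecidableEq R] [Fintype Q] [DecidableEq Q] (r : R → Q) :
    actOn r (1 : Matrix (R → Bool) (R → Bool) ℂ) = 1 := by
  ext x y
  simp only [actOn, Matrix.one_apply]
  by_cases h : x = y
  · subst h; simp
  · rw [if_neg h]
    split_ifs with h1 h2
    · exfalso
      apply h
      funext q
      by_cases hq : q ∈ Set.range r
      · obtain ⟨a, rfl⟩ := hq
        exact congrFun h2 a
      · exact h1 q hq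
    · rfl
    · rfl

lemma actOn_mem_unitary [Fintype R] [DecidableEq R] [Fintype Q] [DecidableEq Q] {r : R → Q}
    (hr : Function.Injective r) {u : Matrix (R → Bool) (R → Bool) ℂ}
    (hu : u ∈ Matrix.unitaryGroup (R → Bool) ℂ) :
    actOn r u ∈ Matrix.unitaryGroup (Q → Bool) ℂ := by
  rw [Matrix.mem_unitaryGroup_iff, Matrix.star_eq_conjTranspose, actOn_conjTranspose,
    ← actOn_mul hr, ← Matrix.star_eq_conjTranspose, Matrix.mem_unitaryGroup_iff.1 hu, actOn_one]

lemma actOn_comp {r : Q → Q'} (hr : Function.Injective r) (r' : R → Q)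
    (u : Matrix (R → Bool) (R → Bool) ℂ) : actOn r (actOn r' u) = actOn (r ∘ r') u := by
  ext x y
  have : (∀ q, q ∉ Set.range (r ∘ r') → x q = y q) ↔ (∀ q, q ∉ Set.range r → x q = y q) ∧
      ∀ a, a ∉ Set.range r' → (x ∘ r) a = (y ∘ r) a := by
    constructor
    · intro h
      refine ⟨fun q hq => h q fun ⟨a, ha⟩ => hq ⟨r' a, ha⟩, fun a ha => h (r a) ?_⟩
      rintro ⟨b, hb⟩
      exact ha ⟨b, hr hb⟩
    · rintro ⟨h1, h2⟩ q hq
      by_cases hq' : q ∈ Set.range r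
      · obtain ⟨a, rfl⟩ := hq'
        exact h2 a fun ⟨b, hb⟩ => hq ⟨b, by simp [hb]⟩
      · exact h1 q hq'
  by_cases h1 : ∀ q, q ∉ Set.range r → x q = y q
  · by_cases h2 : ∀ a, a ∉ Set.range r' → (x ∘ r) a = (y ∘ r) a
    · rw [actOn_apply_of_agree _ h1, actOn_apply_of_agree _ h2,
        actOn_apply_of_agree _ (this.2 ⟨h1, h2⟩)]
      rfl
    · rw [actOn_apply_of_agree _ h1]
      simp only [actOn]
      rw [if_neg h2, if_neg fun h => h2 (this.1 h).2]
  · simp only [actOn]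
    rw [if_neg h1, if_neg fun h => h1 (this.1 h).1]

lemma actOn_basisMap {r : Q → Q'} (hr : Function.Injective r)
    (g : (Q → Bool) → (Q → Bool)) :
    actOn r (basisMap g) = basisMap fun y => overwrite r (g (y ∘ r)) y := by
  ext x y
  simp only [actOn, basisMap]
  by_cases h : x = overwrite r (g (y ∘ r)) y
  · rw [if_pos h, if_pos, if_pos]
    · rw [h, overwrite_comp hr]
    · intro q hq
      rw [h, overwrite_off _ _ hq]
  · rw [if_neg h]
    split_ifs with h1 h2
    · exact absurd (overwrite_eq hr (fun q hq => (h1 q hq).symm) h2).symm h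
    · rfl
    · rfl

lemma overwrite_update [DecidableEq Q] [DecidableEq Q'] {r : Q → Q'} (hr : Function.Injective r)
    (y : Q' → Bool) (t : Q) (b : Bool) :
    overwrite r (Function.update (y ∘ r) t b) y = Function.update y (r t) b := by
  refine overwrite_eq hr (fun q hq => ?_) ?_
  · rw [Function.update_of_ne]
    rintro rfl
    exact hq ⟨t, rfl⟩
  · exact Function.update_comp_eq_of_injective _ hr _ _

end ActOn

/-! ### Matrices of maps between basis states -/

section BasisMap

variable {Q : Type} [Fintype Q] [DecidableEq Q]

lemma mul_basisMap_apply (A : Matrix (Q → Bool) (Q → Bool) ℂ) (g : (Q → Bool) → (Q → Bool))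
    (x y : Q → Bool) : (A * basisMap g) x y = A x (g y) := by
  simp [Matrix.mul_apply, basisMap]

lemma basisMap_mul (g g' : (Q → Bool) → (Q → Bool)) :
    basisMap g * basisMap g' = basisMap (g ∘ g') := by
  ext x y
  rw [mul_basisMap_apply]; rfl

lemma basisMap_mem_unitary {g : (Q → Bool) → (Q → Bool)}
    (hg : Function.Injective g) :
    basisMap g ∈ Matrix.unitaryGroup (Q → Bool) ℂ := by
  rw [Matrix.mem_unitaryGroup_iff', Matrix.star_eq_conjTranspose]
  ext x y
  rw [mul_basisMap_apply]
  simp only [Matrix.conjTranspose_apply, basisMap, Matrix.one_apply, hg.eq_iff, eq_comm]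
  split_ifs <;> simp

end BasisMap

/-! ## Gates and circuits -/

section Gates

variable {R Q Q' : Type}

/-- The gate on the wires of `Q'` that is obtained by an embedding of wires. -/
def Gate.map (r : Q ↪ Q') : Gate R Q → Gate R Q'
  | .single q u => .single (r q) u
  | .cnot c t h => .cnot (r c) (r t) (r.injective.ne h)
  | .toffoli c₁ c₂ t h h₁ h₂ =>
    .toffoli (r c₁) (r c₂) (r t) (r.injective.ne h) (r.injective.ne h₁) (r.injective.ne h₂)
  | .prepR s => .prepR (s.trans r)
  | .prepLAdj s => .prepLAdj (s.trans r)

lemma queryCount_map (r : Q ↪ Q') (c : List (Gate R Q)) :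
    queryCount (c.map (Gate.map r)) = queryCount c := by
  simp only [queryCount, List.countP_map]
  congr 1
  funext g
  cases g <;> rfl

lemma queryCount_append (c c' : List (Gate R Q)) :
    queryCount (c ++ c') = queryCount c + queryCount c' := List.countP_append

variable [Fintype R] [DecidableEq R] [DecidableEq Q] [DecidableEq Q']
  (PL PR : Matrix.unitaryGroup (R → Bool) ℂ)

lemma Gate.mat_map (r : Q ↪ Q') (g : Gate R Q) :
    (g.map r).mat PL PR = actOn r (g.mat PL PR) := by
  cases g with
  | single q u =>
    exact (actOn_comp r.injective (fun _ : Unit => q) fun x y => u.1 (x ()) (y ())).symm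
  | cnot c t h =>
    simp only [Gate.map, Gate.mat]
    rw [actOn_basisMap r.injective]
    congr 1; funext y
    exact (overwrite_update r.injective y t _).symm
  | toffoli c₁ c₂ t h h₁ h₂ =>
    simp only [Gate.map, Gate.mat]
    rw [actOn_basisMap r.injective]
    congr 1; funext y
    exact (overwrite_update r.injective y t _).symm
  | prepR s => exact (actOn_comp r.injective _ _).symm
  | prepLAdj s => exact (actOn_comp r.injective _ _).symm

lemma cnot_involutive {c t : Q} (h : c ≠ t) :
    Function.Involutive fun y : Q → Bool => Function.update y t (xor (y t) (y c)) := by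
  intro y
  funext q
  by_cases hq : q = t
  · subst hq; simp [Function.update_of_ne h]
  · simp [Function.update_of_ne hq]

lemma toffoli_involutive {c₁ c₂ t : Q} (h₁ : c₁ ≠ t) (h₂ : c₂ ≠ t) :
    Function.Involutive
      fun y : Q → Bool => Function.update y t (xor (y t) (y c₁ && y c₂)) := by
  intro y
  funext q
  by_cases hq : q = t
  · subst hq; simp [Function.update_of_ne h₁, Function.update_of_ne h₂]
  · simp [Function.update_of_ne hq]

/-- A one-qubit matrix as a matrix on `Unit → Bool`. -/
def unitMat (u : Matrix Bool Bool ℂ) : Matrix (Unit → Bool) (Unit → Bool) ℂ :=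
  fun x y => u (x ()) (y ())

lemma unitMat_mul (u v : Matrix Bool Bool ℂ) : unitMat (u * v) = unitMat u * unitMat v := by
  ext x y
  simp only [unitMat, Matrix.mul_apply]
  exact (Equiv.sum_comp (Equiv.funUnique Unit Bool) fun b => u (x ()) b * v b (y ())).symm

lemma unitMat_conjTranspose (u : Matrix Bool Bool ℂ) :
    (unitMat u).conjTranspose = unitMat u.conjTranspose := rfl

lemma unitMat_one : unitMat 1 = 1 := by
  ext x y
  simp only [unitMat, Matrix.one_apply, funext_iff]
  exact if_congr ⟨fun h _ => h, fun h => h ()⟩ rfl rfl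

lemma unitMat_mem_unitary {u : Matrix Bool Bool ℂ} (hu : u ∈ Matrix.unitaryGroup Bool ℂ) :
    unitMat u ∈ Matrix.unitaryGroup (Unit → Bool) ℂ := by
  rw [Matrix.mem_unitaryGroup_iff, Matrix.star_eq_conjTranspose, unitMat_conjTranspose,
    ← unitMat_mul, ← Matrix.star_eq_conjTranspose, Matrix.mem_unitaryGroup_iff.1 hu, unitMat_one]

/-- The one-qubit matrix `u` acting on the wire `q`. -/
abbrev onWire (q : Q) (u : Matrix Bool Bool ℂ) : Matrix (Q → Bool) (Q → Bool) ℂ :=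
  actOn (fun _ : Unit => q) (unitMat u)

lemma onWire_injective {Q : Type} (q : Q) : Function.Injective fun _ : Unit => q :=
  fun _ _ _ => rfl

variable [Fintype Q] [Fintype Q']

lemma Gate.mat_mem_unitary (g : Gate R Q) : g.mat PL PR ∈ Matrix.unitaryGroup (Q → Bool) ℂ := by
  cases g with
  | single q u => exact actOn_mem_unitary (onWire_injective q) (unitMat_mem_unitary u.2)
  | cnot c t h => exact basisMap_mem_unitary (cnot_involutive h).injective
  | toffoli c₁ c₂ t h h₁ h₂ => exact basisMap_mem_unitary (toffoli_involutive h₁ h₂).injective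
  | prepR r => exact actOn_mem_unitary r.injective PR.2
  | prepLAdj r => exact actOn_mem_unitary r.injective (star PL).2

lemma circuitMat_foldl (c : List (Gate R Q)) (M : Matrix (Q → Bool) (Q → Bool) ℂ) :
    c.foldl (fun M g => g.mat PL PR * M) M = circuitMat PL PR c * M := by
  induction c generalizing M with
  | nil => simp [circuitMat]
  | cons g c ih =>
    simp only [circuitMat, List.foldl_cons]
    rw [ih, ih (g.mat PL PR * 1)]
    simp [mul_assoc]

lemma circuitMat_nil : circuitMat PL PR ([] : List (Gate R Q)) = 1 := rfl

lemma circuitMat_cons (g : Gate R Q) (c : List (Gate R Q)) :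
    circuitMat PL PR (g :: c) = circuitMat PL PR c * g.mat PL PR := by
  conv_lhs => rw [circuitMat, List.foldl_cons, circuitMat_foldl, mul_one]

lemma circuitMat_append (c c' : List (Gate R Q)) :
    circuitMat PL PR (c ++ c') = circuitMat PL PR c' * circuitMat PL PR c := by
  conv_lhs => rw [circuitMat, List.foldl_append, circuitMat_foldl]
  rfl

lemma circuitMat_mem_unitary (c : List (Gate R Q)) :
    circuitMat PL PR c ∈ Matrix.unitaryGroup (Q → Bool) ℂ := by
  induction c with
  | nil => exact one_mem _
  | cons g c ih => rw [circuitMat_cons]; exact mul_mem ih (g.mat_mem_unitary PL PR)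

lemma circuitMat_map (r : Q ↪ Q') (c : List (Gate R Q)) :
    circuitMat PL PR (c.map (Gate.map r)) = actOn r (circuitMat PL PR c) := by
  induction c with
  | nil => exact (actOn_one r).symm
  | cons g c ih =>
    rw [List.map_cons, circuitMat_cons, circuitMat_cons, ih, Gate.mat_map, actOn_mul r.injective]

end Gates

/-! ## Circuits with work wires that are returned clean -/

section Impl

variable {R Q W W' : Type}

/-- The basis state with `y` on the main wires and `0` on the work wires. -/
def withZero (W : Type) (y : Q → Bool) : Q ⊕ W → Bool := Sum.elim y fun _ => false

@[simp] lemma withZero_inr (y : Q → Bool) (w : W) : withZero W y (.inr w) = false := rfl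
@[simp] lemma withZero_comp_inl (y : Q → Bool) : withZero W y ∘ Sum.inl = y := rfl
@[simp] lemma withZero_comp_inr (y : Q → Bool) : withZero W y ∘ Sum.inr = fun _ => false := rfl

open Classical in
/-- `U` maps `|y⟩|0⟩` to `A|y⟩ ⊗ |0⟩`. -/
def Clean (U : Matrix (Q ⊕ W → Bool) (Q ⊕ W → Bool) ℂ) (A : Matrix (Q → Bool) (Q → Bool) ℂ) :
    Prop :=
  ∀ x y, U x (withZero W y) = if x ∘ Sum.inr = (fun _ => false) then A (x ∘ Sum.inl) y else 0

/-- The first factor to act leaves no amplitude on states with a nonzero work wire, so only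
intermediate states of the form `withZero W z` contribute, and on these the other factor is clean as
well. -/
lemma Clean.mul [Fintype Q] [DecidableEq Q] [Fintype W] [DecidableEq W]
    {U U' : Matrix (Q ⊕ W → Bool) (Q ⊕ W → Bool) ℂ}
    {A A' : Matrix (Q → Bool) (Q → Bool) ℂ} (h : Clean U A) (h' : Clean U' A') :
    Clean (U * U') (A * A') := by
  classical
  intro x y
  rw [Matrix.mul_apply, Matrix.mul_apply]
  simp_rw [h' _ y]
  have hinj : Function.Injective (withZero (Q := Q) W) := fun a b hab => by
    rw [← withZero_comp_inl (W := W) a, hab, withZero_comp_inl]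
  rw [← Fintype.sum_of_injective (withZero W) hinj (fun z => U x (withZero W z) * A' z y)]
  · simp_rw [h x]
    split_ifs <;> simp
  · intro z hz
    rw [if_neg, mul_zero]
    intro h0
    apply hz
    refine ⟨z ∘ Sum.inl, ?_⟩
    funext q
    cases q with
    | inl q => rfl
    | inr w => exact (congrFun h0 w).symm
  · intro z; simp

/-- Work wires that are not used keep their value `0`, so the work space can be enlarged. This
allows circuits with different work spaces to be composed. -/
lemma Clean.map {U : Matrix (Q ⊕ W → Bool) (Q ⊕ W → Bool) ℂ}
    {A : Matrix (Q → Bool) (Q → Bool) ℂ} (h : Clean U A) (j : W → W') :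
    Clean (actOn (Sum.map (id : Q → Q) j) U) A := by
  classical
  intro x y
  have e1 : withZero W' y ∘ Sum.map (id : Q → Q) j = withZero W y := by
    funext q; cases q <;> rfl
  have e2 : (x ∘ Sum.map (id : Q → Q) j) ∘ Sum.inl = x ∘ Sum.inl := rfl
  by_cases hx : x ∘ Sum.inr = fun _ => false
  · rw [if_pos hx, actOn_apply_of_agree, e1, h, if_pos, e2]
    · funext w; exact congrFun hx (j w)
    · intro q hq
      cases q with
      | inl q => exact absurd ⟨.inl q, rfl⟩ hq
      | inr w => exact congrFun hx w
  · rw [if_neg hx]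
    by_contra h0
    have h1 := agree_of_actOn_ne_zero h0
    rw [actOn_apply_of_agree _ h1, e1, h] at h0
    apply hx
    by_cases h2 : (x ∘ Sum.map (id : Q → Q) j) ∘ Sum.inr = fun _ => false
    · funext w
      by_cases hw : w ∈ Set.range j
      · obtain ⟨v, rfl⟩ := hw
        exact congrFun h2 v
      · refine h1 (.inr w) ?_
        rintro ⟨q, hq⟩
        cases q with
        | inl q => cases hq
        | inr v => exact hw ⟨v, Sum.inr.inj hq⟩
    · rw [if_neg h2] at h0; exact absurd rfl h0

variable [Fintype R] [DecidableEq R] [Fintype Q] [DecidableEq Q]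
  (PL PR : Matrix.unitaryGroup (R → Bool) ℂ)

/-- The matrix `A` is implemented by a circuit with at most `k` gates and queries, at most `m` of
them queries, with the help of work wires that start and end in `0`. -/
def Impl (A : Matrix (Q → Bool) (Q → Bool) ℂ) (k m : ℕ) : Prop :=
  ∃ (W : Type) (_ : Fintype W) (_ : DecidableEq W) (c : List (Gate R (Q ⊕ W))),
    c.length ≤ k ∧ queryCount c ≤ m ∧ Clean (circuitMat PL PR c) A

variable {PL PR}

lemma Impl.mono {A : Matrix (Q → Bool) (Q → Bool) ℂ} {k k' m m' : ℕ} (h : Impl PL PR A k m)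
    (hk : k ≤ k') (hm : m ≤ m') : Impl PL PR A k' m' := by
  obtain ⟨W, i1, i2, c, h1, h2, h3⟩ := h
  exact ⟨W, i1, i2, c, h1.trans hk, h2.trans hm, h3⟩

/-- The two circuits are put on disjoint copies of work wires; the order of the lists is reversed
because the right factor of a product acts first. -/
lemma Impl.mul {A A' : Matrix (Q → Bool) (Q → Bool) ℂ} {k k' m m' : ℕ} (h : Impl PL PR A k m)
    (h' : Impl PL PR A' k' m') : Impl PL PR (A * A') (k + k') (m + m') := by
  obtain ⟨W, i1, i2, c, h1, h2, h3⟩ := h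
  obtain ⟨W', j1, j2, c', h1', h2', h3'⟩ := h'
  refine ⟨W ⊕ W', inferInstance, inferInstance,
    c'.map (Gate.map ⟨Sum.map id Sum.inr, Function.injective_id.sumMap Sum.inr_injective⟩) ++
    c.map (Gate.map ⟨Sum.map id Sum.inl, Function.injective_id.sumMap Sum.inl_injective⟩), ?_, ?_,
    ?_⟩
  · simp only [List.length_append, List.length_map]; omega
  · simp only [queryCount_append, queryCount_map]; omega
  · rw [circuitMat_append, circuitMat_map, circuitMat_map]
    exact (h3.map Sum.inl).mul (h3'.map Sum.inr)

lemma Impl.one : Impl PL PR (1 : Matrix (Q → Bool) (Q → Bool) ℂ) 0 0 := by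
  refine ⟨Empty, inferInstance, inferInstance, [], le_rfl, le_rfl, ?_⟩
  intro x y
  have hx : x ∘ (Sum.inr : Empty → Q ⊕ Empty) = fun _ => false := funext fun w => w.elim
  rw [if_pos hx, circuitMat_nil, Matrix.one_apply, Matrix.one_apply]
  congr 1
  apply propext
  constructor
  · rintro rfl; rfl
  · rintro rfl; funext q; cases q with
    | inl q => rfl
    | inr w => exact w.elim

lemma Impl.gate (g : Gate R Q) : Impl PL PR (g.mat PL PR) 1 (queryCount [g]) := by
  refine ⟨Empty, inferInstance, inferInstance, [g.map ⟨Sum.inl, Sum.inl_injective⟩], le_rfl,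
    (queryCount_map _ [g]).le, ?_⟩
  intro x y
  have hx : x ∘ (Sum.inr : Empty → Q ⊕ Empty) = fun _ => false := funext fun w => w.elim
  rw [if_pos hx, circuitMat_cons, circuitMat_nil, one_mul, Gate.mat_map]
  exact actOn_apply_of_agree _ fun q hq => by
    cases q with
    | inl q => exact absurd ⟨q, rfl⟩ hq
    | inr w => exact w.elim

lemma Impl.pow {A : Matrix (Q → Bool) (Q → Bool) ℂ} {k : ℕ} (h : Impl PL PR A k 0) (l : ℕ) :
    Impl PL PR (A ^ l) (l * k) 0 := by
  induction l with
  | zero => simpa using Impl.one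
  | succ l ih => rw [pow_succ, add_mul, one_mul]; exact ih.mul h

lemma Impl.onWire (q : Q) {u : Matrix Bool Bool ℂ} (hu : u ∈ Matrix.unitaryGroup Bool ℂ) :
    Impl PL PR (onWire q u) 1 0 := Impl.gate (Gate.single q ⟨u, hu⟩)

lemma Impl.prepR (r : R ↪ Q) : Impl PL PR (actOn r PR.1) 1 1 := Impl.gate (Gate.prepR r)

lemma Impl.prepLAdj (r : R ↪ Q) : Impl PL PR (actOn r PL.1.conjTranspose) 1 1 :=
  Impl.gate (Gate.prepLAdj r)

end Impl

/-! ## Straight-line programs of Boolean functions -/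

/-- A list of Boolean functions of the wires in `S` in which each function is a variable, a
constant, or the conjunction or exclusive or of two functions further down in the list. -/
inductive SL {Q : Type} (S : Set Q) : List ((Q → Bool) → Bool) → Prop
  | nil : SL S []
  | var {L : List ((Q → Bool) → Bool)} (q : Q) (hq : q ∈ S) (h : SL S L) :
    SL S ((fun x => x q) :: L)
  | tt {L : List ((Q → Bool) → Bool)} (h : SL S L) : SL S ((fun _ => true) :: L)
  | and {L : List ((Q → Bool) → Bool)} {f g : (Q → Bool) → Bool} (hf : f ∈ L) (hg : g ∈ L)
    (h : SL S L) : SL S ((fun x => f x && g x) :: L)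
  | xor {L : List ((Q → Bool) → Bool)} {f g : (Q → Bool) → Bool} (hf : f ∈ L) (hg : g ∈ L)
    (h : SL S L) : SL S ((fun x => Bool.xor (f x) (g x)) :: L)

section Compile

variable {R Q : Type}

/-- Used for uncomputation: changing wires outside `S` leaves all computed values valid. -/
lemma SL.congr {S : Set Q} {L : List ((Q → Bool) → Bool)} (h : SL S L) {x y : Q → Bool}
    (hxy : ∀ q ∈ S, x q = y q) : ∀ f ∈ L, f x = f y := by
  induction h with
  | nil => simp
  | var q hq _ ih => exact List.forall_mem_cons.2 ⟨hxy q hq, ih⟩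
  | tt _ ih => exact List.forall_mem_cons.2 ⟨rfl, ih⟩
  | and hf hg _ ih => exact List.forall_mem_cons.2 ⟨by simp only [ih _ hf, ih _ hg], ih⟩
  | xor hf hg _ ih => exact List.forall_mem_cons.2 ⟨by simp only [ih _ hf, ih _ hg], ih⟩

/-- Boolean negation as a unitary matrix. -/
def pauliX : Matrix.unitaryGroup Bool ℂ :=
  ⟨Matrix.of fun a b => if a = !b then 1 else 0, by
    rw [Matrix.mem_unitaryGroup_iff]
    ext a b
    cases a <;> cases b <;> simp [Matrix.mul_apply]⟩

lemma basisMap_id [Fintype Q] [DecidableEq Q] : basisMap (fun x : Q → Bool => x) = 1 := by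
  ext x y
  simp [basisMap, Matrix.one_apply]

variable [Fintype R] [DecidableEq R] [Fintype Q] [DecidableEq Q]
  (PL PR : Matrix.unitaryGroup (R → Bool) ℂ)

lemma mat_pauliX (q : Q) : (Gate.single q pauliX : Gate R Q).mat PL PR =
    basisMap fun y => Function.update y q (Bool.xor (y q) true) := by
  ext x y
  simp only [Gate.mat, actOn, basisMap, pauliX, Matrix.of_apply]
  have : (x = Function.update y q (Bool.xor (y q) true)) ↔
      (∀ q', q' ∉ Set.range (fun _ : Unit => q) → x q' = y q') ∧ x q = !(y q) := by
    constructor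
    · rintro rfl
      refine ⟨fun q' hq' => Function.update_of_ne ?_ _ _, by simp⟩
      rintro rfl
      exact hq' ⟨(), rfl⟩
    · rintro ⟨h1, h2⟩
      funext q'
      by_cases hq : q' = q
      · subst hq; simp [h2]
      · rw [Function.update_of_ne hq]
        exact h1 q' fun ⟨_, h⟩ => hq h.symm
  by_cases h1 : ∀ q', q' ∉ Set.range (fun _ : Unit => q) → x q' = y q'
  · by_cases h2 : x q = !(y q)
    · rw [if_pos h1, if_pos (this.2 ⟨h1, h2⟩)]; exact if_pos h2
    · rw [if_pos h1, if_neg fun h => h2 (this.1 h).2]; exact if_neg h2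
  · rw [if_neg h1, if_neg fun h => h1 (this.1 h).1]

/-- Circuits that write the values of all functions of the list `L` on fresh work wires, and that
undo this. -/
structure Compiled (S : Set Q) (L : List ((Q → Bool) → Bool)) (W : Type) [Fintype W]
    [DecidableEq W] where
  c : List (Gate R (Q ⊕ W))
  c' : List (Gate R (Q ⊕ W))
  g : (Q ⊕ W → Bool) → (Q ⊕ W → Bool)
  g' : (Q ⊕ W → Bool) → (Q ⊕ W → Bool)
  length_le : c.length ≤ 2 * L.length
  length_le' : c'.length ≤ 2 * L.length
  query : queryCount c = 0
  query' : queryCount c' = 0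
  mat : circuitMat PL PR c = basisMap g
  mat' : circuitMat PL PR c' = basisMap g'
  inv : ∀ s, g' (g s) = s
  main : ∀ y q, g (withZero W y) (.inl q) = y q
  out : ∀ f ∈ L, ∃ w, ∀ y, g (withZero W y) (.inr w) = f y
  work : ∀ w, ∃ f ∈ L, ∀ y, g (withZero W y) (.inr w) = f y

variable {PL PR}

/-- One fresh wire receives the value of one more function. The extra gates `e` add `F` to this
wire, where `F` does not read it, so they are their own inverse; the circuit that undoes everything
runs `e` first and then the old inverse. The hypothesis on `f` is needed only for states in which
the earlier values are already in place. -/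
lemma Compiled.cons {S : Set Q} {L : List ((Q → Bool) → Bool)} {W : Type} [Fintype W]
    [DecidableEq W] (h : Compiled PL PR S L W) (f : (Q → Bool) → Bool)
    (e : List (Gate R (Q ⊕ (W ⊕ Unit)))) (F : (Q ⊕ (W ⊕ Unit) → Bool) → Bool)
    (he : e.length ≤ 2) (hq : queryCount e = 0)
    (hF : ∀ s b, F (Function.update s (.inr (.inr ())) b) = F s)
    (hmat : circuitMat PL PR e = basisMap fun s =>
      Function.update s (.inr (.inr ())) (Bool.xor (s (.inr (.inr ()))) (F s)))
    (hf : ∀ y s, (∀ q, s (.inl q) = y q) →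
      (∀ w, s (.inr (.inl w)) = h.g (withZero W y) (.inr w)) → F s = f y) :
    Nonempty (Compiled PL PR S (f :: L) (W ⊕ Unit)) := by
  let r : Q ⊕ W ↪ Q ⊕ (W ⊕ Unit) :=
    ⟨Sum.map id Sum.inl, Function.injective_id.sumMap Sum.inl_injective⟩
  let k : (Q ⊕ (W ⊕ Unit) → Bool) → (Q ⊕ (W ⊕ Unit) → Bool) := fun s =>
      Function.update s (.inr (.inr ())) (Bool.xor (s (.inr (.inr ()))) (F s))
  have hk : ∀ s, k (k s) = s := by
    intro s
    simp only [k]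
    rw [hF]
    simp
  have hnew : ∀ s y, overwrite r s y (.inr (.inr ())) = y (.inr (.inr ())) := by
    intro s y
    apply overwrite_off
    rintro ⟨q, hq⟩
    cases q with
    | inl q => cases hq
    | inr q => cases hq
  have hin : ∀ s y q, overwrite r s y (.inl q) = s (.inl q) := fun s y q =>
    overwrite_apply r.injective s y (.inl q)
  have hin' : ∀ s y w, overwrite r s y (.inr (.inl w)) = s (.inr w) := fun s y w =>
    overwrite_apply r.injective s y (.inr w)
  have hz : ∀ y, withZero (W ⊕ Unit) y ∘ r = withZero W y := by
    intro y; funext q; cases q <;> rfl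
  have hval : ∀ y, F (overwrite r (h.g (withZero (W ⊕ Unit) y ∘ r)) (withZero _ y)) = f y := by
    intro y
    apply hf
    · intro q; rw [hin, hz, h.main]
    · intro w; rw [hin', hz]
  refine ⟨⟨h.c.map (Gate.map r) ++ e, e ++ h.c'.map (Gate.map r),
    fun s => k (overwrite r (h.g (s ∘ r)) s), fun s => overwrite r (h.g' (k s ∘ r)) (k s),
    ?_, ?_, ?_, ?_, ?_, ?_, ?_, ?_, ?_, ?_⟩⟩
  · have := h.length_le
    simp only [List.length_append, List.length_map, List.length_cons]; omega
  · have := h.length_le'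
    simp only [List.length_append, List.length_map, List.length_cons]; omega
  · rw [queryCount_append, queryCount_map, h.query, hq]
  · rw [queryCount_append, queryCount_map, h.query', hq]
  · rw [circuitMat_append, circuitMat_map, h.mat, hmat, actOn_basisMap r.injective, basisMap_mul]
    rfl
  · rw [circuitMat_append, circuitMat_map, h.mat', hmat, actOn_basisMap r.injective, basisMap_mul]
    rfl
  · intro s
    rw [hk, overwrite_comp r.injective, h.inv]
    exact overwrite_eq r.injective (fun q hq => overwrite_off _ _ hq) rfl
  · intro y q
    simp only [k]
    rw [Function.update_of_ne (by simp), hin, hz, h.main]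

  · intro f' hf'
    rcases List.mem_cons.1 hf' with rfl | hf'
    · refine ⟨.inr (), fun y => ?_⟩
      simp only [k]
      rw [Function.update_self, hval, hnew]
      simp
    · obtain ⟨w, hw⟩ := h.out f' hf'
      refine ⟨.inl w, fun y => ?_⟩
      simp only [k]
      rw [Function.update_of_ne (by simp), hin', hz, hw]
  · rintro (w | w)
    · obtain ⟨f', hf', hw⟩ := h.work w
      refine ⟨f', List.mem_cons_of_mem _ hf', fun y => ?_⟩
      simp only [k]
      rw [Function.update_of_ne (by simp), hin', hz, hw]
    · refine ⟨f, List.mem_cons_self, fun y => ?_⟩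
      simp only [k]
      rw [Function.update_self, hval, hnew]
      simp

lemma circuitMat_singleton (g : Gate R Q) : circuitMat PL PR [g] = g.mat PL PR := by
  rw [circuitMat_cons, circuitMat_nil, one_mul]

lemma SL.compile {S : Set Q} {L : List ((Q → Bool) → Bool)} (h : SL S L) :
    ∃ (W : Type) (_ : Fintype W) (_ : DecidableEq W), Nonempty (Compiled PL PR S L W) := by
  induction h with
  | nil =>
    refine ⟨Empty, inferInstance, inferInstance, ⟨⟨[], [], id, id, le_rfl, le_rfl, rfl, rfl, ?_, ?_,
      fun _ => rfl, fun _ _ => rfl, by simp, fun w => w.elim⟩⟩⟩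
    · exact basisMap_id.symm
    · exact basisMap_id.symm
  | @var L q hq _ ih =>
    obtain ⟨W, i1, i2, ⟨h⟩⟩ := ih
    refine ⟨W ⊕ Unit, inferInstance, inferInstance, h.cons _
      [.cnot (.inl q) (.inr (.inr ())) (by simp)] (fun s => s (.inl q)) (by simp) rfl ?_ ?_ ?_⟩
    · intro s b; simp
    · rw [circuitMat_singleton]; rfl
    · intro y s h1 h2; exact h1 q
  | @tt L _ ih =>
    obtain ⟨W, i1, i2, ⟨h⟩⟩ := ih
    refine ⟨W ⊕ Unit, inferInstance, inferInstance, h.cons _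
      [.single (.inr (.inr ())) pauliX] (fun s => true) (by simp) rfl ?_ ?_ ?_⟩
    · intro s b; simp
    · rw [circuitMat_singleton, mat_pauliX]
    · intro y s h1 h2; rfl
  | @and L f g hf hg _ ih =>
    obtain ⟨W, i1, i2, ⟨h⟩⟩ := ih
    obtain ⟨w₁, hw₁⟩ := h.out f hf
    obtain ⟨w₂, hw₂⟩ := h.out g hg
    -- A Toffoli gate needs distinct controls; when both operands sit on the same wire, the
    -- conjunction is a copy.
    by_cases hw : w₁ = w₂
    · refine ⟨W ⊕ Unit, inferInstance, inferInstance, h.cons _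
        [.cnot (.inr (.inl w₁)) (.inr (.inr ())) (by simp)] (fun s => s (.inr (.inl w₁)))
        (by simp) rfl ?_ ?_ ?_⟩
      · intro s b; simp
      · rw [circuitMat_singleton]; rfl
      · intro y s h1 h2
        have : f y = g y := by rw [← hw₁, ← hw₂, hw]
        rw [h2, hw₁, ← this, Bool.and_self]
    · refine ⟨W ⊕ Unit, inferInstance, inferInstance, h.cons _
        [.toffoli (.inr (.inl w₁)) (.inr (.inl w₂)) (.inr (.inr ())) (by simpa using hw) (by simp)
          (by simp)] (fun s => s (.inr (.inl w₁)) && s (.inr (.inl w₂)))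
        (by simp) rfl ?_ ?_ ?_⟩
      · intro s b; simp
      · rw [circuitMat_singleton]; rfl
      · intro y s h1 h2
        rw [h2, h2, hw₁, hw₂]
  | @xor L f g hf hg _ ih =>
    obtain ⟨W, i1, i2, ⟨h⟩⟩ := ih
    obtain ⟨w₁, hw₁⟩ := h.out f hf
    obtain ⟨w₂, hw₂⟩ := h.out g hg
    refine ⟨W ⊕ Unit, inferInstance, inferInstance, h.cons _
        [.cnot (.inr (.inl w₁)) (.inr (.inr ())) (by simp),
          .cnot (.inr (.inl w₂)) (.inr (.inr ())) (by simp)]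
        (fun s => Bool.xor (s (.inr (.inl w₁))) (s (.inr (.inl w₂))))
        (by simp) rfl ?_ ?_ ?_⟩
    · intro s b; simp
    · rw [circuitMat_cons, circuitMat_singleton]
      simp only [Gate.mat]
      rw [basisMap_mul]
      congr 1
      funext s
      simp
    · intro y s h1 h2
      rw [h2, h2, hw₁, hw₂]

/-! ### Phases and exclusive ors with computed functions -/

/-- The one-qubit phase gate. -/
def phaseGate (ζ : ℂ) : Matrix Bool Bool ℂ := Matrix.diagonal fun b => if b then ζ else 1

lemma phaseGate_mem_unitary {ζ : ℂ} (h : ‖ζ‖ = 1) :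
    phaseGate ζ ∈ Matrix.unitaryGroup Bool ℂ := by
  have : ζ * star ζ = 1 := by
    rw [← starRingEnd_apply, Complex.mul_conj, Complex.normSq_eq_norm_sq, h]; simp
  rw [Matrix.mem_unitaryGroup_iff, Matrix.star_eq_conjTranspose, phaseGate,
    Matrix.diagonal_conjTranspose, Matrix.diagonal_mul_diagonal, ← Matrix.diagonal_one]
  congr 1
  funext b
  cases b
  · simp
  · simpa using this

lemma onWire_diagonal (q : Q) (φ : Bool → ℂ) :
    onWire q (Matrix.diagonal φ) = Matrix.diagonal fun x : Q → Bool => φ (x q) := by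
  ext x y
  by_cases hxy : x = y
  · subst hxy
    rw [onWire, actOn_apply_of_agree _ fun _ _ => rfl, Matrix.diagonal_apply_eq]
    simp [unitMat]
  · rw [Matrix.diagonal_apply_ne _ hxy]
    by_contra h
    have h1 := agree_of_actOn_ne_zero h
    rw [onWire, actOn_apply_of_agree _ h1] at h
    apply hxy
    funext q'
    by_cases hq : q' = q
    · subst hq
      by_contra h2
      exact h (Matrix.diagonal_apply_ne _ h2)
    · exact h1 q' fun ⟨_, h3⟩ => hq h3.symm

/-- The total phase of a list of pairs of a function and a phase. -/
def listPhase {X : Type} (Z : List ((X → Bool) × ℂ)) (x : X) : ℂ :=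
  (Z.map fun z => if z.1 x then z.2 else 1).prod

lemma exists_phase_circuit {X : Type} (Z : List ((X → Bool) × ℂ)) (v : X → Q → Bool)
    (hZ : ∀ z ∈ Z, ‖z.2‖ = 1 ∧ ∃ q, ∀ x, v x q = z.1 x) :
    ∃ (c : List (Gate R Q)) (φ : (Q → Bool) → ℂ), c.length ≤ Z.length ∧ queryCount c = 0 ∧
      circuitMat PL PR c = Matrix.diagonal φ ∧ ∀ x, φ (v x) = listPhase Z x := by
  induction Z with
  | nil => exact ⟨[], fun _ => 1, le_rfl, rfl, Matrix.diagonal_one.symm, fun _ => rfl⟩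
  | cons z Z ih =>
    obtain ⟨c, φ, h1, h2, h3, h4⟩ := ih fun z hz => hZ z (List.mem_cons_of_mem _ hz)
    obtain ⟨hz, q, hq⟩ := hZ z List.mem_cons_self
    refine ⟨.single q ⟨_, phaseGate_mem_unitary hz⟩ :: c,
      fun s => φ s * (if s q then z.2 else 1), Nat.succ_le_succ h1, ?_, ?_, ?_⟩
    · simpa [queryCount, Gate.isQuery] using h2
    · rw [circuitMat_cons, h3]
      have : (Gate.single q ⟨_, phaseGate_mem_unitary hz⟩ : Gate R Q).mat PL PR =
        onWire q (Matrix.diagonal fun b => if b then z.2 else 1) := rfl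
      rw [this, onWire_diagonal, Matrix.diagonal_mul_diagonal]
    · intro x
      simp only [h4, hq, listPhase, List.map_cons, List.prod_cons]
      rw [mul_comm]

/-- Compute the functions, apply one-qubit phase gates to the wires that hold them, uncompute.
Diagonal gates do not change the basis state, so the inverse circuit restores the work wires. The
phases cost one gate each, the two passes `2 * L.length` each. -/
lemma Impl.listPhase {S : Set Q} {L : List ((Q → Bool) → Bool)} (h : SL S L)
    (Z : List (((Q → Bool) → Bool) × ℂ)) (hZ : ∀ z ∈ Z, ‖z.2‖ = 1 ∧ z.1 ∈ L) :
    Impl PL PR (Matrix.diagonal (listPhase Z)) (4 * L.length + Z.length) 0 := by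
  obtain ⟨W, i1, i2, ⟨H⟩⟩ := h.compile (PL := PL) (PR := PR)
  obtain ⟨c, φ, h1, h2, h3, h4⟩ := exists_phase_circuit (PL := PL) (PR := PR) Z
    (fun y => H.g (withZero W y)) fun z hz =>
    ⟨(hZ z hz).1, let ⟨w, hw⟩ := H.out z.1 (hZ z hz).2; ⟨.inr w, hw⟩⟩
  refine ⟨W, i1, i2, H.c ++ c ++ H.c', ?_, ?_, ?_⟩
  · have := H.length_le
    have := H.length_le'
    simp only [List.length_append]; omega
  · rw [queryCount_append, queryCount_append, H.query, h2, H.query']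
  · intro x y
    rw [circuitMat_append, circuitMat_append, H.mat, H.mat', h3, ← mul_assoc, mul_basisMap_apply,
      Matrix.mul_diagonal, h4]
    simp only [basisMap, H.inv]
    by_cases hx : x ∘ Sum.inr = fun _ => false
    · rw [if_pos hx]
      by_cases hxy : x ∘ Sum.inl = y
      · rw [hxy, Matrix.diagonal_apply_eq, if_pos, one_mul]
        funext q
        cases q with
        | inl q => exact congrFun hxy q
        | inr w => exact congrFun hx w
      · rw [Matrix.diagonal_apply_ne _ hxy, if_neg, zero_mul]
        rintro rfl
        exact hxy rfl
    · rw [if_neg hx, if_neg, zero_mul]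
      rintro rfl
      exact hx rfl

lemma exists_cnot_circuit {W : Type} [Fintype W] [DecidableEq W] (T : List Q) (hT : T.Nodup)
    (src : Q → W) :
    ∃ (c : List (Gate R (Q ⊕ W))), c.length ≤ T.length ∧ queryCount c = 0 ∧
      circuitMat PL PR c = basisMap fun s => Sum.elim
        (fun q => if q ∈ T then Bool.xor (s (.inl q)) (s (.inr (src q))) else s (.inl q))
        (s ∘ Sum.inr) := by
  induction T with
  | nil =>
    refine ⟨[], le_rfl, rfl, ?_⟩
    rw [circuitMat_nil, ← basisMap_id]
    congr 1
    funext s q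
    cases q <;> simp
  | cons t T ih =>
    obtain ⟨c, h1, h2, h3⟩ := ih (List.nodup_cons.1 hT).2
    refine ⟨.cnot (.inr (src t)) (.inl t) (by simp) :: c, Nat.succ_le_succ h1, ?_, ?_⟩
    · simpa [queryCount, Gate.isQuery] using h2
    · rw [circuitMat_cons, h3]
      simp only [Gate.mat]
      rw [basisMap_mul]
      congr 1
      funext s q
      cases q with
      | inr w => simp
      | inl q =>
        by_cases hq : q = t
        · subst hq
          simp [(List.nodup_cons.1 hT).1]
        · simp [hq]

/-- Compute the mask, add it to the targets with CNOT gates, uncompute. The last step is legitimate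
because the program reads only wires of `S`, and none of these is a target: the values computed from
the modified state are the same. -/
lemma Impl.xorMask {S : Set Q} {L : List ((Q → Bool) → Bool)} (h : SL S L) (T : Finset Q)
    (hST : ∀ q ∈ S, q ∉ T) (F : (Q → Bool) → Q → Bool) (hF : ∀ q ∈ T, (fun x => F x q) ∈ L)
    (hF' : ∀ q ∉ T, ∀ x, F x q = false) :
    Impl PL PR (basisMap fun x q => Bool.xor (x q) (F x q)) (4 * L.length + T.card) 0 := by
  obtain ⟨W, i1, i2, ⟨H⟩⟩ := h.compile (PL := PL) (PR := PR)
  by_cases hW : T = ∅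
  · subst hW
    refine Impl.mono (k := 0) (m := 0) ?_ (Nat.zero_le _) le_rfl
    have : (fun (x : Q → Bool) q => Bool.xor (x q) (F x q)) = fun x => x := by
      funext x q
      rw [hF' q (by simp), Bool.xor_false]
    rw [this, basisMap_id]
    exact Impl.one
  have : ∀ q, ∃ w, q ∈ T → ∀ y, H.g (withZero W y) (.inr w) = F y q := by
    intro q
    by_cases hq : q ∈ T
    · obtain ⟨w, hw⟩ := H.out _ (hF q hq)
      exact ⟨w, fun _ => hw⟩
    · obtain ⟨t, ht⟩ := Finset.nonempty_iff_ne_empty.2 hW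
      obtain ⟨w, hw⟩ := H.out _ (hF t ht)
      exact ⟨w, fun h => absurd h hq⟩
  choose src hsrc using this
  obtain ⟨c, h1, h2, h3⟩ := exists_cnot_circuit (PL := PL) (PR := PR) T.toList T.nodup_toList src
  refine ⟨W, i1, i2, H.c ++ c ++ H.c', ?_, ?_, ?_⟩
  · have := H.length_le
    have := H.length_le'
    rw [Finset.length_toList] at h1
    simp only [List.length_append]; omega
  · rw [queryCount_append, queryCount_append, H.query, h2, H.query']
  -- After the CNOT gates the state is the one that the forward computation would have produced from
  -- the modified main wires, so the inverse computation clears the work wires.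
  · have key : ∀ y, Sum.elim (fun q => if q ∈ T.toList then
        Bool.xor (H.g (withZero W y) (.inl q)) (H.g (withZero W y) (.inr (src q)))
        else H.g (withZero W y) (.inl q)) (H.g (withZero W y) ∘ Sum.inr) =
        H.g (withZero W fun q => Bool.xor (y q) (F y q)) := by
      intro y
      funext q
      cases q with
      | inl q =>
        rw [H.main]
        by_cases hq : q ∈ T
        · simp only [Sum.elim_inl, Finset.mem_toList, hq, if_true]
          rw [H.main, hsrc q hq]
        · simp only [Sum.elim_inl, Finset.mem_toList, hq, if_false]
          rw [H.main, hF' q hq, Bool.xor_false]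
      | inr w =>
        obtain ⟨f, hf, hw⟩ := H.work w
        simp only [Sum.elim_inr, Function.comp_apply]
        rw [hw, hw]
        refine h.congr (fun q hq => ?_) f hf
        rw [hF' q (hST q hq), Bool.xor_false]
    intro x y
    rw [circuitMat_append, circuitMat_append, H.mat, H.mat', h3, basisMap_mul, basisMap_mul]
    simp only [basisMap, Function.comp_apply, key, H.inv]
    by_cases hx : x ∘ Sum.inr = fun _ => false
    · rw [if_pos hx]
      by_cases hxy : x ∘ Sum.inl = fun q => Bool.xor (y q) (F y q)
      · rw [if_pos hxy, if_pos]
        funext q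
        cases q with
        | inl q => exact congrFun hxy q
        | inr w => exact congrFun hx w
      · rw [if_neg hxy, if_neg]
        rintro rfl
        exact hxy rfl
    · rw [if_neg hx, if_neg]
      rintro rfl
      exact hx rfl

end Compile

/-! ### Counting the steps of computations -/

section Comp

variable {Q : Type} {S : Set Q}

/-- From the functions in `H` one can compute those in `T` in `k` steps, reading wires in `S`. -/
def Comp (S : Set Q) (H T : Set ((Q → Bool) → Bool)) (k : ℕ) : Prop :=
  ∀ L, SL S L → (∀ f ∈ H, f ∈ L) →
    ∃ L', SL S (L' ++ L) ∧ L'.length ≤ k ∧ ∀ f ∈ T, f ∈ L' ++ L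

variable {H H' T T' : Set ((Q → Bool) → Bool)} {k k' : ℕ}

lemma Comp.mono (h : Comp S H T k) (hH : H ⊆ H') (hT : T' ⊆ T) (hk : k ≤ k') :
    Comp S H' T' k' := fun L hL hL' =>
  let ⟨L', h1, h2, h3⟩ := h L hL fun f hf => hL' f (hH hf)
  ⟨L', h1, h2.trans hk, fun f hf => h3 f (hT hf)⟩

lemma Comp.refl (hT : T ⊆ H) : Comp S H T 0 := fun _ hL hL' =>
  ⟨[], hL, le_rfl, fun f hf => hL' f (hT hf)⟩

/-- Since `Comp` quantifies over all programs that contain `H`, a second computation can be run on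
top of the first one and may use its results without recomputing them; hence costs add. -/
lemma Comp.trans (h : Comp S H T k) (h' : Comp S (H ∪ T) T' k') :
    Comp S H (T ∪ T') (k + k') := by
  intro L hL hL'
  obtain ⟨L1, h1, h2, h3⟩ := h L hL hL'
  obtain ⟨L2, h4, h5, h6⟩ := h' (L1 ++ L) h1 (by
    rintro f (hf | hf)
    · exact List.mem_append_right _ (hL' f hf)
    · exact h3 f hf)
  refine ⟨L2 ++ L1, by rwa [List.append_assoc], by rw [List.length_append]; omega, ?_⟩
  rw [List.append_assoc]
  rintro f (hf | hf)
  · exact List.mem_append_right _ (h3 f hf)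
  · exact h6 f hf

lemma Comp.trans' (h : Comp S H T k) (h' : Comp S (H ∪ T) T' k') : Comp S H T' (k + k') :=
  (h.trans h').mono subset_rfl Set.subset_union_right le_rfl

lemma Comp.union (h : Comp S H T k) (h' : Comp S H T' k') : Comp S H (T ∪ T') (k + k') :=
  h.trans (h'.mono Set.subset_union_left subset_rfl le_rfl)

lemma Comp.biUnion {ι : Type} (s : Finset ι) {T : ι → Set ((Q → Bool) → Bool)} {k : ι → ℕ}
    (h : ∀ i ∈ s, Comp S H (T i) (k i)) : Comp S H (⋃ i ∈ s, T i) (∑ i ∈ s, k i) := by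
  classical
  induction s using Finset.induction_on with
  | empty => exact Comp.refl (by simp)
  | insert a s ha ih =>
    rw [Finset.sum_insert ha, Finset.set_biUnion_insert]
    exact (h a (Finset.mem_insert_self a s)).union
      (ih fun i hi => h i (Finset.mem_insert_of_mem hi))

lemma Comp.iUnion {ι : Type} [Fintype ι] {T : ι → Set ((Q → Bool) → Bool)} {k : ℕ}
    (h : ∀ i, Comp S H (T i) k) : Comp S H (⋃ i, T i) (Fintype.card ι * k) := by
  have := Comp.biUnion (Finset.univ : Finset ι) (T := T) (k := fun _ => k) fun i _ => h i
  simpa using this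

lemma Comp.var {q : Q} (hq : q ∈ S) : Comp S H {fun x => x q} 1 := fun L hL _ =>
  ⟨[_], .var q hq hL, le_rfl, by rintro f rfl; simp⟩

lemma Comp.tt : Comp S H {fun _ => true} 1 := fun L hL _ =>
  ⟨[_], .tt hL, le_rfl, by rintro f rfl; simp⟩

variable {f g : (Q → Bool) → Bool}

lemma Comp.and (hf : f ∈ H) (hg : g ∈ H) : Comp S H {fun x => f x && g x} 1 := fun L hL hL' =>
  ⟨[_], .and (hL' f hf) (hL' g hg) hL, le_rfl, by rintro f rfl; simp⟩

lemma Comp.xor (hf : f ∈ H) (hg : g ∈ H) : Comp S H {fun x => Bool.xor (f x) (g x)} 1 :=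
  fun L hL hL' =>
  ⟨[_], .xor (hL' f hf) (hL' g hg) hL, le_rfl, by rintro f rfl; simp⟩

lemma Comp.not (hf : f ∈ H) : Comp S H {fun x => !f x} 2 := by
  have h1 : Comp S H {fun _ => true} 1 := Comp.tt
  have h2 : Comp S (H ∪ {fun _ => true}) {fun x => Bool.xor (f x) true} 1 :=
    Comp.xor (f := f) (g := fun _ => true) (Or.inl hf) (Or.inr rfl)
  simpa using h1.trans' h2

lemma Comp.ff : Comp S H {fun _ => false} 2 := by
  have h1 : Comp S H {fun _ => true} 1 := Comp.tt
  have h2 : Comp S (H ∪ {fun _ => true}) {fun _ => Bool.xor true true} 1 :=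
    Comp.xor (f := fun _ => true) (g := fun _ => true) (Or.inr rfl) (Or.inr rfl)
  exact h1.trans' h2

lemma Comp.and_not (hf : f ∈ H) (hg : g ∈ H) : Comp S H {fun x => f x && !g x} 3 :=
  (Comp.not hg).trans' (Comp.and (Or.inl hf) (Or.inr rfl))

lemma Comp.program (h : Comp S ∅ T k) : ∃ L, SL S L ∧ L.length ≤ k ∧ ∀ f ∈ T, f ∈ L := by
  obtain ⟨L, h1, h2, h3⟩ := h [] .nil (by simp)
  exact ⟨L, by simpa using h1, h2, by simpa using h3⟩

/-- Iteration of a computation. -/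
lemma Comp.iterate {T : ℕ → Set ((Q → Bool) → Bool)} {k n : ℕ}
    (h : ∀ t < n, Comp S (H ∪ T t) (T (t + 1)) k) :
    ∀ m ≤ n, Comp S (H ∪ T 0) (⋃ t ∈ Finset.range (m + 1), T t) (m * k) := by
  intro m hm
  induction m with
  | zero =>
    rw [Nat.zero_mul]
    refine Comp.refl fun f hf => Or.inr ?_
    simpa using hf
  | succ m ih =>
    have h1 := ih (by omega)
    have h2 : Comp S ((H ∪ T 0) ∪ ⋃ t ∈ Finset.range (m + 1), T t) (T (m + 1)) k := by
      refine (h m (by omega)).mono ?_ subset_rfl le_rfl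
      refine Set.union_subset (fun f hf => Or.inl (Or.inl hf)) fun f hf => Or.inr ?_
      exact Set.mem_biUnion (x := m) (by simp) hf
    refine (h1.trans h2).mono subset_rfl ?_ (by ring_nf; omega)
    rw [Finset.range_add_one, Finset.set_biUnion_insert]
    exact (Set.union_comm _ _).subset

end Comp

/-! ## Polynomials on the unit circle -/

section Circle

open Polynomial

/-- The point `x` of `[0,1]` with `z + z⁻¹ = 2 - 4 x`, for `z` on the unit circle. -/
def circlePoint (z : ℂ) : ℝ := (1 - z.re) / 2

/-- On the unit circle `z⁻¹` is the conjugate, so `z + z⁻¹ = 2 Re z` and `4 x z = 2 z - z² - 1`.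
Multiplication by `z` turns polynomials in `x` into polynomials in `z`. -/
lemma circlePoint_mul {z : ℂ} (hz : ‖z‖ = 1) :
    (circlePoint z : ℂ) * z = -(1 / 4) * (z - 1) ^ 2 := by
  have h : z * (starRingEnd ℂ) z = 1 := by
    rw [Complex.mul_conj, Complex.normSq_eq_norm_sq, hz]; simp
  have h2 : (starRingEnd ℂ) z = 2 * (z.re : ℂ) - z := by
    rw [eq_sub_iff_add_eq, add_comm, Complex.add_conj]; push_cast; ring
  rw [h2] at h
  rw [circlePoint]
  push_cast
  linear_combination (-1 / 4 : ℂ) * h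

/-- The polynomial with `|Q(z)| = |x - w|` on the unit circle, where `z + z⁻¹ = 2 - 4 x`. -/
def quadFactor (w : ℂ) : ℂ[X] := C (1 / 4) * ((X - 1) ^ 2 + C (4 * w) * X)

lemma natDegree_quadFactor_le (w : ℂ) : (quadFactor w).natDegree ≤ 2 := by
  rw [quadFactor]; compute_degree

/-- By `circlePoint_mul`, `(x - w) z` is a polynomial in `z` up to sign, and the factor `z` has
modulus one. -/
lemma norm_quadFactor {z : ℂ} (hz : ‖z‖ = 1) (w : ℂ) :
    ‖(quadFactor w).eval z‖ = ‖(circlePoint z : ℂ) - w‖ := by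
  have : (quadFactor w).eval z = -(((circlePoint z : ℂ) - w) * z) := by
    rw [sub_mul, circlePoint_mul hz, quadFactor]
    simp; ring
  rw [this, norm_neg, norm_mul, hz, mul_one]

/-- The right-hand side is affine in `Re z`, hence in the point of `[0,1]`. A real linear factor
without sign change on the interval is thus a squared modulus of a polynomial of degree one, which
keeps the degree bound of the factorization sharp. -/
lemma norm_linear_sq {z : ℂ} (hz : ‖z‖ = 1) (a b : ℝ) :
    ‖(C (a : ℂ) * X + C (b : ℂ)).eval z‖ ^ 2 = a ^ 2 + b ^ 2 + 2 * a * b * z.re := by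
  have h1 : z.re * z.re + z.im * z.im = 1 := by
    rw [← Complex.normSq_apply, Complex.normSq_eq_norm_sq, hz]; norm_num
  rw [← Complex.normSq_eq_norm_sq, Complex.normSq_apply]
  simp
  linear_combination a ^ 2 * h1

/-- Factorization on the unit circle of a polynomial that is nonnegative on `(0,1)`. -/
theorem exists_norm_sq_eq (m : ℕ) : ∀ r : ℝ[X], r.natDegree = m →
    (∀ x ∈ Set.Ioo (0 : ℝ) 1, 0 ≤ r.eval x) →
    ∃ Q : ℂ[X], Q.natDegree ≤ m ∧ ∀ z : ℂ, ‖z‖ = 1 → ‖Q.eval z‖ ^ 2 = r.eval (circlePoint z) := by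
  induction m using Nat.strong_induction_on with
  | _ m ih =>
  intro r hr hpos
  by_cases hm : m = 0
  · subst hm
    rw [natDegree_eq_zero] at hr
    obtain ⟨c, rfl⟩ := hr
    have hc : 0 ≤ c := by simpa using hpos (1 / 2) ⟨by norm_num, by norm_num⟩
    refine ⟨C ((√c : ℝ) : ℂ), by simp, fun z _ => ?_⟩
    simp [Real.sq_sqrt hc]
  have hr0 : r ≠ 0 := by rintro rfl; simp at hr; exact hm hr.symm
  obtain ⟨w, hw⟩ := Complex.exists_root (f := r.map (algebraMap ℝ ℂ)) (by
    rw [degree_map]; exact natDegree_pos_iff_degree_pos.1 (by omega))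
  have hw' : aeval w r = 0 := by
    rw [IsRoot, eval_map_algebraMap] at hw; exact hw
  by_cases him : w.im = 0
  · obtain ⟨w, rfl⟩ : ∃ a : ℝ, (a : ℂ) = w := ⟨w.re, Complex.ext rfl him.symm⟩
    have hroot : r.eval w = 0 := by
      have : ((r.eval w : ℝ) : ℂ) = 0 := by
        rw [← hw']; simpa using (aeval_algebraMap_apply ℂ w r).symm
      exact_mod_cast this
    obtain ⟨r1, rfl⟩ := dvd_iff_isRoot.2 hroot
    have hr1 : r1 ≠ 0 := right_ne_zero_of_mul hr0
    rw [natDegree_mul (X_sub_C_ne_zero w) hr1, natDegree_X_sub_C] at hr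
    simp only [eval_mul, eval_sub, eval_X, eval_C] at hpos
    rcases le_or_gt w 0 with h0 | h0
    · obtain ⟨Q, hQ, hQ'⟩ := ih r1.natDegree (by omega) r1 rfl fun x hx =>
        nonneg_of_mul_nonneg_right (hpos x hx) (by linarith [hx.1])
      -- The points `z = 1` and `z = -1` correspond to `x = 0` and `x = 1`. Matching `x - w` there
      -- requires that the sum of the two coefficients is `√(-w)` and their difference `√(1 - w)`.
      refine ⟨(C (((√(1 - w) + √(-w)) / 2 : ℝ) : ℂ) * X +
        C ((-(√(1 - w) - √(-w)) / 2 : ℝ) : ℂ)) * Q, ?_, fun z hz => ?_⟩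
      · refine natDegree_mul_le.trans ?_
        have := natDegree_linear_le (a := (((√(1 - w) + √(-w)) / 2 : ℝ) : ℂ))
          (b := ((-(√(1 - w) - √(-w)) / 2 : ℝ) : ℂ))
        omega
      · rw [eval_mul, norm_mul, mul_pow, hQ' z hz, norm_linear_sq hz, eval_mul]
        congr 1
        have e1 := Real.sq_sqrt (show 0 ≤ 1 - w by linarith)
        have e2 := Real.sq_sqrt (show 0 ≤ -w by linarith)
        simp only [eval_sub, eval_X, eval_C, circlePoint]
        linear_combination (1 / 2 - z.re / 2) * e1 + (1 / 2 + z.re / 2) * e2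
    rcases le_or_gt 1 w with h1 | h1
    · obtain ⟨Q, hQ, hQ'⟩ := ih (-r1).natDegree (by rw [natDegree_neg]; omega) (-r1) rfl
        fun x hx => by
          have := hpos x hx
          rw [eval_neg]
          nlinarith [hx.2]
      rw [natDegree_neg] at hQ
      -- Now the factor is `w - x`, with the values `w` at `z = 1` and `w - 1` at `z = -1`; the sign
      -- is moved to the cofactor.
      refine ⟨(C (((√w + √(w - 1)) / 2 : ℝ) : ℂ) * X +
        C (((√w - √(w - 1)) / 2 : ℝ) : ℂ)) * Q, ?_, fun z hz => ?_⟩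
      · refine natDegree_mul_le.trans ?_
        have := natDegree_linear_le (a := (((√w + √(w - 1)) / 2 : ℝ) : ℂ))
          (b := (((√w - √(w - 1)) / 2 : ℝ) : ℂ))
        omega
      · rw [eval_mul, norm_mul, mul_pow, hQ' z hz, norm_linear_sq hz, eval_mul]
        have e1 := Real.sq_sqrt (show 0 ≤ w by linarith)
        have e2 := Real.sq_sqrt (show 0 ≤ w - 1 by linarith)
        have e3 : ((√w + √(w - 1)) / 2) ^ 2 + ((√w - √(w - 1)) / 2) ^ 2 +
            2 * ((√w + √(w - 1)) / 2) * ((√w - √(w - 1)) / 2) * z.re = w - circlePoint z := by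
          rw [circlePoint]
          linear_combination (1 / 2 + z.re / 2) * e1 + (1 / 2 - z.re / 2) * e2
        rw [e3]
        simp only [eval_sub, eval_X, eval_C, eval_neg]
        ring
    · have hc : Continuous fun x => r1.eval x := r1.continuous
      have hI : Set.Ioo (0 : ℝ) 1 ∈ nhds w := Ioo_mem_nhds h0 h1
      -- A root inside the interval is at least double: the cofactor is nonpositive to its left and
      -- nonnegative to its right, so it vanishes there by continuity.
      have hr1w : r1.eval w = 0 := by
        refine le_antisymm ?_ ?_
        · refine le_of_tendsto (hc.continuousAt.tendsto.mono_left
            (nhdsWithin_le_nhds (s := Set.Iio w))) ?_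
          filter_upwards [nhdsWithin_le_nhds hI, self_mem_nhdsWithin] with x hx hxw
          have := hpos x hx
          have hxw' : x < w := hxw
          nlinarith
        · refine ge_of_tendsto (hc.continuousAt.tendsto.mono_left
            (nhdsWithin_le_nhds (s := Set.Ioi w))) ?_
          filter_upwards [nhdsWithin_le_nhds hI, self_mem_nhdsWithin] with x hx hxw
          exact nonneg_of_mul_nonneg_right (hpos x hx) (sub_pos.2 hxw)
      obtain ⟨r2, rfl⟩ := dvd_iff_isRoot.2 hr1w
      have hr2 : r2 ≠ 0 := right_ne_zero_of_mul hr1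
      rw [natDegree_mul (X_sub_C_ne_zero w) hr2, natDegree_X_sub_C] at hr
      simp only [eval_mul, eval_sub, eval_X, eval_C] at hpos
      have hne : ∀ x ∈ Set.Ioo (0 : ℝ) 1, x ≠ w → 0 ≤ r2.eval x := by
        intro x hx hxw
        have h2 : 0 < (x - w) ^ 2 := by have := sub_ne_zero.2 hxw; positivity
        have := hpos x hx
        exact nonneg_of_mul_nonneg_right (by rwa [sq, mul_assoc]) h2
      obtain ⟨Q, hQ, hQ'⟩ := ih r2.natDegree (by omega) r2 rfl fun x hx => by
        by_cases hxw : x = w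
        · subst hxw
          refine ge_of_tendsto (r2.continuous.continuousAt.tendsto.mono_left
            (nhdsWithin_le_nhds (s := {x}ᶜ))) ?_
          filter_upwards [nhdsWithin_le_nhds hI, self_mem_nhdsWithin] with y hy hyx
          exact hne y hy hyx
        · exact hne x hx hxw
      refine ⟨quadFactor w * Q, ?_, fun z hz => ?_⟩
      · refine natDegree_mul_le.trans ?_
        have := natDegree_quadFactor_le w
        omega
      · rw [eval_mul, norm_mul, mul_pow, hQ' z hz, norm_quadFactor hz, ← Complex.ofReal_sub,
          Complex.norm_real, Real.norm_eq_abs, sq_abs]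
        simp only [eval_mul, eval_sub, eval_X, eval_C]
        ring
  -- A nonreal root comes with its conjugate, and the quadratic factor of the pair equals `|x - w|²`
  -- on the real line, the square of the modulus of `quadFactor w`.
  · obtain ⟨r1, rfl⟩ := Polynomial.quadratic_dvd_of_aeval_eq_zero_im_ne_zero r hw' him
    have hr1 : r1 ≠ 0 := right_ne_zero_of_mul hr0
    have hdeg : (X ^ 2 - C (2 * w.re) * X + C (‖w‖ ^ 2) : ℝ[X]).natDegree = 2 := by
      compute_degree!
    rw [natDegree_mul (left_ne_zero_of_mul hr0) hr1, hdeg] at hr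
    have hval : ∀ x : ℝ, (X ^ 2 - C (2 * w.re) * X + C (‖w‖ ^ 2) : ℝ[X]).eval x =
        ‖(x : ℂ) - w‖ ^ 2 := by
      intro x
      rw [← Complex.normSq_eq_norm_sq, ← Complex.normSq_eq_norm_sq, Complex.normSq_apply,
        Complex.normSq_apply]
      simp
      ring
    obtain ⟨Q, hQ, hQ'⟩ := ih r1.natDegree (by omega) r1 rfl fun x hx => by
      have := hpos x hx
      rw [eval_mul, hval] at this
      refine nonneg_of_mul_nonneg_right this ?_
      have : (x : ℂ) - w ≠ 0 := by
        intro h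
        apply him
        rw [← sub_eq_zero.1 h, Complex.ofReal_im]
      positivity
    refine ⟨quadFactor w * Q, ?_, fun z hz => ?_⟩
    · refine natDegree_mul_le.trans ?_
      have := natDegree_quadFactor_le w
      omega
    · rw [eval_mul, norm_mul, mul_pow, hQ' z hz, norm_quadFactor hz, eval_mul, hval]

/-- The polynomial `P` with `P(z) = z ^ N q(x)`, where `z + z⁻¹ = 2 - 4 x`. -/
def circlePoly (N : ℕ) (q : ℝ[X]) : ℂ[X] :=
  ∑ k ∈ Finset.range (N + 1), C (q.coeff k : ℂ) * X ^ (N - k) * (C (-(1 / 4)) * (X - 1) ^ 2) ^ k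

lemma natDegree_circlePoly_le (N : ℕ) (q : ℝ[X]) : (circlePoly N q).natDegree ≤ 2 * N := by
  refine natDegree_sum_le_of_forall_le _ _ fun k hk => ?_
  have hk' := Finset.mem_range.1 hk
  have h1 : (C (-(1 / 4) : ℂ) * (X - 1) ^ 2 : ℂ[X]).natDegree ≤ 2 := by compute_degree
  have h2 := natDegree_pow_le_of_le k h1
  have h3 := natDegree_mul_le_of_le (natDegree_C_mul_X_pow_le (q.coeff k : ℂ) (N - k)) h2
  omega

lemma eval_circlePoly {N : ℕ} {q : ℝ[X]} (hq : q.natDegree ≤ N) {z : ℂ} (hz : ‖z‖ = 1) :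
    (circlePoly N q).eval z = z ^ N * (q.eval (circlePoint z) : ℝ) := by
  rw [circlePoly, eval_finsetSum, eval_eq_sum_range' (Nat.lt_succ_of_le hq)]
  push_cast
  rw [Finset.mul_sum]
  refine Finset.sum_congr rfl fun k hk => ?_
  have hk' := Finset.mem_range.1 hk
  have h1 : (C (-(1 / 4) : ℂ) * (X - 1) ^ 2 : ℂ[X]).eval z = circlePoint z * z := by
    rw [circlePoint_mul hz]; simp
  rw [eval_mul, eval_pow, h1]
  simp only [eval_mul, eval_C, eval_pow, eval_X]
  rw [show z ^ N = z ^ (N - k) * z ^ k by rw [← pow_add]; congr 1; omega]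
  ring

/-- The bound on `q` makes `1 - q²` nonnegative on the interval, and its degree is at most `2 N`, so
`exists_norm_sq_eq` factors it without exceeding the degree of `circlePoly N q`. -/
lemma exists_complement {N : ℕ} {q : ℝ[X]} (hq : q.natDegree ≤ N)
    (hb : ∀ x ∈ Set.Icc (0 : ℝ) 1, |q.eval x| ≤ 1) :
    ∃ Q : ℂ[X], Q.natDegree ≤ 2 * N ∧
      ∀ z : ℂ, ‖z‖ = 1 → ‖(circlePoly N q).eval z‖ ^ 2 + ‖Q.eval z‖ ^ 2 = 1 := by
  obtain ⟨Q, h1, h2⟩ := exists_norm_sq_eq _ (1 - q ^ 2) rfl fun x hx => by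
    have := hb x ⟨hx.1.le, hx.2.le⟩
    simp only [eval_sub, eval_one, eval_pow]
    nlinarith [sq_abs (q.eval x), abs_nonneg (q.eval x)]
  refine ⟨Q, h1.trans ?_, fun z hz => ?_⟩
  · refine (natDegree_sub_le _ _).trans ?_
    rw [natDegree_one]
    have := natDegree_pow_le_of_le 2 hq
    omega
  · rw [h2 z hz, eval_circlePoly hq hz, norm_mul, norm_pow, hz, Complex.norm_real, Real.norm_eq_abs]
    simp

end Circle

/-! ## Polynomial pairs from sequences of rotations -/

section Rotations

open Polynomial

/-- The unitary matrix whose columns are the eigenvectors of the real rotations. -/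
def rotBasis : Matrix Bool Bool ℂ := Matrix.of fun a b =>
  ((1 / √2 : ℝ) : ℂ) * (if a then (if b then Complex.I else -Complex.I) else 1)

lemma sqrt_two_inv_mul : ((1 / √2 : ℝ) : ℂ) * ((1 / √2 : ℝ) : ℂ) = 1 / 2 := by
  rw [← Complex.ofReal_mul, div_mul_div_comm, Real.mul_self_sqrt (by norm_num)]
  norm_num

lemma rotBasis_mem_unitary : rotBasis ∈ Matrix.unitaryGroup Bool ℂ := by
  have h := sqrt_two_inv_mul
  have hI := Complex.I_mul_I
  rw [Matrix.mem_unitaryGroup_iff, Matrix.star_eq_conjTranspose]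
  ext a b
  cases a <;> cases b <;>
    simp only [rotBasis, Matrix.mul_apply, Matrix.conjTranspose_apply, Matrix.of_apply,
      Fintype.sum_bool, Matrix.one_apply, star_mul', Complex.star_def, Complex.conj_ofReal,
      map_one, map_neg, Complex.conj_I, if_true, if_false, Bool.false_eq_true, reduceCtorEq]
  · linear_combination 2 * h
  · ring
  · ring
  · linear_combination 2 * h - 2 * hI * ((1 / √2 : ℝ) : ℂ) * ((1 / √2 : ℝ) : ℂ)

lemma rotBasis_mem_unitary' : rotBasis.conjTranspose ∈ Matrix.unitaryGroup Bool ℂ :=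
  (star (⟨rotBasis, rotBasis_mem_unitary⟩ : Matrix.unitaryGroup Bool ℂ)).2

lemma diagonal_mem_unitary {φ : Bool → ℂ} (h : ∀ b, ‖φ b‖ = 1) :
    Matrix.diagonal φ ∈ Matrix.unitaryGroup Bool ℂ := by
  rw [Matrix.mem_unitaryGroup_iff, Matrix.star_eq_conjTranspose, Matrix.diagonal_conjTranspose,
    Matrix.diagonal_mul_diagonal, ← Matrix.diagonal_one]
  congr 1
  funext b
  rw [Pi.star_apply, ← starRingEnd_apply, Complex.mul_conj, Complex.normSq_eq_norm_sq, h]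
  simp

/-- A one-qubit gate with two free pairs of phases. -/
def phaseRot (E F : Bool → ℂ) : Matrix Bool Bool ℂ :=
  Matrix.diagonal E * rotBasis * Matrix.diagonal F * rotBasis.conjTranspose

lemma phaseRot_mem_unitary {E F : Bool → ℂ} (hE : ∀ b, ‖E b‖ = 1) (hF : ∀ b, ‖F b‖ = 1) :
    phaseRot E F ∈ Matrix.unitaryGroup Bool ℂ :=
  mul_mem (mul_mem (mul_mem (diagonal_mem_unitary hE) rotBasis_mem_unitary)
    (diagonal_mem_unitary hF)) rotBasis_mem_unitary'

lemma exists_polar (v : ℂ) : ∃ e : ℂ, ‖e‖ = 1 ∧ v = e * (‖v‖ : ℝ) :=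
  ⟨Complex.exp (v.arg * Complex.I), Complex.norm_exp_ofReal_mul_I _, by
    rw [mul_comm]; exact (Complex.norm_mul_exp_arg_mul_I v).symm⟩

/-- Every unit vector is the first column of a rotation with phases. -/
lemma exists_phaseRot (v : Bool → ℂ) (hv : ‖v false‖ ^ 2 + ‖v true‖ ^ 2 = 1) :
    ∃ E F : Bool → ℂ, (∀ b, ‖E b‖ = 1) ∧ (∀ b, ‖F b‖ = 1) ∧
      ∀ b, phaseRot E F b false = v b := by
  obtain ⟨e, he, hve⟩ := exists_polar (v false)
  obtain ⟨e', he', hve'⟩ := exists_polar (v true)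
  -- In the eigenbasis `rotBasis`, the phases `f` and its conjugate form the real rotation by the
  -- argument of `f`, whose first column is `(‖v false‖, ‖v true‖)`. The outer phases restore the
  -- arguments of the entries.
  set f : ℂ := (‖v false‖ : ℝ) + (‖v true‖ : ℝ) * Complex.I with hf
  have hnf : ‖f‖ = 1 := by
    have : ‖f‖ ^ 2 = 1 := by
      rw [← Complex.normSq_eq_norm_sq, hf, Complex.normSq_add_mul_I, hv]
    exact (pow_eq_one_iff_of_nonneg (norm_nonneg f) two_ne_zero).1 this
  refine ⟨fun b => if b then e' else e, fun b => if b then star f else f, ?_, ?_, ?_⟩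
  · intro b; cases b <;> simpa
  · intro b; cases b <;> simpa
  · have h := sqrt_two_inv_mul
    have hsf : star f = (‖v false‖ : ℝ) - (‖v true‖ : ℝ) * Complex.I := by
      rw [hf, star_add, star_mul', Complex.star_def, Complex.conj_ofReal, Complex.conj_ofReal,
        Complex.conj_I]
      ring
    intro b
    cases b
    · conv_rhs => rw [hve]
      simp only [phaseRot, rotBasis, Matrix.mul_apply, Matrix.conjTranspose_apply, Matrix.of_apply,
        Fintype.sum_bool, Matrix.diagonal_apply, star_mul', Complex.star_def, Complex.conj_ofReal,
        map_one, if_true, if_false, Bool.false_eq_true, reduceCtorEq]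
      rw [← Complex.star_def, hsf, hf]
      linear_combination (e * 2 * (‖v false‖ : ℝ)) * h
    · conv_rhs => rw [hve']
      have hI := Complex.I_mul_I
      simp only [phaseRot, rotBasis, Matrix.mul_apply, Matrix.conjTranspose_apply, Matrix.of_apply,
        Fintype.sum_bool, Matrix.diagonal_apply, star_mul', Complex.star_def, Complex.conj_ofReal,
        map_one, if_true, if_false, Bool.false_eq_true, reduceCtorEq]
      rw [← Complex.star_def, hsf, hf]
      linear_combination (e' * 2 * (‖v true‖ : ℝ)) * h -
        (2 * e' * (‖v true‖ : ℝ) * ((1 / √2 : ℝ) : ℂ) * ((1 / √2 : ℝ) : ℂ)) * hI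

/-- The pair of polynomials that results from a sequence of rotations, with a multiplication of
the first entry by the variable before each rotation except the first one. -/
def rotPoly (E F : ℕ → Bool → ℂ) : ℕ → Bool → ℂ[X]
  | 0 => fun b => C (phaseRot (E 0) (F 0) b false)
  | t + 1 => fun b => C (phaseRot (E (t + 1)) (F (t + 1)) b false) * (X * rotPoly E F t false) +
      C (phaseRot (E (t + 1)) (F (t + 1)) b true) * rotPoly E F t true

lemma rotPoly_congr {E F E' F' : ℕ → Bool → ℂ} {L : ℕ} (hE : ∀ t ≤ L, E t = E' t)
    (hF : ∀ t ≤ L, F t = F' t) : rotPoly E F L = rotPoly E' F' L := by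
  induction L with
  | zero => simp only [rotPoly, hE 0 le_rfl, hF 0 le_rfl]
  | succ L ih =>
    simp only [rotPoly, hE _ le_rfl, hF _ le_rfl,
      ih (fun t ht => hE t (by omega)) fun t ht => hF t (by omega)]

lemma infinite_circle : {z : ℂ | ‖z‖ = 1}.Infinite := by
  have h : IsPreconnected (Metric.sphere (0 : ℂ) 1) :=
    isPreconnected_sphere (by rw [Complex.rank_real_complex]; norm_num) 0 1
  have h2 : {z : ℂ | ‖z‖ = 1} = Metric.sphere (0 : ℂ) 1 := by ext z; simp
  rw [h2]
  exact h.infinite_of_nontrivial ⟨1, by simp, -1, by simp, by norm_num⟩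

/-- On the unit circle the conjugate of `z` is its inverse, so reversing and conjugating the
coefficients amounts to conjugating the value, up to `z ^ L`. This makes the condition on the norms
an identity between polynomials. -/
lemma eval_reflect_conj {L : ℕ} {p : ℂ[X]} (hp : p.natDegree ≤ L) {z : ℂ} (hz : ‖z‖ = 1) :
    (reflect L (p.map (starRingEnd ℂ))).eval z = z ^ L * (starRingEnd ℂ) (p.eval z) := by
  have hz0 : z ≠ 0 := by rintro rfl; simp at hz
  have hinv : z * (starRingEnd ℂ) z = 1 := by
    rw [Complex.mul_conj, Complex.normSq_eq_norm_sq, hz]; simp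
  let _ : Invertible ((starRingEnd ℂ) z) := ⟨z, hinv, by rw [mul_comm]; exact hinv⟩
  have h := eval₂_reflect_mul_pow (RingHom.id ℂ) ((starRingEnd ℂ) z) L (p.map (starRingEnd ℂ))
    (by rwa [natDegree_map])
  have h2 : ⅟((starRingEnd ℂ) z) = z := rfl
  rw [h2] at h
  have h3 : eval₂ (RingHom.id ℂ) ((starRingEnd ℂ) z) (p.map (starRingEnd ℂ)) =
      (starRingEnd ℂ) (p.eval z) := by
    rw [← eval, eval_map, eval₂_at_apply]
  rw [h3, ← eval] at h
  rw [← h, mul_comm, mul_assoc, ← mul_pow, mul_comm _ z, hinv, one_pow, mul_one]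

/-- The extreme coefficients of a pair of polynomials of norm `1` on the unit circle. -/
lemma extreme_coeff_orthogonal {L : ℕ} (hL : 0 < L) {p : Bool → ℂ[X]}
    (hp : ∀ b, (p b).natDegree ≤ L)
    (h1 : ∀ z : ℂ, ‖z‖ = 1 → ‖(p false).eval z‖ ^ 2 + ‖(p true).eval z‖ ^ 2 = 1) :
    (p false).coeff L * (starRingEnd ℂ) ((p false).coeff 0) +
      (p true).coeff L * (starRingEnd ℂ) ((p true).coeff 0) = 0 := by
  have hid : p false * reflect L ((p false).map (starRingEnd ℂ)) +
      p true * reflect L ((p true).map (starRingEnd ℂ)) = X ^ L := by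
    refine eq_of_infinite_eval_eq _ _ (infinite_circle.mono fun z hz => ?_)
    have hz' : ‖z‖ = 1 := hz
    simp only [Set.mem_ofPred_eq, eval_add, eval_mul, eval_pow, eval_X,
      eval_reflect_conj (hp _) hz']
    have := h1 z hz'
    have e : ∀ w : ℂ, w * (starRingEnd ℂ) w = ((‖w‖ ^ 2 : ℝ) : ℂ) := fun w => by
      rw [Complex.mul_conj, Complex.normSq_eq_norm_sq]
    have e2 : (((‖(p false).eval z‖ ^ 2 + ‖(p true).eval z‖ ^ 2 : ℝ)) : ℂ) = 1 := by
      rw [this]; simp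
    push_cast at e2
    have ea := e ((p false).eval z)
    have eb := e ((p true).eval z)
    push_cast at ea eb
    linear_combination z ^ L * ea + z ^ L * eb + z ^ L * e2
  -- The coefficient of degree `2 L` pairs top coefficients with conjugated constant coefficients;
  -- on the right it is zero because `L > 0`.
  have hc := congrArg (fun f => f.coeff (L + L)) hid
  simp only [coeff_add, coeff_X_pow] at hc
  have hr : ∀ b, (reflect L ((p b).map (starRingEnd ℂ))).natDegree ≤ L := fun b => by
    refine (natDegree_reflect_le).trans ?_
    rw [natDegree_map]
    exact max_le le_rfl (hp b)
  rw [coeff_mul_add_eq_of_natDegree_le (hp _) (hr _),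
    coeff_mul_add_eq_of_natDegree_le (hp _) (hr _), if_neg (by omega), coeff_reflect,
    coeff_reflect, revAt_le le_rfl, Nat.sub_self, coeff_map, coeff_map] at hc
  exact hc

/-- Intended for the vectors `a` of top and `b` of constant coefficients. If `a` is nonzero, its
normalization works by orthogonality; if `a = 0`, any unit vector orthogonal to `b` does. -/
lemma exists_unit_vector (a b : Bool → ℂ)
    (h : a false * (starRingEnd ℂ) (b false) + a true * (starRingEnd ℂ) (b true) = 0) :
    ∃ v : Bool → ℂ, ‖v false‖ ^ 2 + ‖v true‖ ^ 2 = 1 ∧ (∃ c : ℂ, ∀ i, a i = c * v i) ∧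
      (starRingEnd ℂ) (v false) * b false + (starRingEnd ℂ) (v true) * b true = 0 := by
  have key : ∀ u : Bool → ℂ, (∃ i, u i ≠ 0) →
      ∃ s : ℝ, s ≠ 0 ∧ ‖(s : ℂ) * u false‖ ^ 2 + ‖(s : ℂ) * u true‖ ^ 2 = 1 := by
    intro u ⟨i, hi⟩
    have hpos : 0 < ‖u false‖ ^ 2 + ‖u true‖ ^ 2 := by
      cases i
      · have := norm_pos_iff.2 hi; positivity
      · have := norm_pos_iff.2 hi; positivity
    refine ⟨1 / √(‖u false‖ ^ 2 + ‖u true‖ ^ 2), by positivity, ?_⟩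
    rw [norm_mul, norm_mul, mul_pow, mul_pow, ← mul_add, Complex.norm_real, Real.norm_eq_abs,
      sq_abs, div_pow, Real.sq_sqrt hpos.le]
    field_simp
  have h' : (starRingEnd ℂ) (a false) * b false + (starRingEnd ℂ) (a true) * b true = 0 := by
    have := congrArg (starRingEnd ℂ) h
    simpa using this
  by_cases ha : ∃ i, a i ≠ 0
  · obtain ⟨s, hs, hs1⟩ := key a ha
    refine ⟨fun i => s * a i, hs1, ⟨(s : ℂ)⁻¹, fun i => ?_⟩, ?_⟩
    · rw [inv_mul_cancel_left₀ (by exact_mod_cast hs)]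
    · simp only [map_mul, Complex.conj_ofReal]
      linear_combination (s : ℂ) * h'
  have ha' : ∀ i, a i = 0 := fun i => by
    by_contra h0; exact ha ⟨i, h0⟩
  by_cases hb : ∃ i, b i ≠ 0
  · obtain ⟨i, hi⟩ := hb
    obtain ⟨s, hs, hs1⟩ := key (fun i => if i then (starRingEnd ℂ) (b false)
      else -(starRingEnd ℂ) (b true)) ⟨!i, by cases i <;> simpa using hi⟩
    refine ⟨fun i => s * (if i then (starRingEnd ℂ) (b false) else -(starRingEnd ℂ) (b true)),
      hs1, ⟨0, fun i => by rw [ha' i, zero_mul]⟩, ?_⟩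
    simp
    ring
  · have hb' : ∀ i, b i = 0 := fun i => by
      by_contra h0; exact hb ⟨i, h0⟩
    exact ⟨fun i => if i then 0 else 1, by simp, ⟨0, fun i => by rw [ha' i, zero_mul]⟩,
      by simp [hb']⟩

lemma norm_sq_unitary_conj {U : Matrix Bool Bool ℂ} (hU : U ∈ Matrix.unitaryGroup Bool ℂ)
    (x y : ℂ) :
    ‖(starRingEnd ℂ) (U false false) * x + (starRingEnd ℂ) (U true false) * y‖ ^ 2 +
      ‖(starRingEnd ℂ) (U false true) * x + (starRingEnd ℂ) (U true true) * y‖ ^ 2 =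
      ‖x‖ ^ 2 + ‖y‖ ^ 2 := by
  have hU' := Matrix.mem_unitaryGroup_iff.1 hU
  have h00 := congrFun (congrFun hU' false) false
  have h01 := congrFun (congrFun hU' false) true
  have h10 := congrFun (congrFun hU' true) false
  have h11 := congrFun (congrFun hU' true) true
  simp only [Matrix.mul_apply, Matrix.star_apply, Fintype.sum_bool, Matrix.one_apply, if_true,
    if_false, Bool.false_eq_true, reduceCtorEq] at h00 h01 h10 h11
  have e : ∀ w : ℂ, ((‖w‖ ^ 2 : ℝ) : ℂ) = w * star w := fun w => by
    rw [← starRingEnd_apply, Complex.mul_conj, Complex.normSq_eq_norm_sq]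
  apply Complex.ofReal_injective
  rw [Complex.ofReal_add, Complex.ofReal_add, e, e, e, e]
  simp only [starRingEnd_apply, star_add, star_mul', star_star]
  linear_combination x * star x * h00 + y * star y * h11 + x * star y * h10 + y * star x * h01

/-- Every pair of polynomials of norm `1` on the unit circle results from rotations. -/
theorem exists_rotPoly (L : ℕ) : ∀ p : Bool → ℂ[X], (∀ b, (p b).natDegree ≤ L) →
    (∀ z : ℂ, ‖z‖ = 1 → ‖(p false).eval z‖ ^ 2 + ‖(p true).eval z‖ ^ 2 = 1) →
    ∃ E F : ℕ → Bool → ℂ, (∀ t b, ‖E t b‖ = 1) ∧ (∀ t b, ‖F t b‖ = 1) ∧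
      rotPoly E F L = p := by
  induction L with
  | zero =>
    intro p hp h1
    have hC : ∀ b, p b = C ((p b).coeff 0) := fun b =>
      eq_C_of_natDegree_le_zero (hp b)
    obtain ⟨E, F, hE, hF, hv⟩ := exists_phaseRot (fun b => (p b).coeff 0) (by
      have := h1 1 (by simp)
      rw [hC false, hC true] at this
      simpa using this)
    refine ⟨fun _ => E, fun _ => F, fun _ => hE, fun _ => hF, ?_⟩
    funext b
    simp only [rotPoly, hv]
    exact (hC b).symm
  | succ L ih =>
    intro p hp h1
    obtain ⟨v, hv1, ⟨c, hc⟩, hv0⟩ := exists_unit_vector (fun b => (p b).coeff (L + 1))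
      (fun b => (p b).coeff 0) (extreme_coeff_orthogonal (Nat.succ_pos L) hp h1)
    obtain ⟨E, F, hE, hF, hv⟩ := exists_phaseRot v hv1
    set U := phaseRot E F with hUdef
    have hU : U ∈ Matrix.unitaryGroup Bool ℂ := phaseRot_mem_unitary hE hF
    -- The last rotation is undone. Its first column is `v`, so the first entry loses its constant
    -- coefficient, since `v` is orthogonal to the vector of constant coefficients. The second
    -- column is orthogonal to `v`, so the second entry loses its top coefficient. Dividing the
    -- first entry by the variable leaves a pair of degree at most `L`, still of norm one on the
    -- circle.
    let p' : Bool → ℂ[X] := fun b => C ((starRingEnd ℂ) (U false b)) * p false +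
      C ((starRingEnd ℂ) (U true b)) * p true
    have hUU := Matrix.mem_unitaryGroup_iff.1 hU
    have hUU' := Matrix.mem_unitaryGroup_iff'.1 hU
    have hback : ∀ b, p b = C (U b false) * p' false + C (U b true) * p' true := by
      intro b
      have e0 := congrFun (congrFun hUU b) false
      have e1 := congrFun (congrFun hUU b) true
      simp only [Matrix.mul_apply, Matrix.star_apply, Fintype.sum_bool] at e0 e1
      have e0' := congrArg (C : ℂ → ℂ[X]) e0
      have e1' := congrArg (C : ℂ → ℂ[X]) e1
      simp only [C_add, C_mul] at e0' e1'
      simp only [p', starRingEnd_apply]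
      cases b
      · simp only [Matrix.one_apply, if_true, reduceCtorEq, if_false, C_1, C_0] at e0' e1'
        linear_combination -p false * e0' - p true * e1'
      · simp only [Matrix.one_apply, if_true, reduceCtorEq, if_false, C_1, C_0] at e0' e1'
        linear_combination -p false * e0' - p true * e1'
    have hdeg : ∀ b, (p' b).natDegree ≤ L + 1 := fun b =>
      natDegree_add_le_of_degree_le ((natDegree_C_mul_le _ _).trans (hp _))
        ((natDegree_C_mul_le _ _).trans (hp _))
    have hcoef0 : (p' false).coeff 0 = 0 := by
      simp only [p', coeff_add, coeff_C_mul, hv]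
      exact hv0
    have hcoefL : (p' true).coeff (L + 1) = 0 := by
      have e := congrFun (congrFun hUU' true) false
      simp only [Matrix.mul_apply, Matrix.star_apply, Fintype.sum_bool, Matrix.one_apply,
        if_false, reduceCtorEq] at e
      have c0 := hc false
      have c1 := hc true
      simp only [p', coeff_add, coeff_C_mul, starRingEnd_apply, c0, c1, ← hv]
      linear_combination c * e
    obtain ⟨p0, hp0⟩ := X_dvd_iff.2 hcoef0
    have hp0deg : p0.natDegree ≤ L := by
      by_cases h0 : p0 = 0
      · rw [h0]; simp
      · have := hdeg false
        rw [hp0, natDegree_X_mul h0] at this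
        omega
    have hp1deg : (p' true).natDegree ≤ L := by
      rw [natDegree_le_iff_coeff_eq_zero]
      intro k hk
      by_cases hk' : k = L + 1
      · rw [hk', hcoefL]
      · exact coeff_eq_zero_of_natDegree_lt (lt_of_le_of_lt (hdeg true) (by omega))
    obtain ⟨E', F', hE', hF', hEF⟩ := ih (fun b => if b then p' true else p0)
      (fun b => by cases b <;> simpa) (fun z hz => by
        have := norm_sq_unitary_conj hU ((p false).eval z) ((p true).eval z)
        rw [h1 z hz] at this
        have e0 : (starRingEnd ℂ) (U false false) * (p false).eval z +
            (starRingEnd ℂ) (U true false) * (p true).eval z = z * p0.eval z := by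
          have := congrArg (eval z) hp0
          simpa [p'] using this
        have e1 : (starRingEnd ℂ) (U false true) * (p false).eval z +
            (starRingEnd ℂ) (U true true) * (p true).eval z = (p' true).eval z := by
          simp [p']
        rw [e0, e1, norm_mul, hz, one_mul] at this
        simpa using this)
    refine ⟨fun t => if t = L + 1 then E else E' t, fun t => if t = L + 1 then F else F' t,
      ?_, ?_, ?_⟩
    · intro t; dsimp only; split_ifs; exacts [hE, hE' t]
    · intro t; dsimp only; split_ifs; exacts [hF, hF' t]
    · have hprev : rotPoly (fun t => if t = L + 1 then E else E' t)
          (fun t => if t = L + 1 then F else F' t) L = fun b => if b then p' true else p0 := by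
        rw [← hEF]
        apply rotPoly_congr
        · intro t ht; rw [if_neg (by omega)]
        · intro t ht; rw [if_neg (by omega)]
      funext b
      rw [rotPoly, hprev, if_pos rfl, if_pos rfl, hback b, hp0]
      simp [hUdef]

/-- The rotations of generalized quantum signal processing for a real polynomial that is bounded
by `1` on `[0,1]`. -/
theorem exists_rotPoly_circlePoly {N : ℕ} {q : ℝ[X]} (hq : q.natDegree ≤ N)
    (hb : ∀ x ∈ Set.Icc (0 : ℝ) 1, |q.eval x| ≤ 1) :
    ∃ E F : ℕ → Bool → ℂ, (∀ t b, ‖E t b‖ = 1) ∧ (∀ t b, ‖F t b‖ = 1) ∧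
      rotPoly E F (2 * N) false = circlePoly N q := by
  obtain ⟨Q, h1, h2⟩ := exists_complement hq hb
  obtain ⟨E, F, hE, hF, h⟩ := exists_rotPoly (2 * N) (fun b => if b then Q else circlePoly N q)
    (fun b => by cases b; exacts [natDegree_circlePoly_le N q, h1]) (by simpa using h2)
  exact ⟨E, F, hE, hF, by rw [h]; rfl⟩

end Rotations

/-! ## Matrices that act within a set of wires -/

section ActsIn

variable {Q A A' : Type}

/-- The matrix changes only the wires in `S`. -/
def ActsIn (S : Set Q) (M : Matrix (Q → Bool) (Q → Bool) ℂ) : Prop :=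
  ∀ x y, M x y ≠ 0 → ∀ q ∉ S, x q = y q

/-- The function does not depend on the wires in `S`. -/
def Indep {β : Type} (S : Set Q) (f : (Q → Bool) → β) : Prop :=
  ∀ x y, (∀ q ∉ S, x q = y q) → f x = f y

lemma actsIn_actOn (r : A → Q) (u : Matrix (A → Bool) (A → Bool) ℂ) :
    ActsIn (Set.range r) (actOn r u) := fun _ _ h => agree_of_actOn_ne_zero h

lemma ActsIn.mono {S S' : Set Q} {M : Matrix (Q → Bool) (Q → Bool) ℂ} (h : ActsIn S M)
    (hS : S ⊆ S') : ActsIn S' M := fun x y hxy q hq => h x y hxy q fun h' => hq (hS h')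

variable [Fintype Q] [DecidableEq Q]

lemma actsIn_diagonal (S : Set Q) (f : (Q → Bool) → ℂ) : ActsIn S (Matrix.diagonal f) := by
  intro x y h q _
  by_cases hxy : x = y
  · rw [hxy]
  · exact absurd (Matrix.diagonal_apply_ne _ hxy) h

lemma actsIn_one (S : Set Q) : ActsIn S (1 : Matrix (Q → Bool) (Q → Bool) ℂ) := by
  rw [← Matrix.diagonal_one]; exact actsIn_diagonal S _

lemma ActsIn.mul {S : Set Q} {M M' : Matrix (Q → Bool) (Q → Bool) ℂ} (h : ActsIn S M)
    (h' : ActsIn S M') : ActsIn S (M * M') := by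
  intro x y hxy q hq
  rw [Matrix.mul_apply] at hxy
  obtain ⟨z, -, hz⟩ := Finset.exists_ne_zero_of_sum_ne_zero hxy
  exact (h x z (left_ne_zero_of_mul hz) q hq).trans (h' z y (right_ne_zero_of_mul hz) q hq)

lemma ActsIn.pow {S : Set Q} {M : Matrix (Q → Bool) (Q → Bool) ℂ} (h : ActsIn S M) (k : ℕ) :
    ActsIn S (M ^ k) := by
  induction k with
  | zero => rw [pow_zero]; exact actsIn_one S
  | succ k ih => rw [pow_succ]; exact ih.mul h

/-- An intermediate state can differ from `x` only in wires of `S` and only in wires of `S'`, hence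
not at all. So diagonal entries are multiplicative for operators on disjoint wires, which yields the
products over the directions. -/
lemma ActsIn.mul_apply_self {S S' : Set Q} {M M' : Matrix (Q → Bool) (Q → Bool) ℂ}
    (h : ActsIn S M) (h' : ActsIn S' M') (hS : Disjoint S S') (x : Q → Bool) :
    (M * M') x x = M x x * M' x x := by
  rw [Matrix.mul_apply, Finset.sum_eq_single x]
  · intro z _ hz
    by_contra h0
    apply hz
    funext q
    by_cases hq : q ∈ S
    · exact h' z x (right_ne_zero_of_mul h0) q (Set.disjoint_left.1 hS hq)
    · exact (h x z (left_ne_zero_of_mul h0) q hq).symm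
  · simp

lemma actsIn_list_prod {ι : Type} {S : ι → Set Q} {M : ι → Matrix (Q → Bool) (Q → Bool) ℂ}
    (h : ∀ i, ActsIn (S i) (M i)) (l : List ι) :
    ActsIn (⋃ i ∈ l, S i) (l.map M).prod := by
  induction l with
  | nil => exact actsIn_one _
  | cons a l ih =>
    rw [List.map_cons, List.prod_cons]
    refine ((h a).mono ?_).mul (ih.mono ?_)
    · exact Set.subset_biUnion_of_mem (u := S) (by simp : a ∈ {i | i ∈ a :: l})
    · exact Set.biUnion_subset_biUnion_left fun i hi => List.mem_cons_of_mem _ hi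

lemma list_prod_apply_self {ι : Type} {S : ι → Set Q}
    {M : ι → Matrix (Q → Bool) (Q → Bool) ℂ} (h : ∀ i, ActsIn (S i) (M i))
    (hS : ∀ i j, i ≠ j → Disjoint (S i) (S j)) (l : List ι) (hl : l.Nodup) (x : Q → Bool) :
    (l.map M).prod x x = (l.map fun i => M i x x).prod := by
  induction l with
  | nil => simp
  | cons a l ih =>
    rw [List.map_cons, List.prod_cons, List.map_cons, List.prod_cons,
      (h a).mul_apply_self (actsIn_list_prod h l), ih (List.nodup_cons.1 hl).2]
    rw [Set.disjoint_iUnion₂_right]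
    intro i hi
    exact hS a i fun hai => (List.nodup_cons.1 hl).1 (hai ▸ hi)

variable [Fintype A] [DecidableEq A] [Fintype A'] [DecidableEq A']

lemma commute_actOn_diagonal {r : A → Q} (u : Matrix (A → Bool) (A → Bool) ℂ)
    {f : (Q → Bool) → ℂ} (hf : Indep (Set.range r) f) :
    Commute (actOn r u) (Matrix.diagonal f) := by
  ext x y
  rw [Matrix.mul_diagonal, Matrix.diagonal_mul]
  by_cases h : actOn r u x y = 0
  · rw [h]; simp
  · rw [hf x y (agree_of_actOn_ne_zero h), mul_comm]

lemma actOn_mul_actOn_apply {r : A → Q} {r' : A' → Q} (hr : Function.Injective r)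
    (h : Disjoint (Set.range r) (Set.range r'))
    (u : Matrix (A → Bool) (A → Bool) ℂ) (v : Matrix (A' → Bool) (A' → Bool) ℂ)
    {x y : Q → Bool} (hxy : ∀ q ∉ Set.range r ∪ Set.range r', x q = y q) :
    (actOn r u * actOn r' v) x y = u (x ∘ r) (y ∘ r) * v (x ∘ r') (y ∘ r') := by
  rw [actOn_mul_apply hr, Finset.sum_eq_single (y ∘ r)]
  · rw [actOn_apply_of_agree]
    · congr 2
      funext a
      exact overwrite_off _ _ (Set.disjoint_right.1 h ⟨a, rfl⟩)
    · intro q hq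
      by_cases hq' : q ∈ Set.range r
      · obtain ⟨a, rfl⟩ := hq'
        rw [overwrite_apply hr]; rfl
      · rw [overwrite_off _ _ hq']
        exact hxy q fun h => h.elim hq' hq
  · intro s _ hs
    by_contra h0
    apply hs
    funext a
    rw [← overwrite_apply hr s x a]
    exact agree_of_actOn_ne_zero (right_ne_zero_of_mul h0) (r a)
      (Set.disjoint_left.1 h ⟨a, rfl⟩)
  · simp

/-- Both products have the same entries by `actOn_mul_actOn_apply`; for states that differ outside
the two registers both entries vanish. -/
lemma commute_actOn {r : A → Q} {r' : A' → Q} (hr : Function.Injective r)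
    (hr' : Function.Injective r') (h : Disjoint (Set.range r) (Set.range r'))
    (u : Matrix (A → Bool) (A → Bool) ℂ) (v : Matrix (A' → Bool) (A' → Bool) ℂ) :
    Commute (actOn r u) (actOn r' v) := by
  ext x y
  by_cases hxy : ∀ q ∉ Set.range r ∪ Set.range r', x q = y q
  · rw [actOn_mul_actOn_apply hr h u v hxy, actOn_mul_actOn_apply hr' h.symm v u
      fun q hq => hxy q fun h => hq h.symm, mul_comm]
  · have h1 : ActsIn (Set.range r ∪ Set.range r') (actOn r u * actOn r' v) :=
      ((actsIn_actOn r u).mono Set.subset_union_left).mul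
        ((actsIn_actOn r' v).mono Set.subset_union_right)
    have h2 : ActsIn (Set.range r ∪ Set.range r') (actOn r' v * actOn r u) :=
      ((actsIn_actOn r' v).mono Set.subset_union_right).mul
        ((actsIn_actOn r u).mono Set.subset_union_left)
    have e1 : (actOn r u * actOn r' v) x y = 0 := by
      by_contra h0; exact hxy (h1 x y h0)
    have e2 : (actOn r' v * actOn r u) x y = 0 := by
      by_contra h0; exact hxy (h2 x y h0)
    rw [e1, e2]

/-- Conjugation of a matrix that preserves the wires of a register. -/
lemma sandwich_apply {r : A → Q} (hr : Function.Injective r)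
    (u v : Matrix (A → Bool) (A → Bool) ℂ) {M : Matrix (Q → Bool) (Q → Bool) ℂ}
    (hM : ∀ x y, M x y ≠ 0 → x ∘ r = y ∘ r) (x y : Q → Bool) :
    (actOn r u.conjTranspose * M * actOn r v) x y =
      ∑ s, star (u s (x ∘ r)) * v s (y ∘ r) * M (overwrite r s x) (overwrite r s y) := by
  rw [mul_actOn_apply hr]
  refine Finset.sum_congr rfl fun s _ => ?_
  rw [actOn_mul_apply hr, Finset.sum_eq_single s, Matrix.conjTranspose_apply]
  · ring
  · intro t _ ht
    by_contra h0
    have := hM _ _ (right_ne_zero_of_mul h0)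
    rw [overwrite_comp hr, overwrite_comp hr] at this
    exact ht this
  · simp

end ActsIn

/-! ## Product states of coins -/

section Coins

variable {R Q A : Type} [Fintype A] [DecidableEq A]

/-- The tensor product of one-qubit matrices. -/
def tensorMat (u : A → Matrix Bool Bool ℂ) : Matrix (A → Bool) (A → Bool) ℂ :=
  Matrix.of fun x y => ∏ a, u a (x a) (y a)

lemma sum_prod_coins {K : Type} [CommSemiring K] (g : A → Bool → K) :
    ∑ s : A → Bool, ∏ a, g a (s a) = ∏ a, (g a true + g a false) := by
  simp_rw [← Fintype.sum_bool]
  rw [Finset.prod_univ_sum, Fintype.piFinset_univ]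

lemma tensorMat_mul (u v : A → Matrix Bool Bool ℂ) :
    tensorMat u * tensorMat v = tensorMat fun a => u a * v a := by
  ext x y
  simp only [tensorMat, Matrix.mul_apply, Matrix.of_apply, ← Finset.prod_mul_distrib]
  rw [sum_prod_coins fun a b => u a (x a) b * v a b (y a)]
  simp only [Fintype.sum_bool]

lemma tensorMat_conjTranspose (u : A → Matrix Bool Bool ℂ) :
    (tensorMat u).conjTranspose = tensorMat fun a => (u a).conjTranspose := by
  ext x y
  simp only [tensorMat, Matrix.conjTranspose_apply, Matrix.of_apply, star_prod]

lemma tensorMat_one : tensorMat (fun _ : A => (1 : Matrix Bool Bool ℂ)) = 1 := by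
  ext x y
  simp only [tensorMat, Matrix.of_apply, Matrix.one_apply]
  by_cases h : x = y
  · subst h; simp
  · rw [if_neg h]
    obtain ⟨a, ha⟩ := Function.ne_iff.1 h
    exact Finset.prod_eq_zero (Finset.mem_univ a) (if_neg ha)

lemma tensorMat_mem_unitary {u : A → Matrix Bool Bool ℂ}
    (hu : ∀ a, u a ∈ Matrix.unitaryGroup Bool ℂ) :
    tensorMat u ∈ Matrix.unitaryGroup (A → Bool) ℂ := by
  rw [Matrix.mem_unitaryGroup_iff, Matrix.star_eq_conjTranspose, tensorMat_conjTranspose,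
    tensorMat_mul, ← tensorMat_one]
  congr 1
  funext a
  exact Matrix.mem_unitaryGroup_iff.1 (hu a)

variable [Fintype R] [DecidableEq R] [Fintype Q] [DecidableEq Q]
  {PL PR : Matrix.unitaryGroup (R → Bool) ℂ}

open Classical in
/-- The tensor product of one-qubit matrices on the wires of a finite set. -/
def layerMat (r : A → Q) (u : A → Matrix Bool Bool ℂ) (s : Finset A) :
    Matrix (Q → Bool) (Q → Bool) ℂ := Matrix.of fun x y =>
  if ∀ q, q ∉ r '' s → x q = y q then ∏ a ∈ s, u a (x (r a)) (y (r a)) else 0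

lemma layerMat_insert {r : A → Q} (hr : Function.Injective r) (u : A → Matrix Bool Bool ℂ)
    {a : A} {s : Finset A} (ha : a ∉ s) :
    layerMat r u (insert a s) = onWire (r a) (u a) * layerMat r u s := by
  ext x y
  have hra : r a ∉ r '' s := by
    rintro ⟨b, hb, hba⟩
    exact ha (hr hba ▸ hb)
  have hw : ∀ (t : Unit → Bool) q, q ≠ r a →
      overwrite (fun _ : Unit => r a) t x q = x q := fun t q hq =>
    overwrite_off t x fun ⟨_, h⟩ => hq h.symm
  have hw' : ∀ t : Unit → Bool, overwrite (fun _ : Unit => r a) t x (r a) = t () := fun t =>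
    overwrite_apply (onWire_injective (r a)) t x ()
  rw [actOn_mul_apply (onWire_injective (r a)), Finset.sum_eq_single (fun _ => y (r a))]
  · by_cases h : ∀ q, q ∉ r '' (insert a s : Finset A) → x q = y q
    · simp only [layerMat, Matrix.of_apply]
      rw [if_pos h, if_pos, Finset.prod_insert ha]
      · congr 1
        refine Finset.prod_congr rfl fun b hb => ?_
        rw [hw _ _ fun h => ha (hr h ▸ hb)]
      · intro q hq
        by_cases hqa : q = r a
        · subst hqa; rw [hw']
        · rw [hw _ _ hqa]
          refine h q ?_
          rw [Finset.coe_insert, Set.image_insert_eq]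
          exact fun h => h.elim hqa hq
    · simp only [layerMat, Matrix.of_apply]
      rw [if_neg h, if_neg, mul_zero]
      intro h'
      apply h
      intro q hq
      rw [Finset.coe_insert, Set.image_insert_eq] at hq
      rw [← h' q fun h => hq (Or.inr h), hw _ _ fun h => hq (Or.inl h)]
  · intro t _ ht
    simp only [layerMat, Matrix.of_apply]
    rw [if_neg, mul_zero]
    intro h
    apply ht
    funext i
    rw [← h (r a) hra, hw']
  · simp

lemma Impl.tensorMat {r : A → Q} (hr : Function.Injective r) {u : A → Matrix Bool Bool ℂ}
    (hu : ∀ a, u a ∈ Matrix.unitaryGroup Bool ℂ) :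
    Impl PL PR (actOn r (tensorMat u)) (Fintype.card A) 0 := by
  have key : ∀ s : Finset A, Impl PL PR (layerMat r u s) s.card 0 := by
    intro s
    induction s using Finset.induction_on with
    | empty =>
      have : layerMat r u ∅ = 1 := by
        ext x y
        simp [layerMat, Matrix.one_apply, funext_iff]
      rw [this]; exact Impl.one
    | insert a s ha ih =>
      rw [layerMat_insert hr u ha, Finset.card_insert_of_notMem ha, add_comm]
      exact (Impl.onWire (r a) (hu a)).mul ih
  have h := key Finset.univ
  have e : layerMat r u Finset.univ = actOn r (QuFEM.tensorMat u) := by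
    ext x y
    simp only [layerMat, Matrix.of_apply, actOn, QuFEM.tensorMat, Finset.coe_univ,
      Set.image_univ, Function.comp_apply]
    split_ifs <;> rfl
  rwa [e] at h

/-- The rotation that maps `|0⟩` to `√(1-π)|0⟩ + √π|1⟩`. -/
def coinMat (π : ℝ) : Matrix Bool Bool ℂ := Matrix.of fun a b =>
  if a = b then ((√(1 - π) : ℝ) : ℂ) else if a then ((√π : ℝ) : ℂ) else -((√π : ℝ) : ℂ)

lemma coinMat_mem_unitary {π : ℝ} (h : π ∈ Set.Icc (0 : ℝ) 1) :
    coinMat π ∈ Matrix.unitaryGroup Bool ℂ := by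
  have h1 : ((√(1 - π) : ℝ) : ℂ) * ((√(1 - π) : ℝ) : ℂ) = 1 - π := by
    rw [← Complex.ofReal_mul, Real.mul_self_sqrt (by linarith [h.2])]; push_cast; rfl
  have h2 : ((√π : ℝ) : ℂ) * ((√π : ℝ) : ℂ) = π := by
    rw [← Complex.ofReal_mul, Real.mul_self_sqrt h.1]
  rw [Matrix.mem_unitaryGroup_iff, Matrix.star_eq_conjTranspose]
  ext a b
  cases a <;> cases b <;>
    simp only [coinMat, Matrix.mul_apply, Matrix.conjTranspose_apply, Matrix.of_apply,
      Fintype.sum_bool, Matrix.one_apply, Complex.star_def, Complex.conj_ofReal,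
      map_neg, if_true, if_false, Bool.false_eq_true, reduceCtorEq]
  · linear_combination h1 + h2
  · ring
  · ring
  · linear_combination h1 + h2

/-- The probability of an outcome of a coin. -/
def coinProb (π : ℝ) (b : Bool) : ℝ := if b then π else 1 - π

lemma coinMat_apply_false {π : ℝ} (h : π ∈ Set.Icc (0 : ℝ) 1) (b : Bool) :
    star (coinMat π b false) * coinMat π b false = (coinProb π b : ℝ) := by
  cases b
  · simp only [coinMat, Matrix.of_apply, if_true, Complex.star_def, Complex.conj_ofReal, coinProb,
      Bool.false_eq_true, if_false]
    rw [← Complex.ofReal_mul, Real.mul_self_sqrt (by linarith [h.2])]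
  · simp only [coinMat, Matrix.of_apply, if_true, Complex.star_def, Complex.conj_ofReal, coinProb,
      if_false, reduceCtorEq]
    rw [← Complex.ofReal_mul, Real.mul_self_sqrt h.1]

/-- An operator that leaves the contents of the coins unchanged acts separately for each outcome.
The amplitudes before and after combine to probabilities, so the block at zero coins is an
expectation over independent coins. -/
lemma coins_sandwich {r : A → Q} (hr : Function.Injective r) {π : A → ℝ}
    (hπ : ∀ a, π a ∈ Set.Icc (0 : ℝ) 1) {M : Matrix (Q → Bool) (Q → Bool) ℂ}
    (hM : ∀ x y, M x y ≠ 0 → x ∘ r = y ∘ r) {x y : Q → Bool} (hx : x ∘ r = fun _ => false)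
    (hy : y ∘ r = fun _ => false) :
    (actOn r (tensorMat fun a => coinMat (π a)).conjTranspose * M *
      actOn r (tensorMat fun a => coinMat (π a))) x y =
      ∑ s, ((∏ a, coinProb (π a) (s a) : ℝ) : ℂ) * M (overwrite r s x) (overwrite r s y) := by
  rw [sandwich_apply hr _ _ hM, hx, hy]
  refine Finset.sum_congr rfl fun s _ => ?_
  congr 1
  simp only [tensorMat, Matrix.of_apply, star_prod]
  rw [← Finset.prod_mul_distrib, Complex.ofReal_prod]
  exact Finset.prod_congr rfl fun a _ => coinMat_apply_false (hπ a) (s a)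

end Coins

/-! ## Generalized quantum signal processing -/

section QSP

open Polynomial

variable {R Q A : Type} [Fintype A] [DecidableEq A] [Fintype Q] [DecidableEq Q]

/-- The sign `(-1) ^ b`. -/
def boolSign (b : Bool) : ℂ := if b then -1 else 1

lemma boolSign_mul_self (b : Bool) : boolSign b * boolSign b = 1 := by
  cases b <;> simp [boolSign]

/-- Whether some wire of a register is `1`. -/
def anyOn (r : A → Q) (x : Q → Bool) : Bool := decide (∃ a, x (r a) = true)

variable (r : A → Q) (u : A → Matrix Bool Bool ℂ) (φ : (Q → Bool) → Bool) (c : Q)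
  (E F : ℕ → (Q → Bool) → Bool → ℂ)

/-- The conjugation by a product of rotations of the sign of a Boolean function. -/
def signConj (φ : (Q → Bool) → Bool) : Matrix (Q → Bool) (Q → Bool) ℂ :=
  actOn r (tensorMat u).conjTranspose * Matrix.diagonal (fun x => boolSign (φ x)) *
    actOn r (tensorMat u)

/-- The reflection that fixes the states in which the register is `0`. -/
def zeroRefl : Matrix (Q → Bool) (Q → Bool) ℂ := Matrix.diagonal fun x => boolSign (anyOn r x)

/-- The walk operator. -/
def walkMat : Matrix (Q → Bool) (Q → Bool) ℂ := zeroRefl r * signConj r u φ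

/-- The walk operator, controlled on the wire `c` being `0`. -/
def ctrlWalk : Matrix (Q → Bool) (Q → Bool) ℂ :=
  Matrix.diagonal (fun x => boolSign (anyOn r x && !x c)) * signConj r u fun x => φ x && !x c

/-- The rotation of the wire `c` with phases that may depend on other wires. -/
def rotAt (E F : (Q → Bool) → Bool → ℂ) : Matrix (Q → Bool) (Q → Bool) ℂ :=
  Matrix.diagonal (fun x => E x (x c)) * onWire c rotBasis *
    Matrix.diagonal (fun x => F x (x c)) * onWire c rotBasis.conjTranspose

/-- Alternating rotations and controlled walk operators. -/
def qspSeq : ℕ → Matrix (Q → Bool) (Q → Bool) ℂ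
  | 0 => rotAt c (E 0) (F 0)
  | t + 1 => rotAt c (E (t + 1)) (F (t + 1)) * (ctrlWalk r u φ c * qspSeq t)

/-- Generalized quantum signal processing with `2 N` controlled walk operators. -/
def qspMat (N : ℕ) : Matrix (Q → Bool) (Q → Bool) ℂ :=
  (signConj r u φ * zeroRefl r) ^ N * qspSeq r u φ c E F (2 * N)

/-! ### The wires that quantum signal processing changes -/

section ActsIn

variable {r u φ c E F}

lemma actsIn_signConj (φ : (Q → Bool) → Bool) : ActsIn (Set.range r) (signConj r u φ) :=
  ((actsIn_actOn r _).mul (actsIn_diagonal _ _)).mul (actsIn_actOn r _)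

lemma actsIn_onWire (v : Matrix Bool Bool ℂ) : ActsIn {c} (onWire c v) :=
  (actsIn_actOn _ _).mono (by rintro _ ⟨_, rfl⟩; rfl)

lemma actsIn_rotAt (E F : (Q → Bool) → Bool → ℂ) : ActsIn {c} (rotAt c E F) :=
  (((actsIn_diagonal _ _).mul (actsIn_onWire _)).mul (actsIn_diagonal _ _)).mul (actsIn_onWire _)

lemma actsIn_qspSeq (t : ℕ) : ActsIn (insert c (Set.range r)) (qspSeq r u φ c E F t) := by
  have h : ActsIn (insert c (Set.range r)) (ctrlWalk r u φ c) :=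
    ((actsIn_diagonal _ _).mul (actsIn_signConj _)).mono (Set.subset_insert _ _)
  have h2 : ∀ E F, ActsIn (insert c (Set.range r)) (rotAt (Q := Q) c E F) := fun E F =>
    (actsIn_rotAt E F).mono (by simp)
  induction t with
  | zero => exact h2 _ _
  | succ t ih => exact (h2 _ _).mul (h.mul ih)

lemma actsIn_qspMat (N : ℕ) : ActsIn (insert c (Set.range r)) (qspMat r u φ c E F N) :=
  ((((actsIn_signConj _).mul (actsIn_diagonal _ _)).mono (Set.subset_insert _ _)).pow N).mul
    (actsIn_qspSeq _)

end ActsIn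

/-! ### Involutions, commutation relations and the controlled walk -/

section Algebra

variable {r u φ c E F}

lemma signConj_mul_self (hr : Function.Injective r)
    (hu : ∀ a, u a ∈ Matrix.unitaryGroup Bool ℂ) (φ : (Q → Bool) → Bool) :
    signConj r u φ * signConj r u φ = 1 := by
  have h := Matrix.mem_unitaryGroup_iff.1 (actOn_mem_unitary hr (tensorMat_mem_unitary hu))
  have h' := Matrix.mem_unitaryGroup_iff'.1 (actOn_mem_unitary hr (tensorMat_mem_unitary hu))
  rw [Matrix.star_eq_conjTranspose, actOn_conjTranspose] at h h'
  have hd : Matrix.diagonal (fun x : Q → Bool => boolSign (φ x)) *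
      Matrix.diagonal (fun x => boolSign (φ x)) = 1 := by
    rw [Matrix.diagonal_mul_diagonal, ← Matrix.diagonal_one]
    congr 1
    funext x
    exact boolSign_mul_self _
  calc signConj r u φ * signConj r u φ
      = actOn r (tensorMat u).conjTranspose * (Matrix.diagonal (fun x => boolSign (φ x)) *
          (actOn r (tensorMat u) * actOn r (tensorMat u).conjTranspose) *
            Matrix.diagonal (fun x => boolSign (φ x))) * actOn r (tensorMat u) := by
        simp only [signConj, mul_assoc]
    _ = 1 := by rw [h, mul_one, hd, mul_one, h']

lemma zeroRefl_mul_self : zeroRefl r * zeroRefl r = (1 : Matrix (Q → Bool) (Q → Bool) ℂ) := by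
  rw [zeroRefl, Matrix.diagonal_mul_diagonal, ← Matrix.diagonal_one]
  congr 1
  funext x
  exact boolSign_mul_self _

/-- The projection onto the states with the bit `b` on the wire `c`. -/
def wireProj (c : Q) (b : Bool) : Matrix (Q → Bool) (Q → Bool) ℂ :=
  Matrix.diagonal fun x => if x c = b then 1 else 0

lemma commute_signConj_diagonal {f : (Q → Bool) → ℂ} (hf : Indep (Set.range r) f)
    (φ : (Q → Bool) → Bool) : Commute (signConj r u φ) (Matrix.diagonal f) :=
  ((commute_actOn_diagonal _ hf).mul_left (Matrix.commute_diagonal _ _)).mul_left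
    (commute_actOn_diagonal _ hf)

lemma commute_walkMat_diagonal {f : (Q → Bool) → ℂ} (hf : Indep (Set.range r) f) :
    Commute (walkMat r u φ) (Matrix.diagonal f) :=
  (Matrix.commute_diagonal _ _).mul_left (commute_signConj_diagonal hf φ)

lemma indep_wire (hc : c ∉ Set.range r) {β : Type} (f : Bool → β) :
    Indep (Set.range r) fun x : Q → Bool => f (x c) := fun x y h => by
  show f (x c) = f (y c)
  rw [h c hc]

lemma range_wire (c : Q) : Set.range (fun _ : Unit => c) = {c} := by
  ext; simp [eq_comm]

lemma commute_walkMat_onWire (hr : Function.Injective r) (hc : c ∉ Set.range r)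
    (hφ : Indep {c} φ) (v : Matrix Bool Bool ℂ) : Commute (walkMat r u φ) (onWire c v) := by
  have hdis : Disjoint (Set.range fun _ : Unit => c) (Set.range r) := by
    rw [range_wire]; exact Set.disjoint_singleton_left.2 hc
  have h1 : ∀ w, Commute (onWire c v) (actOn r w) := fun w =>
    commute_actOn (onWire_injective c) hr hdis _ _
  have h2 : ∀ f : (Q → Bool) → ℂ, Indep {c} f → Commute (onWire c v) (Matrix.diagonal f) :=
    fun f hf => commute_actOn_diagonal _ (by rwa [range_wire])
  refine Commute.symm ?_
  refine (h2 _ fun x y h => ?_).mul_right (((h1 _).mul_right (h2 _ fun x y h => ?_)).mul_right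
    (h1 _))
  · congr 1
    simp only [anyOn]
    congr 1
    refine propext (exists_congr fun a => ?_)
    rw [h (r a) fun ha => hc ⟨a, ha⟩]
  · rw [hφ x y h]

/-- The phases of the rotation may depend on wires other than the coins, and the sign function of
the walk does not read `c`; so walk and rotation act on disjoint wires given the rest of the state.
This lets polynomials of the walk be pulled through the rotations. -/
lemma commute_walkMat_rotAt (hr : Function.Injective r) (hc : c ∉ Set.range r)
    (hφ : Indep {c} φ) {E F : (Q → Bool) → Bool → ℂ} (hE : Indep (Set.range r) E)
    (hF : Indep (Set.range r) F) : Commute (walkMat r u φ) (rotAt c E F) := by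
  have h1 : ∀ E : (Q → Bool) → Bool → ℂ, Indep (Set.range r) E →
      Indep (Set.range r) fun x => E x (x c) := fun E hE x y h => by
    show E x (x c) = E y (y c)
    rw [hE x y h, h c hc]
  exact (((commute_walkMat_diagonal (h1 E hE)).mul_right
    (commute_walkMat_onWire hr hc hφ _)).mul_right (commute_walkMat_diagonal (h1 F hF))).mul_right
    (commute_walkMat_onWire hr hc hφ _)

lemma commute_walkMat_wireProj (hc : c ∉ Set.range r) (b : Bool) :
    Commute (walkMat r u φ) (wireProj c b) :=
  commute_walkMat_diagonal (indep_wire hc fun b' => if b' = b then 1 else 0)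

/-- Only the two sign functions carry the control. If the wire `c` is `1`, both signs are trivial
and the rotations around the inner one cancel; if it is `0`, the control disappears from the signs
and the walk operator remains. -/
lemma ctrlWalk_mul_wireProj (hc : c ∉ Set.range r) (b : Bool)
    (hr : Function.Injective r) (hu : ∀ a, u a ∈ Matrix.unitaryGroup Bool ℂ) :
    ctrlWalk r u φ c * wireProj c b =
      (if b then 1 else walkMat r u φ) * wireProj c b := by
  have hP : ∀ w, Commute (actOn r w) (wireProj c b) := fun w =>
    commute_actOn_diagonal _ (indep_wire hc fun b' => if b' = b then 1 else 0)
  have hd : ∀ f : (Q → Bool) → Bool, Matrix.diagonal (fun x => boolSign (f x && !x c)) *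
      wireProj c b = Matrix.diagonal (fun x => boolSign (f x && !b)) * wireProj c b := by
    intro f
    simp only [wireProj, Matrix.diagonal_mul_diagonal]
    congr 1
    funext x
    by_cases h : x c = b
    · rw [h]
    · rw [if_neg h, mul_zero, mul_zero]
  have hsc : signConj r u (fun x => φ x && !x c) * wireProj c b =
      signConj r u (fun x => φ x && !b) * wireProj c b := by
    simp only [signConj]
    rw [mul_assoc, (hP _).eq, ← mul_assoc, mul_assoc _ (Matrix.diagonal _) (wireProj c b), hd,
      ← mul_assoc, mul_assoc _ (wireProj c b), ← (hP _).eq, ← mul_assoc]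
  have hscP : Commute (signConj r u (fun x => φ x && !b)) (wireProj c b) :=
    commute_signConj_diagonal (indep_wire hc fun b' => if b' = b then 1 else 0) _
  rw [ctrlWalk, mul_assoc, hsc, hscP.eq, ← mul_assoc, hd, mul_assoc, ← hscP.eq, ← mul_assoc]
  congr 1
  cases b
  · simp [walkMat, zeroRefl]
  · have h := Matrix.mem_unitaryGroup_iff'.1 (actOn_mem_unitary hr (tensorMat_mem_unitary hu))
    rw [Matrix.star_eq_conjTranspose, actOn_conjTranspose] at h
    simp [signConj, boolSign, h]

end Algebra

/-! ### Action on the two basis vectors of the signal qubit -/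

section Vectors

variable {r u φ c E F}

/-- The basis vector that agrees with `κ` off `c` and has the bit `b` on the wire `c`. -/
def wireVec (κ : Q → Bool) (c : Q) (b : Bool) : (Q → Bool) → ℂ :=
  Pi.single (Function.update κ c b) 1

/-- The matrix acts on the two vectors `wireVec κ c b` as the two-dimensional matrix. -/
def RepOn (κ : Q → Bool) (c : Q) (X : Matrix (Q → Bool) (Q → Bool) ℂ) (M : Matrix Bool Bool ℂ) :
    Prop := ∀ b, X.mulVec (wireVec κ c b) = ∑ b', M b' b • wireVec κ c b'

lemma RepOn.mul {κ : Q → Bool} {X Y : Matrix (Q → Bool) (Q → Bool) ℂ} {M N : Matrix Bool Bool ℂ}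
    (h : RepOn κ c X M) (h' : RepOn κ c Y N) : RepOn κ c (X * Y) (M * N) := by
  intro b
  rw [← Matrix.mulVec_mulVec, h' b]
  simp only [Fintype.sum_bool, Matrix.mulVec_add, Matrix.mulVec_smul, h true, h false,
    Matrix.mul_apply]
  module

lemma repOn_diagonal (κ : Q → Bool) {E : (Q → Bool) → Bool → ℂ} (hE : Indep {c} E) :
    RepOn κ c (Matrix.diagonal fun x => E x (x c)) (Matrix.diagonal (E κ)) := by
  have h : ∀ b, (Matrix.diagonal fun x => E x (x c)).mulVec (wireVec κ c b) =
      E κ b • wireVec κ c b := by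
    intro b
    funext x
    rw [Matrix.mulVec_diagonal, wireVec, Pi.smul_apply, smul_eq_mul]
    by_cases hx : x = Function.update κ c b
    · rw [hx, Function.update_self, hE (Function.update κ c b) κ fun q hq =>
        Function.update_of_ne hq _ _]
    · rw [Pi.single_eq_of_ne hx, mul_zero, mul_zero]
  intro b
  rw [h b]
  cases b <;> simp

lemma repOn_onWire (κ : Q → Bool) (v : Matrix Bool Bool ℂ) : RepOn κ c (onWire c v) v := by
  intro b
  funext x
  rw [wireVec, Matrix.mulVec_single_one, Matrix.col_apply, onWire]
  simp only [Fintype.sum_bool, Pi.add_apply, Pi.smul_apply, smul_eq_mul, wireVec, Pi.single_apply]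
  by_cases h : ∀ q, q ≠ c → x q = κ q
  · rw [actOn_apply_of_agree]
    · have hx : ∀ b', x = Function.update κ c b' ↔ x c = b' := fun b' => by
        constructor
        · rintro rfl; simp
        · intro hb
          funext q
          by_cases hq : q = c
          · subst hq; simp [hb]
          · rw [Function.update_of_ne hq, h q hq]
      simp only [hx, unitMat, Function.comp_apply, Function.update_self]
      cases x c <;> simp
    · intro q hq
      rw [range_wire] at hq
      rw [h q hq, Function.update_of_ne hq]
  · have hx : ∀ b', x ≠ Function.update κ c b' := fun b' hb => h fun q hq => by
      rw [hb, Function.update_of_ne hq]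
    rw [if_neg (hx _), if_neg (hx _)]
    by_contra h0
    apply h
    intro q hq
    have := agree_of_actOn_ne_zero (r := fun _ : Unit => c) (u := unitMat v) (x := x)
      (y := Function.update κ c b) (by intro h1; rw [h1] at h0; simp at h0) q
      (by rw [range_wire]; exact hq)
    rwa [Function.update_of_ne hq] at this

lemma repOn_rotAt (κ : Q → Bool) {E F : (Q → Bool) → Bool → ℂ} (hE : Indep {c} E)
    (hF : Indep {c} F) : RepOn κ c (rotAt c E F) (phaseRot (E κ) (F κ)) :=
  (((repOn_diagonal κ hE).mul (repOn_onWire κ _)).mul (repOn_diagonal κ hF)).mul (repOn_onWire κ _)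

lemma wireProj_mulVec_wireVec (κ : Q → Bool) (b : Bool) :
    (wireProj c b).mulVec (wireVec κ c b) = wireVec κ c b := by
  funext x
  rw [wireProj, Matrix.mulVec_diagonal, wireVec, Pi.single_apply]
  by_cases hx : x = Function.update κ c b
  · rw [hx]; simp
  · simp [hx]

lemma commute_aeval {ι : Type} [Fintype ι] [DecidableEq ι] {X U : Matrix ι ι ℂ}
    (h : Commute U X) (p : ℂ[X]) :
    Commute (aeval U p) X := by
  induction p using Polynomial.induction_on' with
  | add p q hp hq => rw [map_add]; exact hp.add_left hq
  | monomial n a =>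
    rw [aeval_monomial]
    exact (Algebra.commute_algebraMap_left a X).mul_left (h.pow_left n)

lemma mulVec_wireVec_apply_of_ne {X : Matrix (Q → Bool) (Q → Bool) ℂ} {b : Bool}
    (h : Commute X (wireProj c b)) (κ x : Q → Bool) (hx : x c ≠ b) :
    X.mulVec (wireVec κ c b) x = 0 := by
  rw [← wireProj_mulVec_wireVec κ b, Matrix.mulVec_mulVec, h.eq, ← Matrix.mulVec_mulVec,
    wireProj, Matrix.mulVec_diagonal, if_neg hx, zero_mul]

lemma ctrlWalk_mulVec (hr : Function.Injective r) (hu : ∀ a, u a ∈ Matrix.unitaryGroup Bool ℂ)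
    (hc : c ∉ Set.range r) (p : ℂ[X]) (κ : Q → Bool) (b : Bool) :
    (ctrlWalk r u φ c).mulVec ((aeval (walkMat r u φ) p).mulVec (wireVec κ c b)) =
      (aeval (walkMat r u φ) (if b then p else X * p)).mulVec (wireVec κ c b) := by
  have h1 := commute_aeval (commute_walkMat_wireProj (u := u) (φ := φ) hc b) p
  have h2 : (aeval (walkMat r u φ) p).mulVec (wireVec κ c b) =
      (wireProj c b).mulVec ((aeval (walkMat r u φ) p).mulVec (wireVec κ c b)) := by
    rw [Matrix.mulVec_mulVec, ← h1.eq, ← Matrix.mulVec_mulVec, wireProj_mulVec_wireVec]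
  rw [h2, Matrix.mulVec_mulVec, ctrlWalk_mul_wireProj hc b hr hu, ← Matrix.mulVec_mulVec, ← h2]
  cases b
  · simp only [Bool.false_eq_true, if_false, map_mul, aeval_X]
    rw [Matrix.mulVec_mulVec]
  · simp

/-- A controlled walk multiplies the polynomial in front of the vector with signal `0` by the
variable, and a rotation mixes the two polynomials, as it commutes with the walk. These are the two
operations in the recursion of `rotPoly`. The phases are constant along all wires that change, so
they can be evaluated at `κ`. -/
lemma qspSeq_mulVec (hr : Function.Injective r) (hu : ∀ a, u a ∈ Matrix.unitaryGroup Bool ℂ)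
    (hc : c ∉ Set.range r) (hφ : Indep {c} φ) (hE : ∀ t, Indep (insert c (Set.range r)) (E t))
    (hF : ∀ t, Indep (insert c (Set.range r)) (F t)) (κ : Q → Bool) (t : ℕ) :
    (qspSeq r u φ c E F t).mulVec (wireVec κ c false) =
      ∑ b, (aeval (walkMat r u φ) (rotPoly (fun t => E t κ) (fun t => F t κ) t b)).mulVec
        (wireVec κ c b) := by
  have hsub : ∀ {f : (Q → Bool) → Bool → ℂ} {S : Set Q}, Indep (insert c (Set.range r)) f →
      S ⊆ insert c (Set.range r) → Indep S f := fun hf hS x y h =>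
    hf x y fun q hq => h q fun hq' => hq (hS hq')
  have hrep : ∀ t, RepOn κ c (rotAt c (E t) (F t)) (phaseRot (E t κ) (F t κ)) := fun t =>
    repOn_rotAt κ (hsub (hE t) (by simp)) (hsub (hF t) (by simp))
  have hcom : ∀ t p, Commute (aeval (walkMat r u φ) p) (rotAt c (E t) (F t)) := fun t p =>
    commute_aeval (commute_walkMat_rotAt hr hc hφ (hsub (hE t) (Set.subset_insert _ _))
      (hsub (hF t) (Set.subset_insert _ _))) p
  induction t with
  | zero =>
    rw [qspSeq, hrep 0 false]
    refine Finset.sum_congr rfl fun b _ => ?_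
    rw [rotPoly, aeval_C, Algebra.algebraMap_eq_smul_one, Matrix.smul_mulVec, Matrix.one_mulVec]
  | succ t ih =>
    rw [qspSeq, ← Matrix.mulVec_mulVec, ← Matrix.mulVec_mulVec, ih]
    have hswap : ∀ p b, (rotAt c (E (t + 1)) (F (t + 1))).mulVec
        ((aeval (walkMat r u φ) p).mulVec (wireVec κ c b)) =
        (aeval (walkMat r u φ) p).mulVec (∑ b', phaseRot (E (t + 1) κ) (F (t + 1) κ) b' b •
          wireVec κ c b') := fun p b => by
      rw [Matrix.mulVec_mulVec, ← (hcom (t + 1) p).eq, ← Matrix.mulVec_mulVec, hrep]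
    simp only [Fintype.sum_bool, Matrix.mulVec_add, ctrlWalk_mulVec hr hu hc, hswap, if_true,
      Bool.false_eq_true, if_false]
    simp only [rotPoly, map_add, map_mul, aeval_C, Matrix.add_mulVec,
      Algebra.algebraMap_eq_smul_one, smul_mul_assoc, one_mul, Matrix.smul_mulVec,
      Matrix.mulVec_smul]
    abel

/-- On a state that is an eigenvector up to the walk, a polynomial of the walk operator acts as the
polynomial of the amplitude. -/
lemma aeval_circlePoly_mulVec {ι : Type} [Fintype ι] [DecidableEq ι] {N : ℕ} {q : ℝ[X]}
    (hq : q.natDegree ≤ N) (x : ℝ)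
    (V Z : Matrix ι ι ℂ) (hV : V * V = 1) (e : ι → ℂ) (he : Z.mulVec e = e)
    (hVe : Z.mulVec (V.mulVec e) = (2 * (1 - 2 * x : ℝ) : ℂ) • e - V.mulVec e) :
    (aeval (Z * V) (circlePoly N q)).mulVec e =
      ((q.eval x : ℝ) : ℂ) • ((Z * V) ^ N).mulVec e := by
  set U := Z * V with hU
  have h1 : U.mulVec e = (2 * (1 - 2 * x : ℝ) : ℂ) • e - V.mulVec e := by
    rw [hU, ← Matrix.mulVec_mulVec, hVe]
  have h2 : U.mulVec (V.mulVec e) = e := by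
    rw [hU, ← Matrix.mulVec_mulVec, Matrix.mulVec_mulVec e V V, hV, Matrix.one_mulVec, he]
  set M := aeval U (C (-(1 / 4)) * (X - 1) ^ 2 : ℂ[X]) with hM
  -- The counterpart of `circlePoint_mul` for the walk: from `U (V e) = e` follows `U² e = 2 (1 - 2
  -- x) U e - e`, so `-(U - 1)² / 4` acts on `e` as `x U`.
  have hMe : M.mulVec e = (x : ℂ) • U.mulVec e := by
    have : M = (-(1 / 4) : ℂ) • (U * U - 2 • U + 1) := by
      rw [hM, map_mul, aeval_C, Algebra.algebraMap_eq_smul_one, smul_mul_assoc, one_mul]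
      congr 1
      simp only [map_pow, map_sub, aeval_X, map_one]
      noncomm_ring
    rw [this, Matrix.smul_mulVec, Matrix.add_mulVec, Matrix.sub_mulVec, Matrix.smul_mulVec,
      Matrix.one_mulVec, ← Matrix.mulVec_mulVec, h1, Matrix.mulVec_sub, Matrix.mulVec_smul, h1, h2]
    push_cast
    module
  have hpow : ∀ k, (M ^ k).mulVec e = (x : ℂ) ^ k • (U ^ k).mulVec e := by
    intro k
    induction k with
    | zero => simp
    | succ k ih =>
      have hc : Commute M (U ^ k) := (commute_aeval (Commute.refl U) _).pow_right k
      rw [pow_succ', ← Matrix.mulVec_mulVec, ih, Matrix.mulVec_smul, Matrix.mulVec_mulVec, hc.eq,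
        ← Matrix.mulVec_mulVec, hMe, Matrix.mulVec_smul, Matrix.mulVec_mulVec, smul_smul,
        ← pow_succ, ← pow_succ]
  rw [circlePoly, map_sum, Matrix.sum_mulVec, eval_eq_sum_range' (Nat.lt_succ_of_le hq)]
  push_cast
  rw [Finset.sum_smul]
  refine Finset.sum_congr rfl fun k hk => ?_
  have hk' := Finset.mem_range.1 hk
  rw [map_mul, map_mul, aeval_C, map_pow, aeval_X, map_pow, ← hM,
    Algebra.algebraMap_eq_smul_one, smul_mul_assoc, one_mul, smul_mul_assoc, Matrix.smul_mulVec,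
    ← Matrix.mulVec_mulVec, hpow, Matrix.mulVec_smul, Matrix.mulVec_mulVec, ← pow_add, smul_smul,
    Nat.sub_add_cancel (by omega)]

/-- The diagonal entries of generalized quantum signal processing are values of the polynomial. -/
theorem qspMat_apply_self (hr : Function.Injective r)
    (hu : ∀ a, u a ∈ Matrix.unitaryGroup Bool ℂ)
    (hc : c ∉ Set.range r) (hφ : Indep {c} φ) (hE : ∀ t, Indep (insert c (Set.range r)) (E t))
    (hF : ∀ t, Indep (insert c (Set.range r)) (F t)) {N : ℕ} {q : ℝ[X]} (hq : q.natDegree ≤ N)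
    {κ : Q → Bool} (hκr : ∀ a, κ (r a) = false) (hκc : κ c = false) {x : ℝ}
    (hx : signConj r u φ κ κ = ((1 - 2 * x : ℝ) : ℂ))
    (hpoly : rotPoly (fun t => E t κ) (fun t => F t κ) (2 * N) false = circlePoly N q) :
    qspMat r u φ c E F N κ κ = ((q.eval x : ℝ) : ℂ) := by
  have hκ : Function.update κ c false = κ := by rw [← hκc, Function.update_eq_self]
  set V := signConj r u φ with hV
  set Z := zeroRefl (Q := Q) r with hZ
  have hVV : V * V = 1 := signConj_mul_self hr hu φ
  have hZZ : Z * Z = 1 := zeroRefl_mul_self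
  set e := wireVec κ c false with he
  have he1 : e = Pi.single κ 1 := by rw [he, wireVec, hκ]
  have hκn : anyOn r κ = false := by simp [anyOn, hκr]
  have hZe : Z.mulVec e = e := by
    funext y
    rw [hZ, zeroRefl, Matrix.mulVec_diagonal, he1, Pi.single_apply]
    by_cases hy : y = κ
    · rw [hy, hκn]; simp [boolSign]
    · simp [hy]
  -- The reflection `V` changes only the coins, so the part of `V e` with all coins zero is `(1 - 2
  -- x) e`. On the rest `Z` is `-1`.
  have hVe : Z.mulVec (V.mulVec e) = (2 * (1 - 2 * x : ℝ) : ℂ) • e - V.mulVec e := by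
    funext y
    rw [hZ, zeroRefl, Matrix.mulVec_diagonal, he1, Pi.sub_apply, Pi.smul_apply, Pi.single_apply,
      Matrix.mulVec_single_one, Matrix.col_apply]
    by_cases hy : y = κ
    · rw [hy, hκn, hx, if_pos rfl]
      simp [boolSign]
      ring
    · rw [if_neg hy, smul_zero, zero_sub]
      by_cases hy0 : anyOn r y = true
      · rw [hy0]; simp [boolSign]
      · have : V y κ = 0 := by
          by_contra h0
          apply hy
          funext q
          by_cases hqr : q ∈ Set.range r
          · obtain ⟨a, rfl⟩ := hqr
            rw [hκr a]
            by_contra h1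
            exact hy0 (by simp only [anyOn, decide_eq_true_eq]; exact ⟨a, by simpa using h1⟩)
          · exact actsIn_signConj (u := u) φ y κ h0 q hqr
        rw [this]; simp
  -- `V Z` is the inverse of the walk, so its power removes the factor `U ^ N` that accompanies the
  -- value of the polynomial.
  have hinv : (V * Z) * (Z * V) = 1 := by
    rw [mul_assoc, ← mul_assoc Z Z V, hZZ, one_mul, hVV]
  have hinvN : ∀ N, (V * Z) ^ N * (Z * V) ^ N = 1 := by
    intro N
    induction N with
    | zero => simp
    | succ N ih =>
      rw [pow_succ, pow_succ', mul_assoc, ← mul_assoc (V * Z), hinv, one_mul, ih]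
  have hcol : qspMat r u φ c E F N κ κ = (qspMat r u φ c E F N).mulVec e κ := by
    rw [he1, Matrix.mulVec_single_one, Matrix.col_apply]
  rw [hcol, qspMat, ← Matrix.mulVec_mulVec, qspSeq_mulVec hr hu hc hφ hE hF, Fintype.sum_bool,
    hpoly, Matrix.mulVec_add, Pi.add_apply]
  -- The component with signal `1` does not contribute to the diagonal entry: all operators that act
  -- on it preserve the signal wire, which is `0` in `κ`.
  have hfirst : ((V * Z) ^ N).mulVec ((aeval (walkMat r u φ) (rotPoly (fun t => E t κ)
      (fun t => F t κ) (2 * N) true)).mulVec (wireVec κ c true)) κ = 0 := by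
    rw [Matrix.mulVec_mulVec]
    refine mulVec_wireVec_apply_of_ne (b := true) (Commute.mul_left ?_ ?_) κ κ (by rw [hκc]; simp)
    · exact ((commute_signConj_diagonal (indep_wire hc fun b' => if b' = true then 1 else 0)
        φ).mul_left (Matrix.commute_diagonal _ _)).pow_left N
    · exact commute_aeval (commute_walkMat_wireProj hc true) _
  have hw : walkMat r u φ = Z * V := rfl
  rw [hfirst, zero_add, hw, aeval_circlePoly_mulVec hq x V Z hVV e hZe hVe, Matrix.mulVec_smul,
    Matrix.mulVec_mulVec, hinvN, Matrix.one_mulVec, he1]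
  simp

end Vectors

end QSP

/-! ### The cost -/

section Cost

variable {R Q A : Type} [Fintype A] [DecidableEq A] [Fintype Q] [DecidableEq Q] [Fintype R]
  [DecidableEq R] {PL PR : Matrix.unitaryGroup (R → Bool) ℂ}
  {r : A → Q} {u : A → Matrix Bool Bool ℂ} {φ : (Q → Bool) → Bool} {c : Q}
  {E F : ℕ → (Q → Bool) → Bool → ℂ}

lemma Impl.signConj (hr : Function.Injective r) (hu : ∀ a, u a ∈ Matrix.unitaryGroup Bool ℂ)
    {k : ℕ} (h : Impl PL PR (Matrix.diagonal fun x => boolSign (φ x)) k 0) :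
    Impl PL PR (QuFEM.signConj r u φ) (k + 2 * Fintype.card A) 0 := by
  rw [QuFEM.signConj, tensorMat_conjTranspose]
  refine (((Impl.tensorMat hr fun a => ?_).mul h).mul (Impl.tensorMat hr hu)).mono (by omega) le_rfl
  exact (star (⟨u a, hu a⟩ : Matrix.unitaryGroup Bool ℂ)).2

lemma Impl.rotAt {E F : (Q → Bool) → Bool → ℂ} {k : ℕ}
    (hE : Impl PL PR (Matrix.diagonal fun x => E x (x c)) k 0)
    (hF : Impl PL PR (Matrix.diagonal fun x => F x (x c)) k 0) :
    Impl PL PR (rotAt c E F) (2 * k + 2) 0 :=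
  (((hE.mul (Impl.onWire c rotBasis_mem_unitary)).mul hF).mul
    (Impl.onWire c rotBasis_mem_unitary')).mono (by omega) le_rfl

lemma Impl.qspMat (hr : Function.Injective r) (hu : ∀ a, u a ∈ Matrix.unitaryGroup Bool ℂ)
    {k l : ℕ} (h1 : Impl PL PR (Matrix.diagonal fun x => boolSign (φ x)) k 0)
    (h2 : Impl PL PR (Matrix.diagonal fun x => boolSign (φ x && !x c)) k 0)
    (h3 : Impl PL PR (Matrix.diagonal fun x => boolSign (anyOn r x)) k 0)
    (h4 : Impl PL PR (Matrix.diagonal fun x => boolSign (anyOn r x && !x c)) k 0)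
    (hE : ∀ t, Impl PL PR (Matrix.diagonal fun x => E t x (x c)) l 0)
    (hF : ∀ t, Impl PL PR (Matrix.diagonal fun x => F t x (x c)) l 0) (N : ℕ) :
    Impl PL PR (QuFEM.qspMat r u φ c E F N)
      (3 * N * (2 * k + 2 * Fintype.card A) + (2 * N + 1) * (2 * l + 2)) 0 := by
  have hseq : ∀ t, Impl PL PR (qspSeq r u φ c E F t)
      (t * (2 * k + 2 * Fintype.card A) + (t + 1) * (2 * l + 2)) 0 := by
    intro t
    induction t with
    | zero => exact (Impl.rotAt (hE 0) (hF 0)).mono (by omega) le_rfl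
    | succ t ih =>
      refine ((Impl.rotAt (hE _) (hF _)).mul ((h4.mul (Impl.signConj hr hu h2)).mul ih)).mono ?_
        le_rfl
      have e1 : (t + 1) * (2 * k + 2 * Fintype.card A) =
        t * (2 * k + 2 * Fintype.card A) + (2 * k + 2 * Fintype.card A) := by ring
      have e2 : (t + 1 + 1) * (2 * l + 2) = (t + 1) * (2 * l + 2) + (2 * l + 2) := by ring
      omega
  refine ((((Impl.signConj hr hu h1).mul h3).pow N).mul (hseq (2 * N))).mono ?_ le_rfl
  have : N * (k + 2 * Fintype.card A + k) + 2 * N * (2 * k + 2 * Fintype.card A) =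
    3 * N * (2 * k + 2 * Fintype.card A) := by ring
  omega

end Cost

/-! ## Interpolation with basis polynomials that are bounded by one -/

section Interpolation

open Polynomial

/-- Nodes in `[0,1]` that maximize the Vandermonde determinant. -/
lemma exists_bounded_lagrange_basis (D : ℕ) :
    ∃ ν : Fin D → ℝ, (∀ j, ν j ∈ Set.Icc (0 : ℝ) 1) ∧ Function.Injective ν ∧
      ∀ j, ∀ t ∈ Set.Icc (0 : ℝ) 1, |(Lagrange.basis Finset.univ ν j).eval t| ≤ 1 := by
  have hcomp : IsCompact (Set.Icc (0 : Fin D → ℝ) 1) := isCompact_Icc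
  have hcont : Continuous fun ν : Fin D → ℝ => |(Matrix.vandermonde ν).det| := by
    refine Continuous.abs (Continuous.matrix_det ?_)
    refine continuous_matrix fun i j => ?_
    simp only [Matrix.vandermonde_apply]
    fun_prop
  obtain ⟨ν, hν, hmax⟩ := hcomp.exists_isMaxOn ⟨0, by simp⟩ hcont.continuousOn
  have hν' : ∀ j, ν j ∈ Set.Icc (0 : ℝ) 1 := fun j => ⟨hν.1 j, hν.2 j⟩
  -- The maximum is nonzero because equally spaced nodes are admissible and distinct.
  have hdet : (Matrix.vandermonde ν).det ≠ 0 := by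
    have hinj : Function.Injective fun j : Fin D => ((j : ℕ) : ℝ) / D := by
      intro i j hij
      have hD : (D : ℝ) ≠ 0 := by
        have := i.pos
        positivity
      have : ((i : ℕ) : ℝ) = (j : ℕ) := by
        have h : ((i : ℕ) : ℝ) / D = ((j : ℕ) : ℝ) / D := hij
        field_simp at h
        exact h
      exact Fin.ext (by exact_mod_cast this)
    have h1 := Matrix.det_vandermonde_ne_zero_iff.2 hinj
    have h2 := hmax (a := fun j : Fin D => ((j : ℕ) : ℝ) / D)
      ⟨fun j => by show (0 : ℝ) ≤ _; positivity, fun j => by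
        show ((j : ℕ) : ℝ) / D ≤ 1
        have : ((j : ℕ) : ℝ) ≤ D := by exact_mod_cast j.2.le
        exact div_le_one_of_le₀ this (by positivity)⟩
    intro h0
    have h3 : |(Matrix.vandermonde fun j : Fin D => ((j : ℕ) : ℝ) / D).det| ≤
        |(Matrix.vandermonde ν).det| := h2
    rw [h0, abs_zero] at h3
    exact h1 (abs_eq_zero.1 (le_antisymm h3 (abs_nonneg _)))
  have hinj : Function.Injective ν := Matrix.det_vandermonde_ne_zero_iff.1 hdet
  refine ⟨ν, hν', hinj, fun j t ht => ?_⟩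
  -- Moving node `j` to `t` replaces a row by the combination of the old rows with the coefficients
  -- `ℓ_k(t)`, by interpolation of monomials of degree less than `D`. The determinant is thereby
  -- multiplied by `ℓ_j(t)`, so maximality gives the bound `|ℓ_j(t)| ≤ 1`.
  have hrow : Matrix.vandermonde (Function.update ν j t) =
      (Matrix.vandermonde ν).updateRow j
        (∑ k, ((Lagrange.basis Finset.univ ν k).eval t) • Matrix.vandermonde ν k) := by
    ext i l
    by_cases hi : i = j
    · subst hi
      rw [Matrix.updateRow_self, Matrix.vandermonde_apply, Function.update_self]
      have h := Lagrange.eq_interpolate (s := Finset.univ) (v := ν) (f := X ^ (l : ℕ))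
        hinj.injOn (by
          rw [degree_X_pow, Finset.card_fin]
          exact_mod_cast l.2)
      have h2 := congrArg (eval t) h
      rw [Lagrange.interpolate_apply, eval_finsetSum] at h2
      simp only [eval_pow, eval_X, eval_mul, eval_C] at h2
      rw [h2, Finset.sum_apply]
      refine Finset.sum_congr rfl fun k _ => ?_
      rw [Pi.smul_apply, Matrix.vandermonde_apply, smul_eq_mul, mul_comm]
    · rw [Matrix.updateRow_ne hi, Matrix.vandermonde_apply, Matrix.vandermonde_apply,
        Function.update_of_ne hi]
  have h1 := hmax (a := Function.update ν j t)
    ⟨fun i => by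
      by_cases hi : i = j
      · subst hi; simpa using ht.1
      · simpa [hi] using hν.1 i, fun i => by
      by_cases hi : i = j
      · subst hi; simpa using ht.2
      · simpa [hi] using hν.2 i⟩
  have h2 : |(Matrix.vandermonde (Function.update ν j t)).det| ≤
    |(Matrix.vandermonde ν).det| := h1
  rw [hrow, Matrix.det_updateRow_sum, smul_eq_mul, abs_mul] at h2
  exact le_of_mul_le_mul_right (by rwa [one_mul]) (abs_pos.2 hdet)

/-- A polynomial that is bounded by one on the cube is a sum of products of univariate polynomials
that are bounded by one. -/
theorem exists_sum_prod_eq {d D : ℕ} (q : MvPolynomial (Fin (d + 1)) ℝ)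
    (hq : ∀ i, q.degreeOf i < D) (hb : ∀ x ∈ unitCube (d + 1), |MvPolynomial.eval x q| ≤ 1) :
    ∃ P : (Fin d → Fin D) → Fin (d + 1) → ℝ[X], (∀ a i, (P a i).natDegree < D) ∧
      (∀ a i, ∀ t ∈ Set.Icc (0 : ℝ) 1, |(P a i).eval t| ≤ 1) ∧
      ∀ x, MvPolynomial.eval x q = ∑ a, ∏ i, (P a i).eval (x i) := by
  obtain ⟨ν, hν, hinj, hbasis⟩ := exists_bounded_lagrange_basis D
  have hD : 0 < D := lt_of_le_of_lt (Nat.zero_le _) (hq 0)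
  -- The first variable is left free: `P0 a` is the restriction of `q` to a line on which the other
  -- coordinates are interpolation nodes in `[0,1]`, so it inherits the bound of `q`, and one factor
  -- `D` in the number of terms is saved.
  let P0 : (Fin d → Fin D) → ℝ[X] := fun a => ∑ m ∈ q.support,
    C (q.coeff m * ∏ i : Fin d, ν (a i) ^ m i.succ) * X ^ m 0
  have hP0 : ∀ a t, (P0 a).eval t = MvPolynomial.eval (Fin.cons t fun i => ν (a i)) q := by
    intro a t
    rw [MvPolynomial.eval_eq', eval_finsetSum]
    refine Finset.sum_congr rfl fun m _ => ?_
    rw [Fin.prod_univ_succ]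
    simp only [eval_mul, eval_C, eval_pow, eval_X, Fin.cons_zero, Fin.cons_succ]
    ring
  have hmdeg : ∀ m ∈ q.support, ∀ i, m i < D := fun m hm i =>
    lt_of_le_of_lt (MvPolynomial.monomial_le_degreeOf i hm) (hq i)
  refine ⟨fun a => Fin.cons (P0 a) fun i => Lagrange.basis Finset.univ ν (a i), ?_, ?_, ?_⟩
  · intro a i
    refine Fin.cases ?_ (fun i => ?_) i
    · show (P0 a).natDegree < D
      refine lt_of_le_of_lt (natDegree_sum_le_of_forall_le (n := D - 1) _ _ fun m hm => ?_)
        (by omega)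
      refine (natDegree_C_mul_X_pow_le _ _).trans ?_
      have := hmdeg m hm 0
      omega
    · show (Lagrange.basis Finset.univ ν (a i)).natDegree < D
      rw [Lagrange.natDegree_basis hinj.injOn (Finset.mem_univ _), Finset.card_fin]
      omega
  · intro a i t ht
    refine Fin.cases ?_ (fun i => ?_) i
    · show |(P0 a).eval t| ≤ 1
      rw [hP0]
      refine hb _ ⟨fun i => ?_, fun i => ?_⟩
      · refine Fin.cases ?_ (fun i => ?_) i
        · simpa using ht.1
        · simpa using (hν (a i)).1
      · refine Fin.cases ?_ (fun i => ?_) i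
        · simpa using ht.2
        · simpa using (hν (a i)).2
    · exact hbasis _ t ht
  · intro x
    have hmono : ∀ m ∈ q.support, ∀ i : Fin d, x i.succ ^ m i.succ =
        ∑ b, ν b ^ m i.succ * (Lagrange.basis Finset.univ ν b).eval (x i.succ) := by
      intro m hm i
      have h := Lagrange.eq_interpolate (s := Finset.univ) (v := ν) (f := X ^ m i.succ)
        hinj.injOn (by
          rw [degree_X_pow, Finset.card_fin]
          exact_mod_cast hmdeg m hm i.succ)
      have h2 := congrArg (eval (x i.succ)) h
      rw [Lagrange.interpolate_apply, eval_finsetSum] at h2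
      simpa only [eval_pow, eval_X, eval_mul, eval_C] using h2
    have e1 : ∀ m ∈ q.support, q.coeff m * ∏ i, x i ^ m i =
        ∑ a : Fin d → Fin D, (q.coeff m * (∏ i, ν (a i) ^ m i.succ) * x 0 ^ m 0) *
          ∏ i, (Lagrange.basis Finset.univ ν (a i)).eval (x i.succ) := by
      intro m hm
      rw [Fin.prod_univ_succ, Finset.prod_congr rfl fun i _ => hmono m hm i,
        Finset.prod_univ_sum, Fintype.piFinset_univ, Finset.mul_sum, Finset.mul_sum]
      refine Finset.sum_congr rfl fun a _ => ?_
      rw [Finset.prod_mul_distrib]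
      ring
    rw [MvPolynomial.eval_eq', Finset.sum_congr rfl e1, Finset.sum_comm]
    refine Finset.sum_congr rfl fun a _ => ?_
    rw [Fin.prod_univ_succ]
    simp only [Fin.cons_zero, Fin.cons_succ, P0, eval_finsetSum, eval_mul, eval_C, eval_pow,
      eval_X]
    rw [Finset.sum_mul]

end Interpolation

/-! ## Gauss-Legendre nodes and weights -/

section Legendre

open Polynomial

lemma iterate_derivative_comp_neg_X (p : ℝ[X]) (k : ℕ) :
    derivative^[k] (p.comp (-X)) = (-1) ^ k * (derivative^[k] p).comp (-X) := by
  induction k generalizing p with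
  | zero => simp
  | succ k ih => simp [ih (derivative p), derivative_comp, pow_succ]

lemma iterate_derivative_comp_X_add_one (p : ℝ[X]) (k : ℕ) :
    derivative^[k] (p.comp (X + 1)) = (derivative^[k] p).comp (X + 1) := by
  induction k generalizing p with
  | zero => simp
  | succ k ih => simp [ih (derivative p), derivative_comp]

/-- In the variable `t - 1` the polynomial `(t² - 1)^G` becomes `X^G (X + 2)^G`, with nonnegative
coefficients. Its `G`-th derivative also has nonnegative coefficients and a positive constant one.
Together with the parity of the polynomial this confines its real roots to `[-1,1]`. -/
lemma legendre_eval_pos {G : ℕ} {t : ℝ} (ht : 1 ≤ t) : 0 < (legendre G).eval t := by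
  have hcomp : ((X ^ 2 - 1 : ℝ[X]) ^ G).comp (X + 1) = X ^ G * (X + C 2) ^ G := by
    rw [← mul_pow, pow_comp]
    congr 1
    simp only [sub_comp, pow_comp, X_comp, one_comp]
    rw [show (C 2 : ℝ[X]) = 2 from rfl]
    ring
  set p : ℝ[X] := X ^ G * (X + C 2) ^ G with hp
  have hcoef : ∀ k, 0 ≤ p.coeff k := by
    intro k
    rw [hp, coeff_X_pow_mul']
    split_ifs
    · rw [coeff_X_add_C_pow]; positivity
    · exact le_rfl
  have hcoefG : p.coeff G = 2 ^ G := by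
    rw [hp, coeff_X_pow_mul', if_pos le_rfl, Nat.sub_self, coeff_X_add_C_pow]
    simp
  have h1 : (derivative^[G] ((X ^ 2 - 1 : ℝ[X]) ^ G)).eval t =
      (derivative^[G] p).eval (t - 1) := by
    rw [← hcomp, iterate_derivative_comp_X_add_one, eval_comp]
    simp
  have hdc : ∀ k, 0 ≤ (derivative^[G] p).coeff k := by
    intro k
    rw [coeff_iterate_derivative]
    exact smul_nonneg (Nat.zero_le _) (hcoef _)
  have hd0 : 0 < (derivative^[G] p).coeff 0 := by
    rw [coeff_iterate_derivative, zero_add, hcoefG, Nat.descFactorial_self]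
    have := Nat.factorial_pos G
    rw [nsmul_eq_mul]
    positivity
  have hpos : 0 < (derivative^[G] p).eval (t - 1) := by
    rw [eval_eq_sum_range, Finset.sum_range_succ']
    refine add_pos_of_nonneg_of_pos (Finset.sum_nonneg fun k _ => ?_) (by simpa using hd0)
    exact mul_nonneg (hdc _) (pow_nonneg (by linarith) _)
  rw [legendre, eval_mul, eval_C, h1]
  have := Nat.factorial_pos G
  positivity

lemma legendre_eval_neg (G : ℕ) (t : ℝ) :
    (legendre G).eval (-t) = (-1) ^ G * (legendre G).eval t := by
  have h : ((X ^ 2 - 1 : ℝ[X]) ^ G).comp (-X) = (X ^ 2 - 1) ^ G := by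
    simp
  have h2 := iterate_derivative_comp_neg_X ((X ^ 2 - 1 : ℝ[X]) ^ G) G
  rw [h] at h2
  have h3 := congrArg (eval t) h2
  simp only [eval_mul, eval_comp, eval_neg, eval_X, eval_pow, eval_one] at h3
  simp only [legendre, eval_mul, eval_C]
  rw [h3]
  have : ((-1 : ℝ) ^ G) * (-1) ^ G = 1 := by rw [← mul_pow]; simp
  linear_combination -(1 / (2 ^ G * (G.factorial : ℝ))) *
    (eval (-t) (derivative^[G] ((X ^ 2 - 1 : ℝ[X]) ^ G))) * this

lemma abs_le_one_of_legendre_root {G : ℕ} {t : ℝ} (ht : (legendre G).eval t = 0) : |t| ≤ 1 := by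
  rw [abs_le]
  constructor
  · by_contra h
    have h1 := legendre_eval_pos (G := G) (t := -t) (by linarith)
    rw [legendre_eval_neg, ht, mul_zero] at h1
    exact lt_irrefl _ h1
  · by_contra h
    have h1 := legendre_eval_pos (G := G) (t := t) (by linarith)
    rw [ht] at h1
    exact lt_irrefl _ h1

lemma abs_gaussNode_le (G : ℕ) (ℓ : Fin G) : |gaussNode G ℓ| ≤ 1 := by
  rw [gaussNode]
  by_cases h : (ℓ : ℕ) < ((legendre G).roots.sort (· ≤ ·)).length
  · rw [List.getD_eq_getElem _ _ h]
    have hmem := List.getElem_mem h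
    rw [Multiset.mem_sort] at hmem
    exact abs_le_one_of_legendre_root (isRoot_of_mem_roots hmem)
  -- The default value `0` also lies in `[-1,1]`, so the number of real roots need not be known.
  · rw [List.getD_eq_default _ _ (by omega)]
    simp

/-- Nonnegativity follows from `|t| ≤ 1` alone; a vanishing denominator would give the weight `0`.
-/
lemma gaussWeight_nonneg (G : ℕ) (ℓ : Fin G) : 0 ≤ gaussWeight G ℓ := by
  have h := abs_gaussNode_le G ℓ
  have h2 : 0 ≤ 1 - gaussNode G ℓ ^ 2 := by
    have := sq_abs (gaussNode G ℓ)
    nlinarith [abs_nonneg (gaussNode G ℓ)]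
  rw [gaussWeight]
  positivity

lemma quadWeight_nonneg {d : ℕ} (E : ℕ) {G : ℕ} (ℓ : Fin d → Fin G) : 0 ≤ quadWeight E ℓ :=
  Finset.prod_nonneg fun i _ => div_nonneg (gaussWeight_nonneg G (ℓ i)) (by positivity)

/-- The Gauss node on `[0,1]`. -/
def unitNode (G : ℕ) (ℓ : Fin G) : ℝ := (gaussNode G ℓ + 1) / 2

lemma unitNode_mem (G : ℕ) (ℓ : Fin G) : unitNode G ℓ ∈ Set.Icc (0 : ℝ) 1 := by
  have h := abs_le.1 (abs_gaussNode_le G ℓ)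
  constructor <;> rw [unitNode] <;> linarith [h.1, h.2]

lemma quadPoint_mem {d E G : ℕ} (e : Fin d → Fin E) (ℓ : Fin d → Fin G) :
    quadPoint e ℓ ∈ unitCube d := by
  have h : ∀ i, 0 ≤ quadPoint e ℓ i ∧ quadPoint e ℓ i ≤ 1 := by
    intro i
    have h1 := unitNode_mem G (ℓ i)
    have hE : (0 : ℝ) < E := by exact_mod_cast (e i).pos
    have he : ((e i : ℕ) : ℝ) + 1 ≤ E := by exact_mod_cast (e i).2
    have h2 : quadPoint e ℓ i = (unitNode G (ℓ i) + ((e i : ℕ) : ℝ)) / E := rfl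
    rw [h2]
    constructor
    · have := h1.1; positivity
    · rw [div_le_one hE]; linarith [h1.2]
  exact ⟨fun i => (h i).1, fun i => (h i).2⟩

end Legendre

/-! ## Bounds for norms -/

section Norms

/-- The bound by the essential supremum holds almost everywhere. The excess `max (|q| - (‖f‖ + ε))
0` is continuous and vanishes almost everywhere on the cube, which lies in the closure of its
interior, so it vanishes there everywhere. Positivity of `supNorm f` excludes an infinite norm,
which `toReal` would send to `0`. -/
lemma abs_eval_le_supNorm_add {d : ℕ} {f : (Fin d → ℝ) → ℝ} (hf : 0 < supNorm f)
    {q : MvPolynomial (Fin d) ℝ} {ε : ℝ}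
    (hq : ∀ x ∈ unitCube d, |f x - MvPolynomial.eval x q| ≤ ε) :
    ∀ x ∈ unitCube d, |MvPolynomial.eval x q| ≤ supNorm f + ε := by
  have hm : MeasurableSet (unitCube d) := measurableSet_Icc
  have hfin : eLpNorm f ⊤ (volume.restrict (unitCube d)) ≠ ⊤ := by
    intro h
    rw [supNorm, h] at hf
    simp at hf
  have h1 : ∀ᵐ x ∂(volume.restrict (unitCube d)), |f x| ≤ supNorm f := by
    have h := ae_le_eLpNormEssSup (f := f) (μ := volume.restrict (unitCube d))
    filter_upwards [h] with x hx
    rw [← eLpNorm_exponent_top] at hx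
    have h2 := ENNReal.toReal_mono hfin hx
    rwa [toReal_enorm, Real.norm_eq_abs] at h2
  have hcont : Continuous fun x : Fin d → ℝ => MvPolynomial.eval x q :=
    MvPolynomial.continuous_eval q
  have h2 : (fun x => max (|MvPolynomial.eval x q| - (supNorm f + ε)) 0)
      =ᵐ[volume.restrict (unitCube d)] fun _ => (0 : ℝ) := by
    filter_upwards [h1, ae_restrict_mem hm] with x hx hxc
    refine max_eq_right ?_
    have h3 := abs_le.1 (hq x hxc)
    have h4 := abs_le.1 hx
    have : |MvPolynomial.eval x q| ≤ supNorm f + ε := abs_le.2 ⟨by linarith, by linarith⟩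
    linarith
  have hcl : unitCube d ⊆ closure (interior (unitCube d)) := by
    have hne : (interior (unitCube d)).Nonempty := by
      refine ⟨fun _ => 1 / 2, ?_⟩
      rw [unitCube, ← Set.pi_univ_Icc, interior_pi_set Set.finite_univ]
      intro i _
      show (1 / 2 : ℝ) ∈ interior (Set.Icc (0 : ℝ) 1)
      rw [interior_Icc]
      constructor <;> norm_num
    have h := Convex.closure_interior_eq_closure_of_nonempty_interior (𝕜 := ℝ)
      (convex_Icc (0 : Fin d → ℝ) 1) hne
    rw [show closure (interior (unitCube d)) = closure (unitCube d) from h]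
    exact subset_closure
  have h3 := Measure.eqOn_of_ae_eq h2
    (Continuous.continuousOn ((hcont.abs.sub continuous_const).max continuous_const))
    continuousOn_const hcl
  intro x hx
  have h4 : max (|MvPolynomial.eval x q| - (supNorm f + ε)) 0 = 0 := h3 hx
  have := le_max_left (|MvPolynomial.eval x q| - (supNorm f + ε)) 0
  rw [h4] at this
  linarith

/-- The Schur test. -/
lemma norm_toEuclideanCLM_le {ι : Type} [Fintype ι] [DecidableEq ι] (M : Matrix ι ι ℂ) {s : ℝ}
    (hs : 0 ≤ s) (hrow : ∀ i, ∑ j, ‖M i j‖ ≤ s) (hcol : ∀ j, ∑ i, ‖M i j‖ ≤ s) :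
    ‖Matrix.toEuclideanCLM (n := ι) (𝕜 := ℂ) M‖ ≤ s := by
  refine ContinuousLinearMap.opNorm_le_bound _ hs fun y => ?_
  have h0 : ‖Matrix.toEuclideanCLM (n := ι) (𝕜 := ℂ) M y‖ ^ 2 ≤ (s * ‖y‖) ^ 2 := by
    rw [EuclideanSpace.norm_sq_eq, mul_pow, EuclideanSpace.norm_sq_eq]
    have h1 : ∀ i, ‖(Matrix.toEuclideanCLM (n := ι) (𝕜 := ℂ) M y) i‖ ^ 2 ≤
        s * ∑ j, ‖M i j‖ * ‖y j‖ ^ 2 := by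
      intro i
      have e : (Matrix.toEuclideanCLM (n := ι) (𝕜 := ℂ) M y) i = ∑ j, M i j * y j := rfl
      rw [e]
      have h2 : ‖∑ j, M i j * y j‖ ≤ ∑ j, ‖M i j‖ * ‖y j‖ := by
        refine (norm_sum_le _ _).trans (le_of_eq ?_)
        exact Finset.sum_congr rfl fun j _ => norm_mul _ _
      have h3 : (∑ j, ‖M i j‖ * ‖y j‖) ^ 2 ≤ (∑ j, ‖M i j‖) * ∑ j, ‖M i j‖ * ‖y j‖ ^ 2 :=
        Finset.sum_sq_le_sum_mul_sum_of_sq_le_mul _ (fun _ _ => norm_nonneg _)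
          (fun _ _ => by positivity) fun j _ => le_of_eq (by ring)
      calc ‖∑ j, M i j * y j‖ ^ 2 ≤ (∑ j, ‖M i j‖ * ‖y j‖) ^ 2 := by gcongr
        _ ≤ (∑ j, ‖M i j‖) * ∑ j, ‖M i j‖ * ‖y j‖ ^ 2 := h3
        _ ≤ s * ∑ j, ‖M i j‖ * ‖y j‖ ^ 2 := by
          refine mul_le_mul_of_nonneg_right (hrow i) (Finset.sum_nonneg fun j _ => by positivity)
    calc ∑ i, ‖(Matrix.toEuclideanCLM (n := ι) (𝕜 := ℂ) M y) i‖ ^ 2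
        ≤ ∑ i, s * ∑ j, ‖M i j‖ * ‖y j‖ ^ 2 := Finset.sum_le_sum fun i _ => h1 i
      _ = s * ∑ j, (∑ i, ‖M i j‖) * ‖y j‖ ^ 2 := by
        rw [← Finset.mul_sum, Finset.sum_comm]
        simp_rw [Finset.sum_mul]
      _ ≤ s * ∑ j, s * ‖y j‖ ^ 2 := by
        refine mul_le_mul_of_nonneg_left (Finset.sum_le_sum fun j _ => ?_) hs
        exact mul_le_mul_of_nonneg_right (hcol j) (by positivity)
      _ = s ^ 2 * ∑ j, ‖y j‖ ^ 2 := by rw [← Finset.mul_sum]; ring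
  exact le_of_sq_le_sq h0 (by positivity)

variable {d n p E : ℕ}

lemma IsConn.ext (hp : 0 < p) {e e' : Fin d → Fin E} {j : Fin d → Fin (p + 1)}
    {J : Fin d → Fin (2 ^ n)} (h : IsConn e j J) (h' : IsConn e' j J) : e = e' := by
  funext i
  have h1 := h i
  have h2 := h' i
  have : (e i : ℕ) * p = (e' i : ℕ) * p := by omega
  exact Fin.ext (Nat.eq_of_mul_eq_mul_right hp this)

lemma IsConn.ext_right {e : Fin d → Fin E} {j : Fin d → Fin (p + 1)}
    {J J' : Fin d → Fin (2 ^ n)} (h : IsConn e j J) (h' : IsConn e j J') : J = J' := by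
  funext i
  exact Fin.ext ((h i).trans (h' i).symm)

open Classical in
lemma norm_assemble_apply_le (a : (Fin d → Fin E) → (Fin d → Fin (p + 1)) →
    (Fin d → Fin (p + 1)) → ℝ) (J K : Fin d → Fin (2 ^ n)) :
    ‖assemble n a J K‖ ≤ ∑ e, ∑ j, ∑ k, if IsConn e j J ∧ IsConn e k K then |a e j k| else 0 := by
  rw [assemble]
  refine (norm_sum_le _ _).trans (Finset.sum_le_sum fun e _ => (norm_sum_le _ _).trans
    (Finset.sum_le_sum fun j _ => (norm_sum_le _ _).trans (Finset.sum_le_sum fun k _ => ?_)))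
  split_ifs <;> simp

/-- The norm of an assembled array. -/
lemma norm_assemble_le (hp : 0 < p) (a : (Fin d → Fin E) → (Fin d → Fin (p + 1)) →
    (Fin d → Fin (p + 1)) → ℝ) (b : (Fin d → Fin (p + 1)) → (Fin d → Fin (p + 1)) → ℝ)
    (hab : ∀ e j k, |a e j k| ≤ b j k) (hb : ∀ j k, 0 ≤ b j k) :
    ‖Matrix.toEuclideanCLM (n := Fin d → Fin (2 ^ n)) (𝕜 := ℂ) (assemble n a)‖ ≤
      ∑ j, ∑ k, b j k := by
  classical
  -- For fixed `j` and `k`, the row node `J` belongs to at most one element, and that element fixes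
  -- the column node. So each pair contributes at most `b j k` to a row, and likewise to a column;
  -- the elements do not accumulate.
  have key1 : ∀ J : Fin d → Fin (2 ^ n), ∀ j k, ∑ e : Fin d → Fin E, ∑ K : Fin d → Fin (2 ^ n),
      (if IsConn e j J ∧ IsConn e k K then |a e j k| else 0) ≤ b j k := by
    intro J j k
    have h1 : ∀ e : Fin d → Fin E, ∑ K : Fin d → Fin (2 ^ n),
        (if IsConn e j J ∧ IsConn e k K then |a e j k| else 0) ≤
          if IsConn e j J then b j k else 0 := by
      intro e
      by_cases hJ : IsConn e j J
      · simp only [hJ, true_and, if_true]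
        by_cases hK : ∃ K : Fin d → Fin (2 ^ n), IsConn e k K
        · obtain ⟨K, hK⟩ := hK
          rw [Finset.sum_eq_single K]
          · rw [if_pos hK]; exact hab e j k
          · intro K' _ hne
            exact if_neg fun h => hne (h.ext_right hK)
          · simp
        · rw [Finset.sum_eq_zero fun K _ => if_neg fun h => hK ⟨K, h⟩]
          exact hb j k
      · simp [hJ]
    refine (Finset.sum_le_sum fun e _ => h1 e).trans ?_
    by_cases hE : ∃ e : Fin d → Fin E, IsConn e j J
    · obtain ⟨e, he⟩ := hE
      rw [Finset.sum_eq_single e]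
      · rw [if_pos he]
      · intro e' _ hne
        exact if_neg fun h => hne (h.ext hp he)
      · simp
    · rw [Finset.sum_eq_zero fun e _ => if_neg fun h => hE ⟨e, h⟩]
      exact hb j k
  have key2 : ∀ K : Fin d → Fin (2 ^ n), ∀ j k, ∑ e : Fin d → Fin E, ∑ J : Fin d → Fin (2 ^ n),
      (if IsConn e j J ∧ IsConn e k K then |a e j k| else 0) ≤ b j k := by
    intro K j k
    have h1 : ∀ e : Fin d → Fin E, ∑ J : Fin d → Fin (2 ^ n),
        (if IsConn e j J ∧ IsConn e k K then |a e j k| else 0) ≤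
          if IsConn e k K then b j k else 0 := by
      intro e
      by_cases hK : IsConn e k K
      · simp only [hK, and_true, if_true]
        by_cases hJ : ∃ J : Fin d → Fin (2 ^ n), IsConn e j J
        · obtain ⟨J, hJ⟩ := hJ
          rw [Finset.sum_eq_single J]
          · rw [if_pos hJ]; exact hab e j k
          · intro J' _ hne
            exact if_neg fun h => hne (h.ext_right hJ)
          · simp
        · rw [Finset.sum_eq_zero fun J _ => if_neg fun h => hJ ⟨J, h⟩]
          exact hb j k
      · simp [hK]
    refine (Finset.sum_le_sum fun e _ => h1 e).trans ?_
    by_cases hE : ∃ e : Fin d → Fin E, IsConn e k K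
    · obtain ⟨e, he⟩ := hE
      rw [Finset.sum_eq_single e]
      · rw [if_pos he]
      · intro e' _ hne
        exact if_neg fun h => hne (h.ext hp he)
      · simp
    · rw [Finset.sum_eq_zero fun e _ => if_neg fun h => hE ⟨e, h⟩]
      exact hb j k
  refine norm_toEuclideanCLM_le _ (Finset.sum_nonneg fun j _ => Finset.sum_nonneg fun k _ => hb j k)
    (fun J => ?_) fun K => ?_
  · refine (Finset.sum_le_sum fun K _ => norm_assemble_apply_le a J K).trans ?_
    rw [Finset.sum_comm]
    calc ∑ e : Fin d → Fin E, ∑ K : Fin d → Fin (2 ^ n), ∑ j, ∑ k,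
          (if IsConn e j J ∧ IsConn e k K then |a e j k| else 0)
        = ∑ e : Fin d → Fin E, ∑ j, ∑ k, ∑ K : Fin d → Fin (2 ^ n),
          (if IsConn e j J ∧ IsConn e k K then |a e j k| else 0) := by
          refine Finset.sum_congr rfl fun e _ => ?_
          rw [Finset.sum_comm]
          exact Finset.sum_congr rfl fun j _ => Finset.sum_comm
      _ = ∑ j, ∑ k, ∑ e : Fin d → Fin E, ∑ K : Fin d → Fin (2 ^ n),
          (if IsConn e j J ∧ IsConn e k K then |a e j k| else 0) := by
          rw [Finset.sum_comm]
          exact Finset.sum_congr rfl fun j _ => Finset.sum_comm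
      _ ≤ _ := Finset.sum_le_sum fun j _ => Finset.sum_le_sum fun k _ => key1 J j k
  · refine (Finset.sum_le_sum fun J _ => norm_assemble_apply_le a J K).trans ?_
    rw [Finset.sum_comm]
    calc ∑ e : Fin d → Fin E, ∑ J : Fin d → Fin (2 ^ n), ∑ j, ∑ k,
          (if IsConn e j J ∧ IsConn e k K then |a e j k| else 0)
        = ∑ e : Fin d → Fin E, ∑ j, ∑ k, ∑ J : Fin d → Fin (2 ^ n),
          (if IsConn e j J ∧ IsConn e k K then |a e j k| else 0) := by
          refine Finset.sum_congr rfl fun e _ => ?_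
          rw [Finset.sum_comm]
          exact Finset.sum_congr rfl fun j _ => Finset.sum_comm
      _ = ∑ j, ∑ k, ∑ e : Fin d → Fin E, ∑ J : Fin d → Fin (2 ^ n),
          (if IsConn e j J ∧ IsConn e k K then |a e j k| else 0) := by
          rw [Finset.sum_comm]
          exact Finset.sum_congr rfl fun j _ => Finset.sum_comm
      _ ≤ _ := Finset.sum_le_sum fun j _ => Finset.sum_le_sum fun k _ => key2 K j k

end Norms

/-! ## Computations with one-hot encodings -/

section OneHot

variable {Q τ τ' ι : Type} {S : Set Q} [DecidableEq τ] [DecidableEq τ']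
  {H : Set ((Q → Bool) → Bool)} {σ : Finset τ} {σ' : Finset τ'} {g : (Q → Bool) → τ}

/-- The indicator functions of the values in `σ` of a function. -/
def Ind (σ : Finset τ) (g : (Q → Bool) → τ) : Set ((Q → Bool) → Bool) :=
  (fun s x => decide (g x = s)) '' σ

lemma Comp.of_eq {f f' : (Q → Bool) → Bool} {k : ℕ} (h : Comp S H {f} k) (hf : ∀ x, f x = f' x) :
    Comp S H {f'} k := by
  rwa [← show f = f' from funext hf]

/-- At most one of the indicators is true, so their exclusive or is their disjunction and one step
per element suffices. -/
lemma Comp.memInd (hH : Ind σ g ⊆ H) (t : Finset τ) (ht : t ⊆ σ) :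
    Comp S H {fun x => decide (g x ∈ t)} (t.card + 2) := by
  induction t using Finset.induction_on with
  | empty => simpa using Comp.ff
  | insert a t ha ih =>
    rw [Finset.card_insert_of_notMem ha]
    have h1 := ih ((Finset.subset_insert a t).trans ht)
    have h2 : (fun x : Q → Bool => decide (g x = a)) ∈ H :=
      hH ⟨a, ht (Finset.mem_insert_self a t), rfl⟩
    refine ((h1.trans' (Comp.xor (f := fun x => decide (g x = a))
      (g := fun x => decide (g x ∈ t)) (Or.inl h2) (Or.inr rfl))).of_eq ?_).mono subset_rfl
      subset_rfl (by omega)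
    intro x
    by_cases hx : g x = a
    · simp [hx, ha]
    · simp [hx]

lemma Comp.pred (hH : Ind σ g ⊆ H) (hg : ∀ x, g x ∈ σ) (φ : τ → Bool) :
    Comp S H {fun x => φ (g x)} (σ.card + 2) := by
  refine ((Comp.memInd hH (σ.filter fun s => φ s = true) (Finset.filter_subset _ _)).of_eq
    fun x => ?_).mono subset_rfl subset_rfl
    (Nat.add_le_add_right (Finset.card_le_card (Finset.filter_subset _ _)) 2)
  simp [hg x]

/-- The preimages of the values under `δ` are disjoint, so the disjunctions together take at most
`σ.card` steps, plus two for each value. This linear cost is what makes the one-hot automata cheap.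
-/
lemma Comp.image (hH : Ind σ g ⊆ H) (hg : ∀ x, g x ∈ σ) (δ : τ → τ') {g' : (Q → Bool) → τ'}
    (hg' : ∀ x, g' x = δ (g x)) : Comp S H (Ind σ' g') (σ.card + 2 * σ'.card) := by
  have h := Comp.biUnion (S := S) (H := H) σ' (T := fun s => {fun x => decide (g' x = s)})
    (k := fun s => (σ.filter fun a => δ a = s).card + 2) fun s _ => by
      refine (Comp.memInd hH (σ.filter fun a => δ a = s) (Finset.filter_subset _ _)).of_eq
        fun x => ?_
      simp [hg x, hg']
  refine h.mono subset_rfl ?_ ?_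
  · rintro _ ⟨s, hs, rfl⟩
    exact Set.mem_biUnion (x := s) (Finset.mem_coe.1 hs) rfl
  · rw [Finset.sum_add_distrib, Finset.sum_const, smul_eq_mul, mul_comm 2]
    refine Nat.add_le_add_right ?_ _
    rw [← Finset.card_biUnion]
    · exact Finset.card_le_card fun a ha => by
        obtain ⟨s, -, h⟩ := Finset.mem_biUnion.1 ha
        exact Finset.filter_subset _ _ h
    · intro s _ s' _ hss
      rw [Function.onFun, Finset.disjoint_left]
      intro a ha ha'
      exact hss ((Finset.mem_filter.1 ha).2.symm.trans (Finset.mem_filter.1 ha').2)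

variable {b : (Q → Bool) → Bool}

lemma Comp.pair (hH : Ind σ g ⊆ H) (hb : b ∈ H) :
    Comp S H (Ind (σ ×ˢ Finset.univ) fun x => (g x, b x)) (4 * σ.card) := by
  have h := Comp.biUnion (S := S) (H := H) σ
    (T := fun s => {fun x => decide (g x = s) && b x} ∪ {fun x => decide (g x = s) && !b x})
    (k := fun _ => 4) fun s hs => by
      have h2 : (fun x : Q → Bool => decide (g x = s)) ∈ H := hH ⟨s, hs, rfl⟩
      exact (Comp.and (f := fun x => decide (g x = s)) h2 hb).union
        (Comp.and_not (f := fun x => decide (g x = s)) h2 hb)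
  refine h.mono subset_rfl ?_ (by rw [Finset.sum_const, smul_eq_mul, mul_comm])
  rintro _ ⟨⟨s, c⟩, hs, rfl⟩
  have hs' : s ∈ σ := (Finset.mem_product.1 (Finset.mem_coe.1 hs)).1
  refine Set.mem_biUnion (x := s) hs' ?_
  cases c
  · right
    rw [Set.mem_singleton_iff]
    funext x
    simp [Prod.ext_iff, Bool.decide_and]
  · left
    rw [Set.mem_singleton_iff]
    funext x
    simp [Prod.ext_iff, Bool.decide_and]

lemma Comp.pred₂ (hH : Ind σ g ⊆ H) (hg : ∀ x, g x ∈ σ) (hb : b ∈ H) (φ : τ → Bool → Bool) :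
    Comp S H {fun x => φ (g x) (b x)} (6 * σ.card + 2) := by
  refine ((Comp.pair hH hb).trans' (Comp.pred Set.subset_union_right (fun x => ?_)
    fun s => φ s.1 s.2)).mono subset_rfl subset_rfl ?_
  · simp [hg x]
  · simp only [Finset.card_product, Finset.card_univ, Fintype.card_bool]; omega

lemma Comp.step (hH : Ind σ g ⊆ H) (hg : ∀ x, g x ∈ σ) (hb : b ∈ H) (δ : τ → Bool → τ')
    {g' : (Q → Bool) → τ'} (hg' : ∀ x, g' x = δ (g x) (b x)) :
    Comp S H (Ind σ' g') (6 * σ.card + 2 * σ'.card) := by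
  refine ((Comp.pair hH hb).trans' (Comp.image Set.subset_union_right (fun x => ?_)
    (fun s => δ s.1 s.2) hg')).mono subset_rfl subset_rfl ?_
  · simp [hg x]
  · simp only [Finset.card_product, Finset.card_univ, Fintype.card_bool]; omega

/-- The binary decoder. -/
lemma Comp.decode {B : ℕ} (w : Fin B → Q) (hw : ∀ r, w r ∈ S) :
    Comp S H (Ind Finset.univ fun x r => x (w r)) (6 * 2 ^ B) := by
  induction B with
  | zero =>
    refine (Comp.tt (S := S) (H := H)).mono subset_rfl ?_ (by omega)
    rintro _ ⟨s, -, rfl⟩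
    rw [Set.mem_singleton_iff]
    funext x
    simp only [decide_eq_true_eq]
    exact Subsingleton.elim _ _
  | succ B ih =>
    have h1 := ih (fun r => w r.succ) fun r => hw _
    have h2 : Comp S (H ∪ Ind Finset.univ fun x (r : Fin B) => x (w r.succ))
      {fun x => x (w 0)} 1 := Comp.var (hw 0)
    refine ((h1.trans' (h2.trans' (Comp.pair (g := fun x (r : Fin B) => x (w r.succ))
      (σ := Finset.univ) (b := fun x => x (w 0)) ?_ ?_)))).mono subset_rfl ?_ ?_
    · exact fun f hf => Or.inl (Or.inr hf)
    · exact Or.inr rfl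
    · rintro _ ⟨s, -, rfl⟩
      refine ⟨(fun r => s r.succ, s 0), by simp, ?_⟩
      funext x
      simp only [Prod.ext_iff, funext_iff, Fin.forall_fin_succ, and_comm]
    · rw [Finset.card_univ, Fintype.card_fun, Fintype.card_bool, Fintype.card_fin, pow_succ]
      have := Nat.one_le_two_pow (n := B)
      omega

lemma Comp.any {s : Finset ι} {f : ι → (Q → Bool) → Bool} (hf : ∀ a ∈ s, f a ∈ H) :
    Comp S H {fun x => decide (∃ a ∈ s, f a x = true)} (3 * s.card + 3) := by
  classical
  have h : Comp S H {fun x => decide (∀ a ∈ s, f a x = false)} (3 * s.card + 1) := by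
    induction s using Finset.induction_on with
    | empty => simpa using Comp.tt
    | insert a s ha ih =>
      rw [Finset.card_insert_of_notMem ha]
      have h1 := ih fun b hb => hf b (Finset.mem_insert_of_mem hb)
      refine ((h1.trans' (Comp.and_not (f := fun x => decide (∀ a ∈ s, f a x = false))
        (g := f a) (Or.inr rfl) (Or.inl (hf a (Finset.mem_insert_self a s))))).of_eq
        ?_).mono subset_rfl subset_rfl (by omega)
      intro x
      cases hx : f a x <;> simp [hx]
  refine ((h.trans' (Comp.not (f := fun x => decide (∀ a ∈ s, f a x = false))
    (Or.inr rfl))).of_eq ?_).mono subset_rfl subset_rfl (by omega)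
  intro x
  rw [Bool.eq_iff_iff]
  simp

/-- The computation of the states of an automaton. -/
lemma Comp.scan {n : ℕ} {g : ℕ → (Q → Bool) → τ} (hH : Ind σ (g 0) ⊆ H)
    (hg : ∀ t x, g t x ∈ σ) (w : Fin n → Q) (hw : ∀ r, w r ∈ S) (δ : ℕ → τ → Bool → τ)
    (hδ : ∀ (t : Fin n) x, g (t + 1) x = δ t (g t x) (x (w t))) (φ : ℕ → τ → Bool → Bool) :
    Comp S H ((⋃ t : Fin n, {fun x => φ t (g t x) (x (w t))}) ∪ Ind σ (g n))
      (n * (14 * σ.card + 4)) := by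
  have h1 := Comp.iterate (S := S) (H := H) (T := fun t => Ind σ (g t)) (k := 8 * σ.card + 1)
    (n := n) (fun t ht => by
      have h := Comp.step (S := S)
        (H := (H ∪ Ind σ (g t)) ∪ {fun x : Q → Bool => x (w ⟨t, ht⟩)}) (σ := σ)
        (σ' := σ) (g := g t) (b := fun x => x (w ⟨t, ht⟩)) (fun f hf => Or.inl (Or.inr hf)) (hg t)
        (Or.inr rfl) (δ t) (hδ ⟨t, ht⟩)
      exact ((Comp.var (hw ⟨t, ht⟩)).trans' h).mono subset_rfl subset_rfl (by omega)) n le_rfl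
  have h1' := h1.mono (H' := H) (Set.union_subset subset_rfl hH) subset_rfl le_rfl
  have h2 : Comp S (H ∪ ⋃ t ∈ Finset.range (n + 1), Ind σ (g t))
      (⋃ t : Fin n, {fun x => φ t (g t x) (x (w t))}) (n * (6 * σ.card + 3)) := by
    refine (Comp.iUnion (k := 6 * σ.card + 3) fun t : Fin n => ?_).mono subset_rfl subset_rfl
      (by simp)
    have h := Comp.pred₂ (S := S) (H := (H ∪ ⋃ t ∈ Finset.range (n + 1), Ind σ (g t)) ∪
      {fun x : Q → Bool => x (w t)}) (σ := σ) (g := g t) (b := fun x => x (w t))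
      (fun f hf => Or.inl (Or.inr (Set.mem_biUnion (x := (t : ℕ)) (by simp) hf))) (hg t)
      (Or.inr rfl) (φ t)
    exact ((Comp.var (hw t)).trans' h).mono subset_rfl subset_rfl (by omega)
  refine (h1'.trans h2).mono subset_rfl ?_ (by ring_nf; omega)
  refine Set.union_subset Set.subset_union_right fun f hf => Or.inl ?_
  exact Set.mem_biUnion (x := n) (by simp) hf

end OneHot

/-! ## Arithmetic -/

section Arithmetic

variable {Q : Type} {S : Set Q} {H : Set ((Q → Bool) → Bool)} {n : ℕ}

/-- The number with the binary digits on the given wires. -/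
def wireNum (w : Fin n → Q) (x : Q → Bool) : ℕ := Nat.ofBits fun r => x (w r)

lemma testBit_wireNum (w : Fin n → Q) (x : Q → Bool) (r : Fin n) :
    (wireNum w x).testBit r = x (w r) := Nat.testBit_ofBits_lt _ _ r.2

lemma wireNum_lt (w : Fin n → Q) (x : Q → Bool) : wireNum w x < 2 ^ n := Nat.ofBits_lt_two_pow _

lemma wireNum_eq {w : Fin n → Q} {x : Q → Bool} {K : ℕ} (hK : K < 2 ^ n)
    (h : ∀ r : Fin n, x (w r) = K.testBit r) : wireNum w x = K := by
  refine Nat.eq_of_testBit_eq fun t => ?_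
  by_cases ht : t < n
  · exact (testBit_wireNum w x ⟨t, ht⟩).trans (h ⟨t, ht⟩)
  · rw [Nat.testBit_eq_false_of_lt, Nat.testBit_eq_false_of_lt]
    · exact hK.trans_le (Nat.pow_le_pow_right two_pos (by omega))
    · exact (wireNum_lt w x).trans_le (Nat.pow_le_pow_right two_pos (by omega))

lemma wireNum_mod_succ (w : Fin n → Q) (x : Q → Bool) (t : Fin n) :
    wireNum w x % 2 ^ ((t : ℕ) + 1) =
      wireNum w x % 2 ^ (t : ℕ) + 2 ^ (t : ℕ) * (x (w t)).toNat := by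
  rw [Nat.mod_pow_succ, ← testBit_wireNum w x t, Nat.toNat_testBit]

/-- The binary digit number `t` of an integer. -/
def intBit (a : ℤ) (t : ℕ) : Bool := decide (a / 2 ^ t % 2 = 1)

lemma intBit_natCast (a t : ℕ) : intBit a t = a.testBit t := by
  rw [intBit, Nat.testBit_eq_decide_div_mod_eq]
  congr 1
  apply propext
  norm_cast

lemma sum_testBit (n A : ℕ) (hA : A < 2 ^ n) :
    ∑ r : Fin n, (A.testBit r).toNat * 2 ^ (r : ℕ) = A := by
  rw [Fin.sum_univ_eq_sum_range fun r => (A.testBit r).toNat * 2 ^ r]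
  have h : ∀ m, ∑ r ∈ Finset.range m, (A.testBit r).toNat * 2 ^ r = A % 2 ^ m := by
    intro m
    induction m with
    | zero => simp [Nat.mod_one]
    | succ m ih => rw [Finset.sum_range_succ, ih, Nat.mod_pow_succ, Nat.toNat_testBit, mul_comm]
  rw [h, Nat.mod_eq_of_lt hA]

/-- The addition of a small number to a number in the wires, with the carry out. -/
lemma Comp.addShift (p : ℕ) (w : Fin n → Q) (hw : ∀ r, w r ∈ S) {s : (Q → Bool) → ℤ}
    (hs : ∀ x, s x ∈ Finset.Icc (-(p : ℤ)) p) (hH : Ind (Finset.Icc (-(p : ℤ)) p) s ⊆ H)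
    (hp : 0 < p) :
    Comp S H ((⋃ t : Fin n, {fun x => intBit (wireNum w x + s x) t}) ∪
      {fun x => decide (0 ≤ wireNum w x + s x ∧ wireNum w x + s x < 2 ^ n)})
      (n * (14 * (2 * p + 1) + 4) + (2 * p + 3)) := by
  -- The state is the carry into digit `t` when the shift `s` is added, with rounding down so that
  -- negative shifts are included. It stays between `-p` and `p`, and the next carry depends only on
  -- it and on the digit read.
  set g : ℕ → (Q → Bool) → ℤ := fun t x => (((wireNum w x % 2 ^ t : ℕ) : ℤ) + s x) / 2 ^ t with hg
  have hcard : (Finset.Icc (-(p : ℤ)) p).card = 2 * p + 1 := by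
    rw [Int.card_Icc]; omega
  have hmem : ∀ t x, g t x ∈ Finset.Icc (-(p : ℤ)) p := by
    intro t x
    have h1 := Finset.mem_Icc.1 (hs x)
    have h2 : (1 : ℤ) ≤ 2 ^ t := one_le_pow₀ (by norm_num)
    have h3 : ((wireNum w x % 2 ^ t : ℕ) : ℤ) < 2 ^ t := by
      exact_mod_cast Nat.mod_lt _ (by positivity)
    have hp' : (1 : ℤ) ≤ p := by exact_mod_cast hp
    rw [Finset.mem_Icc]
    constructor
    · rw [Int.le_ediv_iff_mul_le (by positivity)]
      nlinarith [Int.natCast_nonneg (wireNum w x % 2 ^ t)]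
    · rw [← Int.lt_add_one_iff, Int.ediv_lt_iff_lt_mul (by positivity)]
      nlinarith
  have hstep : ∀ (t : Fin n) x, g (t + 1) x = (g t x + (x (w t)).toNat) / 2 := by
    intro t x
    simp only [hg]
    rw [wireNum_mod_succ, pow_succ, ← Int.ediv_ediv_of_nonneg (by positivity)]
    congr 1
    push_cast
    rw [show ((wireNum w x : ℤ) % 2 ^ (t : ℕ) + 2 ^ (t : ℕ) * ((x (w t)).toNat : ℤ) + s x) =
      ((wireNum w x : ℤ) % 2 ^ (t : ℕ) + s x) + ((x (w t)).toNat : ℤ) * 2 ^ (t : ℕ) by ring,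
      Int.add_mul_ediv_right _ _ (by positivity)]
  have h0 : g 0 = s := by
    funext x
    simp [hg]
  have hout : ∀ (t : Fin n) x, intBit (wireNum w x + s x) t =
      decide ((g t x + (x (w t)).toNat) % 2 = 1) := by
    intro t x
    have e1 : ((wireNum w x : ℤ) + s x) / 2 ^ (t : ℕ) =
        g t x + ((wireNum w x / 2 ^ (t : ℕ) : ℕ) : ℤ) := by
      simp only [hg]
      have := Nat.mod_add_div (wireNum w x) (2 ^ (t : ℕ))
      conv_lhs => rw [← this]
      push_cast
      rw [show ((wireNum w x : ℤ) % 2 ^ (t : ℕ) + 2 ^ (t : ℕ) * ((wireNum w x : ℤ) / 2 ^ (t : ℕ)) +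
        s x) = ((wireNum w x : ℤ) % 2 ^ (t : ℕ) + s x) +
          ((wireNum w x : ℤ) / 2 ^ (t : ℕ)) * 2 ^ (t : ℕ) by ring,
        Int.add_mul_ediv_right _ _ (by positivity)]
    have e2 : (x (w t)).toNat = wireNum w x / 2 ^ (t : ℕ) % 2 := by
      rw [← testBit_wireNum w x t, Nat.toNat_testBit]
    rw [intBit, e1, e2]
    congr 1
    apply propext
    push_cast
    omega
  have h1 := Comp.scan (S := S) (H := H) (σ := Finset.Icc (-(p : ℤ)) p) (g := g) (by rwa [h0])
    hmem w hw
    (fun _ s b => (s + b.toNat) / 2) hstep (fun _ s b => decide ((s + b.toNat) % 2 = 1))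
  have h2 := Comp.pred (S := S) (σ := Finset.Icc (-(p : ℤ)) p) (g := g n)
    (H := H ∪ ((⋃ t : Fin n, {fun x => decide ((g t x + (x (w t)).toNat) % 2 = 1)}) ∪
      Ind (Finset.Icc (-(p : ℤ)) p) (g n))) (fun f hf => Or.inr (Or.inr hf)) (hmem n)
    fun s => decide (s = 0)
  rw [hcard] at h1 h2
  refine (h1.trans h2).mono subset_rfl ?_ (by omega)
  refine Set.union_subset ?_ ?_
  · intro f hf
    obtain ⟨t, ht⟩ := Set.mem_iUnion.1 hf
    refine Or.inl (Or.inl (Set.mem_iUnion.2 ⟨t, ?_⟩))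
    rw [Set.mem_singleton_iff] at ht ⊢
    rw [ht]
    funext x
    exact hout t x
  -- After all `n` digits the carry is the floor of the shifted number divided by `2 ^ n`; it is
  -- zero exactly if there is neither underflow nor overflow.
  · rintro f rfl
    right
    rw [Set.mem_singleton_iff]
    funext x
    congr 1
    apply propext
    have hn : (0 : ℤ) < 2 ^ n := by positivity
    simp only [hg]
    rw [Nat.mod_eq_of_lt (wireNum_lt w x), Int.ediv_eq_iff_of_pos hn, zero_mul, zero_add]

/-- The divisibility of the difference of the number in the wires and a small number. -/
lemma Comp.dvdShift (p : ℕ) (w : Fin n → Q) (hw : ∀ r, w r ∈ S) {s : (Q → Bool) → ℤ}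
    (hs : ∀ x, s x ∈ Finset.Icc (-(p : ℤ)) p) (hH : Ind (Finset.Icc (-(p : ℤ)) p) s ⊆ H)
    (hp : 0 < p) :
    Comp S H {fun x => decide ((p : ℤ) ∣ wireNum w x + s x)}
      ((4 * p + 1) + n * (14 * p + 4) + (p + 2)) := by
  -- The state is the remainder modulo `p` of the part that has been read, starting from the shift;
  -- a digit in position `t` adds `2 ^ t`.
  set g : ℕ → (Q → Bool) → ℤ := fun t x => (((wireNum w x % 2 ^ t : ℕ) : ℤ) + s x) % p with hg
  have hp' : (0 : ℤ) < p := by exact_mod_cast hp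
  have hcard : (Finset.Icc (-(p : ℤ)) p).card = 2 * p + 1 := by
    rw [Int.card_Icc]; omega
  have hcard' : (Finset.Ico (0 : ℤ) p).card = p := by
    rw [Int.card_Ico]; omega
  have hmem : ∀ t x, g t x ∈ Finset.Ico (0 : ℤ) p := fun t x =>
    Finset.mem_Ico.2 ⟨Int.emod_nonneg _ hp'.ne', Int.emod_lt_of_pos _ hp'⟩
  have h0 := Comp.image (S := S) (σ' := Finset.Ico (0 : ℤ) p) hH hs (fun s => s % p) (g' := g 0)
    (fun x => by simp [hg])
  have h1 := Comp.scan (S := S) (H := H ∪ Ind (Finset.Ico (0 : ℤ) p) (g 0))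
    (σ := Finset.Ico (0 : ℤ) p) (g := g) Set.subset_union_right hmem w hw
    (fun t s b => (s + 2 ^ t * b.toNat) % p) (fun t x => by
      simp only [hg]
      rw [wireNum_mod_succ, Int.emod_add_emod]
      push_cast
      congr 1
      ring) (fun _ _ _ => true)
  have h2 := Comp.pred (S := S) (σ := Finset.Ico (0 : ℤ) p) (g := g n)
    (H := H ∪ ((⋃ _t : Fin n, {fun _ => true}) ∪ Ind (Finset.Ico (0 : ℤ) p) (g n)))
    (fun f hf => Or.inr (Or.inr hf)) (hmem n) fun s => decide (s = 0)
  rw [hcard, hcard'] at h0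
  rw [hcard'] at h1 h2
  refine (((h0.trans' h1).trans' h2).of_eq fun x => ?_).mono subset_rfl subset_rfl (by omega)
  congr 1
  apply propext
  simp only [hg]
  rw [Nat.mod_eq_of_lt (wireNum_lt w x), Int.dvd_iff_emod_eq_zero]

end Arithmetic

/-! ## The first coin that shows heads -/

section FirstHeads

variable {Q : Type} {S : Set Q} {H : Set ((Q → Bool) → Bool)} {M : ℕ}

/-- The coin `a` is the first one that shows heads. -/
def firstHeads (z : Fin M → Q) (a : Fin M) (x : Q → Bool) : Bool :=
  x (z a) && decide (∀ b < a, x (z b) = false)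

lemma Comp.firstHeads (z : Fin M → Q) (hz : ∀ a, z a ∈ S) :
    Comp S H (⋃ a, {QuFEM.firstHeads z a}) (6 * M + 1) := by
  have h1 := Comp.iterate (S := S) (H := H)
    (T := fun t => {fun x => decide (∀ b : Fin M, (b : ℕ) < t → x (z b) = false)}) (k := 4)
    (n := M) (fun t ht => by
      have h := Comp.and_not (S := S) (H := (H ∪ {fun x : Q → Bool =>
        decide (∀ b : Fin M, (b : ℕ) < t → x (z b) = false)}) ∪ {fun x : Q → Bool => x (z ⟨t, ht⟩)})
        (f := fun x : Q → Bool => decide (∀ b : Fin M, (b : ℕ) < t → x (z b) = false))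
        (g := fun x => x (z ⟨t, ht⟩)) (Or.inl (Or.inr rfl)) (Or.inr rfl)
      refine (((Comp.var (hz ⟨t, ht⟩)).trans' h).of_eq fun x => ?_).mono subset_rfl subset_rfl
        (by omega)
      rw [Bool.eq_iff_iff]
      simp only [Bool.and_eq_true, decide_eq_true_eq, Bool.not_eq_true']
      constructor
      · rintro ⟨h1, h2⟩ b hb
        by_cases hbt : (b : ℕ) = t
        · have : b = ⟨t, ht⟩ := Fin.ext hbt
          rwa [this]
        · exact h1 b (by omega)
      · exact fun h => ⟨fun b hb => h b (by omega), h _ (Nat.lt_succ_self t)⟩) M le_rfl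
  have h0 : Comp S H {fun x : Q → Bool => decide (∀ b : Fin M, (b : ℕ) < 0 → x (z b) = false)} 1 :=
    Comp.tt.of_eq fun x => by simp
  have h2 := h0.trans' h1
  have h3 := Comp.iUnion (S := S) (H := H ∪ ⋃ t ∈ Finset.range (M + 1),
    {fun x : Q → Bool => decide (∀ b : Fin M, (b : ℕ) < t → x (z b) = false)})
    (T := fun a : Fin M => {QuFEM.firstHeads z a}) (k := 2) fun a => by
      have h := Comp.and (S := S) (H := (H ∪ ⋃ t ∈ Finset.range (M + 1),
        {fun x : Q → Bool => decide (∀ b : Fin M, (b : ℕ) < t → x (z b) = false)}) ∪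
        {fun x : Q → Bool => x (z a)}) (f := fun x => x (z a))
        (g := fun x => decide (∀ b : Fin M, (b : ℕ) < (a : ℕ) → x (z b) = false))
        (Or.inr rfl) (Or.inl (Or.inr (Set.mem_biUnion (x := (a : ℕ)) (by simp) rfl)))
      exact (Comp.var (hz a)).trans' h
  rw [Fintype.card_fin] at h3
  exact (h2.trans' h3).mono subset_rfl subset_rfl (by omega)

lemma firstHeads_unique {z : Fin M → Q} {a b : Fin M} {x : Q → Bool}
    (ha : firstHeads z a x = true) (hb : firstHeads z b x = true) : a = b := by
  simp only [firstHeads, Bool.and_eq_true, decide_eq_true_eq] at ha hb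
  rcases lt_trichotomy a b with h | h | h
  · rw [hb.2 a h] at ha; simp at ha
  · exact h
  · rw [ha.2 b h] at hb; simp at hb

/-- Every probability distribution is that of the first heads of a sequence of coins. -/
lemma exists_coins_firstHeads : ∀ (M : ℕ) (w : Fin (M + 1) → ℝ), (∀ a, 0 < w a) →
    ∃ π : Fin (M + 1) → ℝ, (∀ a, π a ∈ Set.Icc (0 : ℝ) 1) ∧
      ∀ (F : (Fin (M + 1) → Bool) → ℂ) (f : Fin (M + 1) → ℂ),
        (∀ a s, firstHeads id a s = true → F s = f a) →
        ((∑ a, w a : ℝ) : ℂ) * ∑ s, ((∏ a, coinProb (π a) (s a) : ℝ) : ℂ) * F s =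
          ∑ a, (w a : ℂ) * f a := by
  intro M
  induction M with
  | zero =>
    intro w hw
    -- The last coin always shows heads, so the outcome without heads has probability zero and the
    -- values of `F` there do not matter.
    refine ⟨fun _ => 1, fun _ => ⟨zero_le_one, le_rfl⟩, fun F f hF => ?_⟩
    have h := (Equiv.funUnique (Fin 1) Bool).symm.sum_comp
      fun s => ((∏ a : Fin 1, coinProb 1 (s a) : ℝ) : ℂ) * F s
    rw [← h, Fintype.sum_bool]
    have h1 : F ((Equiv.funUnique (Fin 1) Bool).symm true) = f 0 :=
      hF 0 _ (by simp [firstHeads, Equiv.funUnique])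
    rw [h1]
    simp [coinProb, Equiv.funUnique]
  | succ M ih =>
    intro w hw
    obtain ⟨π, hπ, h⟩ := ih (fun a => w a.succ) fun a => hw _
    have hpos : 0 < ∑ a : Fin (M + 1), w a.succ :=
      Finset.sum_pos (fun a _ => hw _) Finset.univ_nonempty
    have h0 := hw 0
    -- The first coin gets the relative weight of the first index; given tails, the other coins
    -- distribute the remaining weight by induction.
    refine ⟨Fin.cons (w 0 / ∑ a, w a) π, fun a => ?_, fun F f hF => ?_⟩
    · refine Fin.cases ?_ (fun a => ?_) a
      · rw [Fin.cons_zero, Fin.sum_univ_succ]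
        exact ⟨by positivity, by rw [div_le_one (by positivity)]; linarith⟩
      · rw [Fin.cons_succ]; exact hπ a
    · have e := (Fin.consEquiv fun _ : Fin (M + 2) => Bool).sum_comp
        fun s => ((∏ a, coinProb ((Fin.cons (w 0 / ∑ a, w a) π : Fin (M + 2) → ℝ) a)
          (s a) : ℝ) : ℂ) * F s
      rw [← e, Fintype.sum_prod_type, Fintype.sum_bool]
      have e1 : ∀ s : Fin (M + 1) → Bool,
          F ((Fin.consEquiv fun _ : Fin (M + 2) => Bool) (true, s)) = f 0 := fun s =>
        hF 0 _ (by simp [firstHeads, Fin.consEquiv])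
      have e2 := h (fun s => F ((Fin.consEquiv fun _ : Fin (M + 2) => Bool) (false, s)))
        (fun a => f a.succ) fun a s has => hF a.succ _ (by
          simp only [firstHeads, id, Bool.and_eq_true, decide_eq_true_eq] at has ⊢
          refine ⟨has.1, fun b hb => ?_⟩
          refine Fin.cases (fun _ => rfl) (fun b hb => ?_) b hb
          exact has.2 b (Fin.succ_lt_succ_iff.1 hb))
      have e3 : ∑ s : Fin (M + 1) → Bool, ((∏ a, coinProb (π a) (s a) : ℝ) : ℂ) = 1 := by
        rw [← Complex.ofReal_sum, sum_prod_coins fun a b => coinProb (π a) b]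
        simp [coinProb]
      have e4 : ∀ (b : Bool) (s : Fin (M + 1) → Bool),
          ∏ a, coinProb ((Fin.cons (w 0 / ∑ a, w a) π : Fin (M + 2) → ℝ) a)
            ((Fin.consEquiv fun _ : Fin (M + 2) => Bool) (b, s) a) =
          coinProb (w 0 / ∑ a, w a) b * ∏ a, coinProb (π a) (s a) := fun b s => by
        rw [Fin.prod_univ_succ]; rfl
      simp only [e4, e1, Complex.ofReal_mul, mul_assoc]
      rw [← Finset.mul_sum, ← Finset.mul_sum, ← Finset.sum_mul, e3]
      rw [Fin.sum_univ_succ (fun a => (w a : ℂ) * f a), ← e2, Fin.sum_univ_succ (fun a => w a),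
        show ∀ c, coinProb c true = c from fun _ => rfl,
        show ∀ c, coinProb c false = 1 - c from fun _ => rfl]
      generalize ∑ a : Fin (M + 1), w a.succ = W at hpos ⊢
      generalize ∑ s : Fin (M + 1) → Bool, ((∏ a, coinProb (π a) (s a) : ℝ) : ℂ) *
        F ((Fin.consEquiv fun _ : Fin (M + 2) => Bool) (false, s)) = X
      have hW : (w 0 : ℂ) + W ≠ 0 := by
        have : w 0 + W ≠ 0 := by positivity
        exact_mod_cast this
      push_cast
      field_simp
      ring

lemma sum_coins_single {G : ℕ} (τ : Fin G → ℝ) (l : Fin G) (F : Bool → ℂ) :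
    ∑ s : Fin G → Bool, ((∏ a, coinProb (τ a) (s a) : ℝ) : ℂ) * F (s l) =
      (1 - τ l) * F false + τ l * F true := by
  have h1 : ∀ s : Fin G → Bool, ((∏ a, coinProb (τ a) (s a) : ℝ) : ℂ) * F (s l) =
      ∏ a, (coinProb (τ a) (s a) : ℂ) * (if a = l then F (s a) else 1) := by
    intro s
    rw [Finset.prod_mul_distrib, Complex.ofReal_prod, Finset.prod_ite_eq' Finset.univ l,
      if_pos (Finset.mem_univ l)]
  simp_rw [h1]
  rw [sum_prod_coins fun a b => (coinProb (τ a) b : ℂ) * (if a = l then F b else 1),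
    Finset.prod_eq_single l]
  · simp [coinProb]; ring
  · intro a _ ha
    simp [coinProb, ha]
  · simp

end FirstHeads

/-! ## The wires of the block-encoding circuit -/

/-- The wires that the circuit uses besides its scratch space: the system, the register of the
state-preparation pair, in each direction the numbers of the left and right end nodes of an element
and of the output node, a flag for nodes outside of the element, coins for the position in the
element, and the signal qubit; coins for the terms of the polynomial, and the ancilla qubit. -/
inductive MainWire (d n p G M : ℕ) : Type
  | sys (i : Fin d) (r : Fin n)
  | lcu (q : LCUWires d p G)
  | left (i : Fin d) (r : Fin n)
  | right (i : Fin d) (r : Fin n)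
  | out (i : Fin d) (r : Fin n)
  | bad (i : Fin d)
  | place (i : Fin d) (r : Fin n)
  | gauss (i : Fin d) (l : Fin G)
  | signal (i : Fin d)
  | node (a : Fin M)
  | flag
  deriving DecidableEq

namespace MainWire

variable {d n p G M : ℕ}

/-- The wires as the elements of a sum type. -/
def ofSum : (((Fin d × Fin n) ⊕ (Fin d × Fin n)) ⊕ ((Fin d × Fin n) ⊕ (Fin d × Fin n))) ⊕
    ((LCUWires d p G ⊕ (Fin d × Fin G)) ⊕ ((Fin d ⊕ Fin d) ⊕ (Fin M ⊕ Unit))) ⊕ (Fin d × Fin n) →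
    MainWire d n p G M
  | .inl (.inl (.inl (i, r))) => sys i r
  | .inl (.inl (.inr (i, r))) => left i r
  | .inl (.inr (.inl (i, r))) => right i r
  | .inl (.inr (.inr (i, r))) => out i r
  | .inr (.inl (.inl (.inl q))) => lcu q
  | .inr (.inl (.inl (.inr (i, l)))) => gauss i l
  | .inr (.inl (.inr (.inl (.inl i)))) => bad i
  | .inr (.inl (.inr (.inl (.inr i)))) => signal i
  | .inr (.inl (.inr (.inr (.inl a)))) => node a
  | .inr (.inl (.inr (.inr (.inr _)))) => flag
  | .inr (.inr (i, r)) => place i r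

lemma ofSum_surjective :
    Function.Surjective (ofSum (d := d) (n := n) (p := p) (G := G) (M := M)) := by
  intro q
  cases q with
  | sys i r => exact ⟨.inl (.inl (.inl (i, r))), rfl⟩
  | left i r => exact ⟨.inl (.inl (.inr (i, r))), rfl⟩
  | right i r => exact ⟨.inl (.inr (.inl (i, r))), rfl⟩
  | out i r => exact ⟨.inl (.inr (.inr (i, r))), rfl⟩
  | lcu q => exact ⟨.inr (.inl (.inl (.inl q))), rfl⟩
  | gauss i l => exact ⟨.inr (.inl (.inl (.inr (i, l)))), rfl⟩
  | bad i => exact ⟨.inr (.inl (.inr (.inl (.inl i)))), rfl⟩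
  | signal i => exact ⟨.inr (.inl (.inr (.inl (.inr i)))), rfl⟩
  | node a => exact ⟨.inr (.inl (.inr (.inr (.inl a)))), rfl⟩
  | flag => exact ⟨.inr (.inl (.inr (.inr (.inr ())))), rfl⟩
  | place i r => exact ⟨.inr (.inr (i, r)), rfl⟩

instance : Fintype (MainWire d n p G M) := Fintype.ofSurjective _ ofSum_surjective

lemma card_le : Fintype.card (MainWire d n p G M) ≤
    d * (5 * n + (Nat.clog 2 G + Nat.clog 2 ((p + 1) ^ 2)) + G + 2) + M + 1 := by
  refine (Fintype.card_le_of_surjective _ ofSum_surjective).trans (le_of_eq ?_)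
  simp only [Fintype.card_sum, Fintype.card_prod, Fintype.card_fin, Fintype.card_unit]
  ring

/-- Whether a wire holds a coin or a signal qubit. -/
def isCoin : MainWire d n p G M → Bool
  | place _ _ => true
  | gauss _ _ => true
  | signal _ => true
  | node _ => true
  | _ => false

/-- The coins for the position in direction `i`. -/
def coins (i : Fin d) : Fin n ⊕ Fin G → MainWire d n p G M := Sum.elim (place i) (gauss i)

lemma coins_injective (i : Fin d) :
    Function.Injective (coins i : Fin n ⊕ Fin G → MainWire d n p G M) := by
  rintro (r | r) (s | s) h <;> simp [coins] at h ⊢ <;> exact h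

lemma node_injective : Function.Injective (node : Fin M → MainWire d n p G M) :=
  fun _ _ h => by injection h

end MainWire

/-! ## Phases that depend on the first heads -/

section MuxPhase

variable {R Q : Type} {M : ℕ}

/-- The phase with index `a` if the coin `a` is the first one that shows heads. -/
def muxPhase (z : Fin M → Q) (e : Fin M → Bool → ℂ) (x : Q → Bool) (b : Bool) : ℂ :=
  ∏ a, if firstHeads z a x then e a b else 1

lemma muxPhase_eq {z : Fin M → Q} (e : Fin M → Bool → ℂ) {x : Q → Bool} {a : Fin M}
    (h : firstHeads z a x = true) : muxPhase z e x = e a := by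
  funext b
  rw [muxPhase, Finset.prod_eq_single a]
  · rw [if_pos h]
  · intro a' _ ha'
    exact if_neg fun h' => ha' (firstHeads_unique h' h)
  · simp

lemma firstHeads_congr {z : Fin M → Q} {x y : Q → Bool} (h : ∀ a, x (z a) = y (z a)) (a : Fin M) :
    firstHeads z a x = firstHeads z a y := by
  simp only [firstHeads, h]

variable [Fintype R] [DecidableEq R] [Fintype Q] [DecidableEq Q]
  {PL PR : Matrix.unitaryGroup (R → Bool) ℂ}

lemma Impl.boolSign {φ : (Q → Bool) → Bool} {k : ℕ} (h : Comp Set.univ ∅ {φ} k) :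
    Impl PL PR (Matrix.diagonal fun x => QuFEM.boolSign (φ x)) (4 * k + 1) 0 := by
  obtain ⟨L, h1, h2, h3⟩ := h.program
  have := Impl.listPhase (PL := PL) (PR := PR) h1 [(φ, -1)] (by simpa using h3)
  have hval : QuFEM.listPhase [(φ, -1)] = fun x => QuFEM.boolSign (φ x) := by
    funext x
    simp [QuFEM.listPhase, QuFEM.boolSign]
  rw [hval] at this
  exact this.mono (Nat.add_le_add (Nat.mul_le_mul_left 4 h2) le_rfl) le_rfl

/-- The indicators of the first heads are computed once. At most one of them is true, so one phase
gate for each index and each value of the wire `c` suffices, and the cost is linear in `M`. -/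
lemma Impl.muxPhase (z : Fin M → Q) (c : Q) {e : Fin M → Bool → ℂ} (he : ∀ a b, ‖e a b‖ = 1) :
    Impl PL PR (Matrix.diagonal fun x => QuFEM.muxPhase z e x (x c)) (42 * M + 8) 0 := by
  have h1 : Comp Set.univ ∅ ((⋃ a, {QuFEM.firstHeads z a}) ∪ {fun x : Q → Bool => x c})
      (6 * M + 1 + 1) :=
    (Comp.firstHeads z fun _ => Set.mem_univ _).union (Comp.var (Set.mem_univ c))
  have h2 := Comp.iUnion (S := Set.univ)
    (H := ∅ ∪ ((⋃ a, {QuFEM.firstHeads z a}) ∪ {fun x : Q → Bool => x c}))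
    (T := fun a => {fun x => QuFEM.firstHeads z a x && x c} ∪
      {fun x => QuFEM.firstHeads z a x && !x c}) (k := 4) fun a => by
      have ha : QuFEM.firstHeads z a ∈ ∅ ∪ ((⋃ a, {QuFEM.firstHeads z a}) ∪
          {fun x : Q → Bool => x c}) := Or.inr (Or.inl (Set.mem_iUnion.2 ⟨a, rfl⟩))
      have hc : (fun x : Q → Bool => x c) ∈ ∅ ∪ ((⋃ a, {QuFEM.firstHeads z a}) ∪
          {fun x : Q → Bool => x c}) := Or.inr (Or.inr rfl)
      exact (Comp.and ha hc).union (Comp.and_not ha hc)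
  obtain ⟨L, h3, h4, h5⟩ := (h1.trans' h2).program
  rw [Fintype.card_fin] at h4
  let Z : List (((Q → Bool) → Bool) × ℂ) := (Finset.univ : Finset (Fin M × Bool)).toList.map
    fun ab => (fun x => QuFEM.firstHeads z ab.1 x && (x c == ab.2), e ab.1 ab.2)
  have hZ : ∀ ζ ∈ Z, ‖ζ.2‖ = 1 ∧ ζ.1 ∈ L := by
    intro ζ hζ
    obtain ⟨⟨a, b⟩, -, rfl⟩ := List.mem_map.1 hζ
    refine ⟨he a b, h5 _ (Set.mem_iUnion.2 ⟨a, ?_⟩)⟩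
    cases b
    · right
      simp
    · left
      simp
  have hlen : Z.length = 2 * M := by
    rw [List.length_map, Finset.length_toList, Finset.card_univ, Fintype.card_prod,
      Fintype.card_fin, Fintype.card_bool, mul_comm]
  have hval : ∀ x, QuFEM.listPhase Z x = QuFEM.muxPhase z e x (x c) := by
    intro x
    rw [QuFEM.listPhase, List.map_map, Finset.prod_map_toList, Fintype.prod_prod_type,
      QuFEM.muxPhase]
    refine Finset.prod_congr rfl fun a _ => ?_
    rw [Fintype.prod_bool]
    cases hx : x c <;> cases hh : QuFEM.firstHeads z a x <;> simp [hx, hh]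
  have h6 := Impl.listPhase (PL := PL) (PR := PR) h3 Z hZ
  rw [show QuFEM.listPhase Z = fun x => QuFEM.muxPhase z e x (x c) from funext hval] at h6
  exact h6.mono (by omega) le_rfl

lemma Impl.list_prod {ι : Type} {A : ι → Matrix (Q → Bool) (Q → Bool) ℂ} {k : ℕ}
    (h : ∀ i, Impl PL PR (A i) k 0) (l : List ι) :
    Impl PL PR (l.map A).prod (l.length * k) 0 := by
  induction l with
  | nil => simpa using Impl.one
  | cons a l ih =>
    rw [List.map_cons, List.prod_cons, List.length_cons]
    exact ((h a).mul ih).mono (by ring_nf; omega) le_rfl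

end MuxPhase

/-! ## The sampling of a coordinate -/

section Position

open MainWire

variable {d n p G M : ℕ}

/-- The coin of the Gauss point in direction `i`. -/
def gaussCoin (i : Fin d) (x : MainWire d n p G M → Bool) : Bool :=
  decide (∃ l ∈ (Finset.univ : Finset (Fin G)),
    (decide ((fun r => x (lcu (i, .inl r))) = fun r : Fin (Nat.clog 2 G) => (l : ℕ).testBit r) &&
      x (gauss i l)) = true)

/-- A binary digit, selected by the first heads of the coins, of the number of the left or right end
node, selected by the coin of the Gauss point. -/
def placeBit (i : Fin d) (x : MainWire d n p G M → Bool) : Bool :=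
  decide (∃ r ∈ (Finset.univ : Finset (Fin n)), (firstHeads (place i) r x &&
    Bool.xor (x (left i r)) (gaussCoin i x && Bool.xor (x (left i r)) (x (right i r)))) = true)

lemma two_pow_clog_le {a : ℕ} (ha : 0 < a) : 2 ^ Nat.clog 2 a ≤ 2 * a := by
  rcases Nat.lt_or_ge 1 a with h | h
  · have h1 : Nat.clog 2 a ≠ 0 := (Nat.clog_pos one_lt_two h).ne'
    have h2 := Nat.pow_pred_clog_lt_self one_lt_two h
    obtain ⟨k, hk⟩ := Nat.exists_eq_succ_of_ne_zero h1
    rw [hk] at h2 ⊢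
    rw [Nat.pred_succ] at h2
    rw [pow_succ]; omega
  · rw [Nat.clog_of_right_le_one h]; omega

lemma Comp.gaussCoin {H : Set ((MainWire d n p G M → Bool) → Bool)} (i : Fin d) (hG : 0 < G) :
    Comp Set.univ H {QuFEM.gaussCoin i} (17 * G + 3) := by
  have h1 : Comp Set.univ H (Ind Finset.univ fun (x : MainWire d n p G M → Bool)
      (r : Fin (Nat.clog 2 G)) => x (lcu (i, .inl r))) (6 * 2 ^ Nat.clog 2 G) :=
    Comp.decode (fun r => lcu (i, .inl r)) fun _ => Set.mem_univ _
  set H1 := H ∪ (Ind Finset.univ fun (x : MainWire d n p G M → Bool)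
      (r : Fin (Nat.clog 2 G)) => x (lcu (i, .inl r)))
  let f : Fin G → (MainWire d n p G M → Bool) → Bool := fun l x =>
    decide ((fun r => x (lcu (i, .inl r))) = fun r : Fin (Nat.clog 2 G) => (l : ℕ).testBit r) &&
      x (gauss i l)
  have h2 : Comp Set.univ H1 (⋃ l, {f l}) (Fintype.card (Fin G) * 2) := Comp.iUnion fun l => by
    refine (Comp.var (Set.mem_univ (gauss i l))).trans' (k' := 1) (Comp.and
      (f := fun x => decide ((fun r => x (lcu (i, .inl r))) =
        fun r : Fin (Nat.clog 2 G) => (l : ℕ).testBit r)) (g := fun x => x (gauss i l))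
      (Or.inl (Or.inr ⟨_, Finset.mem_coe.2 (Finset.mem_univ _), rfl⟩)) (Or.inr rfl))
  have h3 : Comp Set.univ (H1 ∪ ⋃ l, {f l}) {QuFEM.gaussCoin i} (3 * G + 3) := by
    have := Comp.any (S := Set.univ) (H := H1 ∪ ⋃ l, {f l}) (s := Finset.univ) (f := f)
      fun l _ => Or.inr (Set.mem_iUnion.2 ⟨l, rfl⟩)
    rw [Finset.card_univ, Fintype.card_fin] at this
    exact this.of_eq fun x => decide_eq_decide.2 Iff.rfl
  rw [Fintype.card_fin] at h2
  refine (h1.trans' (h2.trans' h3)).mono subset_rfl subset_rfl ?_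
  have := two_pow_clog_le hG
  omega

lemma Comp.placeBit (i : Fin d) (hG : 0 < G) :
    Comp Set.univ ∅ {(QuFEM.placeBit i : (MainWire d n p G M → Bool) → Bool)}
      (17 * G + 15 * n + 7) := by
  have h1 : Comp Set.univ ∅ ({(QuFEM.gaussCoin i : (MainWire d n p G M → Bool) → Bool)} ∪
      ⋃ r, {QuFEM.firstHeads (place i) r}) (17 * G + 3 + (6 * n + 1)) :=
    (Comp.gaussCoin i hG).union (Comp.firstHeads _ fun _ => Set.mem_univ _)
  set H1 : Set ((MainWire d n p G M → Bool) → Bool) := ∅ ∪ ({QuFEM.gaussCoin i} ∪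
      ⋃ r, {QuFEM.firstHeads (place i) r})
  let f : Fin n → (MainWire d n p G M → Bool) → Bool := fun r x =>
    QuFEM.firstHeads (place i) r x &&
    Bool.xor (x (left i r)) (QuFEM.gaussCoin i x && Bool.xor (x (left i r)) (x (right i r)))
  have h2 : Comp Set.univ H1 (⋃ r, {f r}) (Fintype.card (Fin n) * 6) := Comp.iUnion fun r => by
    have a1 : Comp Set.univ H1 ({fun x => x (left i r)} ∪ {fun x => x (right i r)}) (1 + 1) :=
      (Comp.var (Set.mem_univ _)).union (Comp.var (Set.mem_univ _))
    have a2 := a1.trans (Comp.xor (f := fun x => x (left i r)) (g := fun x => x (right i r))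
      (Or.inr (Or.inl rfl)) (Or.inr (Or.inr rfl)))
    have a3 := a2.trans (Comp.and (f := QuFEM.gaussCoin i)
      (g := fun x => Bool.xor (x (left i r)) (x (right i r)))
      (Or.inl (Or.inr (Or.inl rfl))) (Or.inr (Or.inr rfl)))
    have a4 := a3.trans (Comp.xor (f := fun x => x (left i r))
      (g := fun x => QuFEM.gaussCoin i x && Bool.xor (x (left i r)) (x (right i r)))
      (Or.inr (Or.inl (Or.inl (Or.inl rfl)))) (Or.inr (Or.inr rfl)))
    exact a4.trans' (Comp.and (f := QuFEM.firstHeads (place i) r)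
      (g := fun x => Bool.xor (x (left i r))
        (QuFEM.gaussCoin i x && Bool.xor (x (left i r)) (x (right i r))))
      (Or.inl (Or.inr (Or.inr (Set.mem_iUnion.2 ⟨r, rfl⟩)))) (Or.inr (Or.inr rfl)))
  have h3 : Comp Set.univ (H1 ∪ ⋃ r, {f r}) {QuFEM.placeBit i} (3 * n + 3) := by
    have := Comp.any (S := Set.univ) (H := H1 ∪ ⋃ r, {f r}) (s := Finset.univ) (f := f)
      fun l _ => Or.inr (Set.mem_iUnion.2 ⟨l, rfl⟩)
    rw [Finset.card_univ, Fintype.card_fin] at this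
    exact this.of_eq fun x => decide_eq_decide.2 Iff.rfl
  rw [Fintype.card_fin] at h2
  exact (h1.trans' (h2.trans' h3)).mono subset_rfl subset_rfl (by omega)

lemma Comp.anyOn {Q A : Type} [Fintype A] (r : A → Q) :
    Comp Set.univ ∅ {QuFEM.anyOn r} (4 * Fintype.card A + 3) := by
  have h1 : Comp Set.univ ∅ (⋃ a, {fun x : Q → Bool => x (r a)}) (Fintype.card A * 1) :=
    Comp.iUnion fun a => Comp.var (Set.mem_univ _)
  have h2 := Comp.any (S := Set.univ) (H := ∅ ∪ ⋃ a, {fun x : Q → Bool => x (r a)})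
    (s := Finset.univ) (f := fun a x => x (r a)) fun a _ => Or.inr (Set.mem_iUnion.2 ⟨a, rfl⟩)
  refine ((h1.trans' h2).of_eq fun x => ?_).mono subset_rfl subset_rfl
    (by rw [Finset.card_univ]; omega)
  simp [QuFEM.anyOn]

lemma Comp.and_not_var {Q : Type} {φ : (Q → Bool) → Bool} {k : ℕ} (h : Comp Set.univ ∅ {φ} k)
    (c : Q) : Comp Set.univ ∅ {fun x => φ x && !x c} (k + 4) :=
  (h.union (Comp.var (Set.mem_univ c))).trans' (Comp.and_not (f := φ) (g := fun x => x c)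
    (Or.inr (Or.inl rfl)) (Or.inr (Or.inr rfl)))

lemma gaussCoin_eq {i : Fin d} {x : MainWire d n p G M → Bool} {l : Fin G}
    (hl : ∀ r, x (lcu (i, .inl r)) = (l : ℕ).testBit r) : gaussCoin i x = x (gauss i l) := by
  rw [gaussCoin, Bool.eq_iff_iff]
  simp only [decide_eq_true_eq, Bool.and_eq_true, Finset.mem_univ, true_and]
  constructor
  · rintro ⟨l', h1, h2⟩
    have : l' = l := by
      have hlt : ∀ a : Fin G, (a : ℕ) < 2 ^ Nat.clog 2 G := fun a =>
        a.2.trans_le (Nat.le_pow_clog one_lt_two G)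
      refine Fin.ext ?_
      rw [← wireNum_eq (w := fun r => lcu (i, .inl r)) (hlt l) hl]
      exact (wireNum_eq (w := fun r => lcu (i, .inl r)) (hlt l') fun r => congrFun h1 r).symm
    rwa [← this]
  · exact fun h => ⟨l, funext hl, h⟩

lemma placeBit_eq {i : Fin d} {x : MainWire d n p G M → Bool} {r : Fin n}
    (h : firstHeads (place i) r x = true) :
    placeBit i x = if gaussCoin i x then x (right i r) else x (left i r) := by
  have h1 : placeBit i x =
      Bool.xor (x (left i r)) (gaussCoin i x && Bool.xor (x (left i r)) (x (right i r))) := by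
    rw [placeBit, Bool.eq_iff_iff]
    simp only [decide_eq_true_eq, Bool.and_eq_true, Finset.mem_univ, true_and]
    constructor
    · rintro ⟨r', h2, h3⟩
      rwa [← firstHeads_unique h2 h]
    · exact fun h2 => ⟨r, h, h2⟩
  rw [h1]
  cases gaussCoin i x <;> simp

/-- The amplitude of the walk operator in direction `i`. -/
lemma signConj_placeBit {πu : Fin n → ℝ} {τ : Fin G → ℝ} (hπ : ∀ r, πu r ∈ Set.Icc (0 : ℝ) 1)
    (hτ : ∀ l, τ l ∈ Set.Icc (0 : ℝ) 1)
    (hu : ∀ (F : (Fin n → Bool) → ℂ) (f : Fin n → ℂ),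
      (∀ a s, firstHeads id a s = true → F s = f a) →
        ((∑ a : Fin n, (2 : ℝ) ^ (a : ℕ) : ℝ) : ℂ) *
          ∑ s, ((∏ a, coinProb (πu a) (s a) : ℝ) : ℂ) * F s =
          ∑ a : Fin n, (((2 : ℝ) ^ (a : ℕ) : ℝ) : ℂ) * f a)
    {i : Fin d} {κ : MainWire d n p G M → Bool} (hκ : ∀ a, κ (coins i a) = false)
    {l : Fin G} (hl : ∀ r, κ (lcu (i, .inl r)) = (l : ℕ).testBit r) {A B : ℕ} (hA : A < 2 ^ n)
    (hB : B < 2 ^ n) (hAκ : ∀ r, κ (left i r) = A.testBit r)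
    (hBκ : ∀ r, κ (right i r) = B.testBit r) (hn : 0 < n) :
    signConj (coins i) (fun a => coinMat (Sum.elim πu τ a)) (placeBit i) κ κ =
      ((1 - 2 * (((1 - τ l) * A + τ l * B) / (2 ^ n - 1)) : ℝ) : ℂ) := by
  have hκr : κ ∘ coins i = fun _ => false := funext hκ
  rw [signConj, coins_sandwich (coins_injective i) (by
    rintro (r | r)
    · exact hπ r
    · exact hτ r) (by
    intro x y h
    by_cases hxy : x = y
    · rw [hxy]
    · exact absurd (Matrix.diagonal_apply_ne _ hxy) h) hκr hκr]
  simp only [Matrix.diagonal_apply_eq]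
  rw [← (Equiv.sumArrowEquivProdArrow (Fin n) (Fin G) Bool).symm.sum_comp, Fintype.sum_prod_type]
  have e1 : ∀ su : Fin n → Bool, ∀ sv : Fin G → Bool,
      ∏ a, coinProb (Sum.elim πu τ a)
        ((Equiv.sumArrowEquivProdArrow (Fin n) (Fin G) Bool).symm (su, sv) a) =
      (∏ a, coinProb (πu a) (su a)) * ∏ a, coinProb (τ a) (sv a) := fun su sv => by
    rw [Fintype.prod_sum_type]; rfl
  simp only [e1, Complex.ofReal_mul, mul_assoc, ← Finset.mul_sum]
  have hwire : ∀ (s : Fin n ⊕ Fin G → Bool) (q : MainWire d n p G M), q.isCoin = false →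
      overwrite (coins i) s κ q = κ q := fun s q hq =>
    overwrite_off _ _ (by rintro ⟨a, rfl⟩; cases a <;> simp [coins, isCoin] at hq)
  -- The coins of the Gauss point are averaged first: only the coin selected by the register
  -- matters, and it chooses between the digits of `B` and `A` with the probabilities `τ l` and `1 -
  -- τ l`. The position coins then weight the digits with powers of two.
  have key := hu (fun su => ∑ sv : Fin G → Bool, ((∏ a, coinProb (τ a) (sv a) : ℝ) : ℂ) *
    boolSign (placeBit i (overwrite (coins i)
      ((Equiv.sumArrowEquivProdArrow (Fin n) (Fin G) Bool).symm (su, sv)) κ)))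
    (fun r => (1 - τ l) * boolSign (A.testBit r) + τ l * boolSign (B.testBit r)) (by
      intro r su hr
      have hc := sum_coins_single τ l fun b => boolSign (if b then B.testBit r else A.testBit r)
      simp only [Bool.false_eq_true, if_false, if_true] at hc
      rw [← hc]
      · refine Finset.sum_congr rfl fun sv _ => ?_
        congr 2
        set s := (Equiv.sumArrowEquivProdArrow (Fin n) (Fin G) Bool).symm (su, sv) with hs
        rw [placeBit_eq (r := r), gaussCoin_eq (l := l), hwire s (right i r) rfl,
          hwire s (left i r) rfl, hAκ, hBκ]
        · have : overwrite (coins i) s κ (gauss i l) = sv l :=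
            overwrite_apply (coins_injective i) s κ (.inr l)
          rw [this]
        · intro r'
          rw [hwire _ _ rfl, hl]
        · rw [← hr]
          have hp : ∀ a, overwrite (coins i) s κ (place i a) = su a := fun a =>
            overwrite_apply (coins_injective i) s κ (.inl a)
          simp only [firstHeads, hp, id])
  have hsum : (∑ a : Fin n, (2 : ℝ) ^ (a : ℕ)) = 2 ^ n - 1 := by
    rw [Fin.sum_univ_eq_sum_range fun a => (2 : ℝ) ^ a, geom_sum_eq (by norm_num)]
    norm_num
  have hpos : (2 : ℝ) ^ n - 1 ≠ 0 := by
    have : (1 : ℝ) < 2 ^ n := one_lt_pow₀ (by norm_num) hn.ne'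
    linarith
  -- The sign of a bit is one minus twice the bit, so the weighted sum recovers the number from its
  -- digits.
  have hbits : ∀ C : ℕ, C < 2 ^ n → ∑ a : Fin n, (((2 : ℝ) ^ (a : ℕ) : ℝ) : ℂ) *
      boolSign (C.testBit a) = ((2 ^ n - 1 - 2 * C : ℝ) : ℂ) := by
    intro C hC
    have h1 : ∀ a : Fin n, (((2 : ℝ) ^ (a : ℕ) : ℝ) : ℂ) * boolSign (C.testBit a) =
        (((2 : ℝ) ^ (a : ℕ) - 2 * (((C.testBit a).toNat * 2 ^ (a : ℕ) : ℕ) : ℝ) : ℝ) : ℂ) := by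
      intro a
      cases C.testBit a
      · simp [boolSign]
      · simp [boolSign]; ring
    simp only [h1]
    rw [← Complex.ofReal_sum, Finset.sum_sub_distrib, hsum, ← Finset.mul_sum, ← Nat.cast_sum,
      sum_testBit n C hC]
  have hR : ∑ a : Fin n, (((2 : ℝ) ^ (a : ℕ) : ℝ) : ℂ) *
      ((1 - τ l) * boolSign (A.testBit a) + τ l * boolSign (B.testBit a)) =
      (((1 - τ l) * (2 ^ n - 1 - 2 * A) + τ l * (2 ^ n - 1 - 2 * B) : ℝ) : ℂ) := by
    have : ∀ a : Fin n, (((2 : ℝ) ^ (a : ℕ) : ℝ) : ℂ) *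
      ((1 - τ l) * boolSign (A.testBit a) + τ l * boolSign (B.testBit a)) =
      (1 - τ l) * ((((2 : ℝ) ^ (a : ℕ) : ℝ) : ℂ) * boolSign (A.testBit a)) +
      τ l * ((((2 : ℝ) ^ (a : ℕ) : ℝ) : ℂ) * boolSign (B.testBit a)) := fun a => by ring
    simp only [this]
    rw [Finset.sum_add_distrib, ← Finset.mul_sum, ← Finset.mul_sum, hbits A hA, hbits B hB]
    push_cast
    ring
  rw [hR, hsum] at key
  have hpos' : ((2 ^ n - 1 : ℝ) : ℂ) ≠ 0 := by exact_mod_cast hpos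
  refine mul_left_cancel₀ hpos' (key.trans ?_)
  rw [← Complex.ofReal_mul]
  congr 1
  field_simp
  ring

end Position

/-! ## The diagonal operator of a polynomial -/

section Inner

open MainWire Polynomial

variable {R : Type} [Fintype R] [DecidableEq R] {PL PR : Matrix.unitaryGroup (R → Bool) ℂ}
  {d n p G M : ℕ}

/-- There is a circuit whose diagonal entries are averages of products of polynomials, each of them
evaluated at a convex combination of two numbers in the registers. -/
theorem exists_polynomial_circuit (PL PR : Matrix.unitaryGroup (R → Bool) ℂ) (hn : 0 < n)
    (hG : 0 < G) (hM : 0 < M) {N : ℕ} {P : Fin M → Fin d → ℝ[X]}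
    (hdeg : ∀ a i, (P a i).natDegree ≤ N)
    (hb : ∀ a i, ∀ t ∈ Set.Icc (0 : ℝ) 1, |(P a i).eval t| ≤ 1) {τ : Fin G → ℝ}
    (hτ : ∀ l, τ l ∈ Set.Icc (0 : ℝ) 1) :
    ∃ I : Matrix (MainWire d n p G M → Bool) (MainWire d n p G M → Bool) ℂ,
      ActsIn {q | q.isCoin = true} I ∧
      Impl PL PR I
        (2 * M + d * (3 * N * (138 * G + 122 * n + 90) + (2 * N + 1) * (84 * M + 18))) 0 ∧
      ∀ (κ : MainWire d n p G M → Bool) (ℓ : Fin d → Fin G) (A B : Fin d → ℕ),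
        (∀ q, q.isCoin = true → κ q = false) →
        (∀ i r, κ (lcu (i, .inl r)) = (ℓ i : ℕ).testBit r) →
        (∀ i, A i < 2 ^ n) → (∀ i, B i < 2 ^ n) →
        (∀ i r, κ (left i r) = (A i).testBit r) → (∀ i r, κ (right i r) = (B i).testBit r) →
        (M : ℂ) * I κ κ = ((∑ a, ∏ i, (P a i).eval
          (((1 - τ (ℓ i)) * A i + τ (ℓ i) * B i) / (2 ^ n - 1)) : ℝ) : ℂ) := by
  obtain ⟨n', rfl⟩ : ∃ n', n = n' + 1 := ⟨n - 1, by omega⟩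
  obtain ⟨M', rfl⟩ : ∃ M', M = M' + 1 := ⟨M - 1, by omega⟩
  obtain ⟨πu, hπu, hu⟩ := exists_coins_firstHeads n' (fun r => (2 : ℝ) ^ (r : ℕ))
    fun r => by positivity
  -- Equal weights: the first heads among the `node` coins select the product of polynomials
  -- uniformly, whence the factor `M` in the conclusion.
  obtain ⟨πz, hπz, hz⟩ := exists_coins_firstHeads M' (fun _ => (1 : ℝ)) fun _ => one_pos
  choose e f he hf hef using fun i a => exists_rotPoly_circlePoly (hdeg a i) (hb a i)
  let u : Fin (n' + 1) ⊕ Fin G → Matrix Bool Bool ℂ := fun a => coinMat (Sum.elim πu τ a)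
  have hu' : ∀ a, u a ∈ Matrix.unitaryGroup Bool ℂ := by
    rintro (r | r)
    · exact coinMat_mem_unitary (hπu r)
    · exact coinMat_mem_unitary (hτ r)
  let z : Fin (M' + 1) → MainWire d (n' + 1) p G (M' + 1) := node
  let E : Fin d → ℕ → (MainWire d (n' + 1) p G (M' + 1) → Bool) → Bool → ℂ := fun i t =>
    muxPhase z fun a => e i a t
  let F : Fin d → ℕ → (MainWire d (n' + 1) p G (M' + 1) → Bool) → Bool → ℂ := fun i t =>
    muxPhase z fun a => f i a t
  let T : Fin d → Matrix (MainWire d (n' + 1) p G (M' + 1) → Bool)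
    (MainWire d (n' + 1) p G (M' + 1) → Bool) ℂ := fun i =>
    qspMat (coins i) u (placeBit i) (signal i) (E i) (F i) N
  let v : Matrix (Fin (M' + 1) → Bool) (Fin (M' + 1) → Bool) ℂ :=
    tensorMat fun a => coinMat (πz a)
  have hv : ∀ a, coinMat (πz a) ∈ Matrix.unitaryGroup Bool ℂ := fun a =>
    coinMat_mem_unitary (hπz a)
  have hact : ∀ i, ActsIn (insert (signal i) (Set.range (coins i))) (T i) := fun i =>
    actsIn_qspMat N
  have hsub : ∀ i, insert (signal i) (Set.range (coins i)) ⊆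
      {q : MainWire d (n' + 1) p G (M' + 1) | q.isCoin = true} := by
    rintro i q (rfl | ⟨(r | r), rfl⟩) <;> rfl
  have hnode : ∀ i a, (node a : MainWire d (n' + 1) p G (M' + 1)) ∉
      insert (signal i) (Set.range (coins i)) := by
    rintro i a (h | ⟨(r | r), h⟩) <;> simp [coins] at h
  have hdisj : ∀ i j, i ≠ j → Disjoint
      (insert (signal i) (Set.range (coins i)) : Set (MainWire d (n' + 1) p G (M' + 1)))
      (insert (signal j) (Set.range (coins j))) := by
    intro i j hij
    rw [Set.disjoint_left]
    rintro q (rfl | ⟨(r | r), rfl⟩) (h | ⟨(s | s), h⟩) <;> simp [coins] at h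
    · exact hij h
    · exact hij h.1.symm
    · exact hij h.1.symm
  have hactT := actsIn_list_prod hact (List.finRange d)
  refine ⟨actOn z v.conjTranspose * ((List.finRange d).map T).prod * actOn z v, ?_, ?_, ?_⟩
  · have h1 : Set.range z ⊆ {q : MainWire d (n' + 1) p G (M' + 1) | q.isCoin = true} := by
      rintro _ ⟨a, rfl⟩; rfl
    exact (((actsIn_actOn z _).mono h1).mul (hactT.mono (Set.iUnion₂_subset fun i _ =>
      hsub i))).mul ((actsIn_actOn z _).mono h1)
  · have hT : ∀ i, Impl PL PR (T i) (3 * N * (2 * (4 * (17 * G + 15 * (n' + 1) + 11) + 1) +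
        2 * Fintype.card (Fin (n' + 1) ⊕ Fin G)) +
        (2 * N + 1) * (2 * (42 * (M' + 1) + 8) + 2)) 0 := fun i => by
      refine Impl.qspMat (coins_injective i) hu' ?_ ?_ ?_ ?_ (fun t => ?_) (fun t => ?_) N
      · exact (Impl.boolSign (Comp.placeBit i hG)).mono (by omega) le_rfl
      · exact (Impl.boolSign (Comp.and_not_var (Comp.placeBit i hG) _)).mono (by omega) le_rfl
      · refine (Impl.boolSign (Comp.anyOn _)).mono ?_ le_rfl
        rw [Fintype.card_sum, Fintype.card_fin, Fintype.card_fin]; omega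
      · refine (Impl.boolSign (Comp.and_not_var (Comp.anyOn _) _)).mono ?_ le_rfl
        rw [Fintype.card_sum, Fintype.card_fin, Fintype.card_fin]; omega
      · exact Impl.muxPhase z (signal i) fun a b => he i a t b
      · exact Impl.muxPhase z (signal i) fun a b => hf i a t b
    have h1 : Impl PL PR (actOn z v.conjTranspose) (M' + 1) 0 := by
      have := Impl.tensorMat (PL := PL) (PR := PR) (node_injective (d := d) (n := n' + 1) (p := p)
        (G := G) (M := M' + 1)) (u := fun a => (coinMat (πz a)).conjTranspose) fun a =>
        (star (⟨_, hv a⟩ : Matrix.unitaryGroup Bool ℂ)).2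
      rw [Fintype.card_fin] at this
      rwa [tensorMat_conjTranspose]
    have h2 : Impl PL PR (actOn z v) (M' + 1) 0 := by
      have := Impl.tensorMat (PL := PL) (PR := PR) (node_injective (d := d) (n := n' + 1) (p := p)
        (G := G) (M := M' + 1)) hv
      rwa [Fintype.card_fin] at this
    refine ((h1.mul (Impl.list_prod hT (List.finRange d))).mul h2).mono ?_ le_rfl
    rw [List.length_finRange, Fintype.card_sum, Fintype.card_fin, Fintype.card_fin,
      show 2 * (4 * (17 * G + 15 * (n' + 1) + 11) + 1) + 2 * (n' + 1 + G) =
        138 * G + 122 * (n' + 1) + 90 by ring,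
      show 2 * (42 * (M' + 1) + 8) + 2 = 84 * (M' + 1) + 18 by ring]
    omega
  · intro κ ℓ A B hκ hℓ hA hB hAκ hBκ
    have hpres : ∀ x y, ((List.finRange d).map T).prod x y ≠ 0 → x ∘ z = y ∘ z := by
      intro x y h
      funext a
      refine hactT x y h (z a) fun hmem => ?_
      obtain ⟨i, hi⟩ := Set.mem_iUnion.1 hmem
      obtain ⟨_, hi⟩ := Set.mem_iUnion.1 hi
      exact hnode i a hi
    have hκz : κ ∘ z = fun _ => false := funext fun a => hκ _ rfl
    rw [coins_sandwich node_injective hπz hpres hκz hκz]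
    -- Given the index `a`, the phases in every direction are those of `P a i`, and the operators of
    -- the directions act on disjoint wires, so the diagonal entry is the product of the values.
    have hsum := hz (fun s => ((List.finRange d).map T).prod (overwrite z s κ) (overwrite z s κ))
      (fun a => ((∏ i, (P a i).eval
        (((1 - τ (ℓ i)) * A i + τ (ℓ i) * B i) / (2 ^ (n' + 1) - 1)) : ℝ) : ℂ)) (by
      intro a s has
      have hoff : ∀ q : MainWire d (n' + 1) p G (M' + 1), (∀ a, q ≠ node a) →
          overwrite z s κ q = κ q := fun q hq =>
        overwrite_off _ _ (by rintro ⟨a, rfl⟩; exact hq a rfl)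
      have hhead : firstHeads z a (overwrite z s κ) = true := by
        rw [← has]
        have h : ∀ a, overwrite z s κ (z a) = s a := fun a => overwrite_apply node_injective s κ a
        simp only [firstHeads, h, id]
      rw [list_prod_apply_self hact hdisj _ (List.nodup_finRange d), ← List.ofFn_eq_map,
        List.prod_ofFn, Complex.ofReal_prod]
      refine Finset.prod_congr rfl fun i _ => ?_
      have hmux : ∀ e : Fin (M' + 1) → Bool → ℂ,
          Indep (insert (signal i) (Set.range (coins i))) (muxPhase z e) := by
        intro e x y hxy
        funext b
        rw [muxPhase, muxPhase]
        refine Finset.prod_congr rfl fun a _ => ?_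
        rw [firstHeads_congr fun a => hxy _ (hnode i a)]
      refine qspMat_apply_self (coins_injective i) hu' ?_ ?_ (fun t => hmux _) (fun t => hmux _)
        (hdeg a i) ?_ ?_ ?_ ?_
      · rintro ⟨(r | r), h⟩ <;> simp [coins] at h
      · intro x y hxy
        have hw : ∀ q : MainWire d (n' + 1) p G (M' + 1), q ≠ signal i → x q = y q := fun q hq =>
          hxy q hq
        simp only [placeBit, gaussCoin, firstHeads]
        simp [hw]
      · intro r
        rw [hoff _ (by cases r <;> simp [coins])]
        exact hκ _ (by cases r <;> rfl)
      · rw [hoff _ (by simp)]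
        exact hκ _ rfl
      · refine signConj_placeBit hπu hτ hu (fun r => ?_) (l := ℓ i) (fun r => ?_) (hA i) (hB i)
          (fun r => ?_) (fun r => ?_) hn
        · rw [hoff _ (by cases r <;> simp [coins])]
          exact hκ _ (by cases r <;> rfl)
        · rw [hoff _ (by simp), hℓ]
        · rw [hoff _ (by simp), hAκ]
        · rw [hoff _ (by simp), hBκ]
      · rw [← hef i a]
        congr 1
        · funext t; exact muxPhase_eq _ hhead
        · funext t; exact muxPhase_eq _ hhead)
    have hcard : ((∑ _a : Fin (M' + 1), (1 : ℝ) : ℝ) : ℂ) = ((M' + 1 : ℕ) : ℂ) := by simp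
    rw [hcard] at hsum
    refine hsum.trans ?_
    rw [Complex.ofReal_sum]
    simp

end Inner

/-! ## The arithmetic of node numbers -/

section Masks

open MainWire

variable {d n p G M : ℕ}

/-- The bits of the register for the pair of local nodes in direction `i`. -/
def pairBits (i : Fin d) (x : MainWire d n p G M → Bool) : Fin (Nat.clog 2 ((p + 1) ^ 2)) → Bool :=
  fun r => x (lcu (i, .inr r))

/-- The local node of the row. -/
def rowDigit (p : ℕ) (b : Fin (Nat.clog 2 ((p + 1) ^ 2)) → Bool) : ℤ :=
  ((Nat.ofBits b / (p + 1) % (p + 1) : ℕ) : ℤ)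

/-- The local node of the column. -/
def colDigit (p : ℕ) (b : Fin (Nat.clog 2 ((p + 1) ^ 2)) → Bool) : ℤ :=
  ((Nat.ofBits b % (p + 1) : ℕ) : ℤ)

lemma rowDigit_mem (b : Fin (Nat.clog 2 ((p + 1) ^ 2)) → Bool) :
    0 ≤ rowDigit p b ∧ rowDigit p b ≤ p := by
  have := Nat.mod_lt (Nat.ofBits b / (p + 1)) (Nat.succ_pos p)
  rw [rowDigit]
  constructor
  · positivity
  · exact_mod_cast Nat.lt_succ_iff.1 this

lemma colDigit_mem (b : Fin (Nat.clog 2 ((p + 1) ^ 2)) → Bool) :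
    0 ≤ colDigit p b ∧ colDigit p b ≤ p := by
  have := Nat.mod_lt (Nat.ofBits b) (Nat.succ_pos p)
  rw [colDigit]
  constructor
  · positivity
  · exact_mod_cast Nat.lt_succ_iff.1 this

/-- The shift of the left end node. -/
def leftShift (p : ℕ) (b : Fin (Nat.clog 2 ((p + 1) ^ 2)) → Bool) : ℤ := -colDigit p b

/-- The shift of the right end node. -/
def rightShift (p : ℕ) (b : Fin (Nat.clog 2 ((p + 1) ^ 2)) → Bool) : ℤ := p - colDigit p b

/-- The shift of the output node. -/
def outShift (p : ℕ) (b : Fin (Nat.clog 2 ((p + 1) ^ 2)) → Bool) : ℤ := rowDigit p b - colDigit p b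

/-- The shift back from the output node. -/
def backShift (p : ℕ) (b : Fin (Nat.clog 2 ((p + 1) ^ 2)) → Bool) : ℤ := colDigit p b - rowDigit p b

/-- Whether a shifted number has `n` digits. -/
def InRange (n : ℕ) (a : ℤ) : Prop := 0 ≤ a ∧ a < 2 ^ n

instance (n : ℕ) (a : ℤ) : Decidable (InRange n a) := inferInstanceAs (Decidable (_ ∧ _))

/-- The node in the system register, shifted. -/
def sysShift (i : Fin d) (φ : (Fin (Nat.clog 2 ((p + 1) ^ 2)) → Bool) → ℤ)
    (x : MainWire d n p G M → Bool) : ℤ := wireNum (sys i) x + φ (pairBits i x)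

/-- Whether the node in the system register is the column node of an element. -/
def validNode (i : Fin d) (x : MainWire d n p G M → Bool) : Bool :=
  (decide (InRange n (sysShift i (leftShift p) x)) &&
    decide (InRange n (sysShift i (rightShift p) x))) &&
      decide ((p : ℤ) ∣ sysShift i (leftShift p) x)

/-- The exclusive or with a mask. -/
def applyMask {Q : Type} (F : (Q → Bool) → Q → Bool) (x : Q → Bool) : Q → Bool :=
  fun q => Bool.xor (x q) (F x q)

/-- The mask with the end nodes, the output node and the validity. -/
def linkMask (x : MainWire d n p G M → Bool) : MainWire d n p G M → Bool
  | left i r => intBit (sysShift i (leftShift p) x) r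
  | right i r => intBit (sysShift i (rightShift p) x) r
  | out i r => intBit (sysShift i (outShift p) x) r
  | bad i => !validNode i x
  | _ => false

/-- The mask with the end nodes. -/
def endsMask (x : MainWire d n p G M → Bool) : MainWire d n p G M → Bool
  | left i r => intBit (sysShift i (leftShift p) x) r
  | right i r => intBit (sysShift i (rightShift p) x) r
  | _ => false

/-- The mask that replaces the column node by the row node. -/
def moveMask (x : MainWire d n p G M → Bool) : MainWire d n p G M → Bool
  | sys i r => Bool.xor (x (out i r)) (intBit (wireNum (out i) x + backShift p (pairBits i x)) r)
  | _ => false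

/-- The mask with the system. -/
def copyMask (x : MainWire d n p G M → Bool) : MainWire d n p G M → Bool
  | out i r => x (sys i r)
  | _ => false

/-- Whether a wire must be zero at the end. -/
def isChecked : MainWire d n p G M → Bool
  | sys _ _ => false
  | flag => false
  | _ => true

/-- The mask with the disjunction of all wires that must be zero at the end. -/
def flagMask (x : MainWire d n p G M → Bool) : MainWire d n p G M → Bool
  | flag => decide (∃ q ∈ Finset.univ.filter fun q : MainWire d n p G M => isChecked q = true,
      x q = true)
  | _ => false

/-- The targets of the masks. -/
def isLinked : MainWire d n p G M → Bool
  | left _ _ => true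
  | right _ _ => true
  | out _ _ => true
  | bad _ => true
  | _ => false

/-! ### Step counts for the shifted node numbers -/

section Cost

variable {S : Set (MainWire d n p G M)} {H : Set ((MainWire d n p G M → Bool) → Bool)}

/-- The pair register, with at most `2 (p + 1)²` contents, is decoded to one-hot form, and contents
with the same shift are merged. This is the source of the quadratic dependence on `p`. -/
lemma Comp.shiftInd (hp : 0 < p) {i : Fin d} (hS : ∀ r, lcu (i, .inr r) ∈ S)
    (φ : (Fin (Nat.clog 2 ((p + 1) ^ 2)) → Bool) → ℤ) :
    Comp S H (Ind (Finset.Icc (-(p : ℤ)) p) fun x => φ (pairBits i x)) (62 * p ^ 2) := by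
  have h1 : Comp S H (Ind Finset.univ fun x => pairBits i x) (6 * 2 ^ Nat.clog 2 ((p + 1) ^ 2)) :=
    Comp.decode (fun r => lcu (i, .inr r)) hS
  have h2 : Comp S (H ∪ Ind Finset.univ fun x => pairBits i x)
      (Ind (Finset.Icc (-(p : ℤ)) p) fun x => φ (pairBits i x)) _ :=
    Comp.image Set.subset_union_right (fun _ => Finset.mem_univ _) φ fun _ => rfl
  refine (h1.trans' h2).mono subset_rfl subset_rfl ?_
  rw [Finset.card_univ, Fintype.card_fun, Fintype.card_bool, Fintype.card_fin, Int.card_Icc]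
  have h3 := two_pow_clog_le (a := (p + 1) ^ 2) (by positivity)
  have h4 : ((p : ℤ) + 1 - -p).toNat = 2 * p + 1 := by omega
  rw [h4]
  nlinarith

lemma Comp.shiftedBits (hp : 0 < p) (hn : 0 < n) {i : Fin d} (hS : ∀ r, lcu (i, .inr r) ∈ S)
    {w : Fin n → MainWire d n p G M} (hw : ∀ r, w r ∈ S)
    {φ : (Fin (Nat.clog 2 ((p + 1) ^ 2)) → Bool) → ℤ} (hφ : ∀ b, -(p : ℤ) ≤ φ b ∧ φ b ≤ p) :
    Comp S H ((⋃ t : Fin n, {fun x => intBit (wireNum w x + φ (pairBits i x)) t}) ∪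
      {fun x => decide (InRange n (wireNum w x + φ (pairBits i x)))}) (113 * (n * p ^ 2)) := by
  have h1 : Comp S H _ _ := Comp.shiftInd hp hS φ
  have h2 := Comp.addShift (S := S) (H := H ∪ Ind (Finset.Icc (-(p : ℤ)) p) fun x =>
    φ (pairBits i x)) p w hw (s := fun x => φ (pairBits i x)) (fun x => Finset.mem_Icc.2 (hφ _))
    Set.subset_union_right hp
  refine (h1.trans' h2).mono subset_rfl ?_ ?_
  · exact subset_rfl
  · have e1 : p ≤ p ^ 2 := Nat.le_self_pow two_ne_zero p
    have e2 : p ^ 2 ≤ n * p ^ 2 := Nat.le_mul_of_pos_left _ hn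
    have e3 : n * p ≤ n * p ^ 2 := Nat.mul_le_mul_left _ e1
    have e4 : n ≤ n * p := Nat.le_mul_of_pos_right _ hp
    have e5 : n * (14 * (2 * p + 1) + 4) = 28 * (n * p) + 18 * n := by ring
    omega

lemma Comp.shiftedDvd (hp : 0 < p) (hn : 0 < n) {i : Fin d} (hS : ∀ r, lcu (i, .inr r) ∈ S)
    {w : Fin n → MainWire d n p G M} (hw : ∀ r, w r ∈ S)
    {φ : (Fin (Nat.clog 2 ((p + 1) ^ 2)) → Bool) → ℤ} (hφ : ∀ b, -(p : ℤ) ≤ φ b ∧ φ b ≤ p) :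
    Comp S H {fun x => decide ((p : ℤ) ∣ wireNum w x + φ (pairBits i x))} (88 * (n * p ^ 2)) := by
  have h1 : Comp S H _ _ := Comp.shiftInd hp hS φ
  have h2 := Comp.dvdShift (S := S) (H := H ∪ Ind (Finset.Icc (-(p : ℤ)) p) fun x =>
    φ (pairBits i x)) p w hw (s := fun x => φ (pairBits i x)) (fun x => Finset.mem_Icc.2 (hφ _))
    Set.subset_union_right hp
  refine (h1.trans' h2).mono subset_rfl subset_rfl ?_
  have e1 : p ≤ p ^ 2 := Nat.le_self_pow two_ne_zero p
  have e2 : p ^ 2 ≤ n * p ^ 2 := Nat.le_mul_of_pos_left _ hn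
  have e3 : n * p ≤ n * p ^ 2 := Nat.mul_le_mul_left _ e1
  have e4 : n ≤ n * p := Nat.le_mul_of_pos_right _ hp
  have e5 : n * (14 * p + 4) = 14 * (n * p) + 4 * n := by ring
  omega

end Cost

lemma leftShift_mem (b : Fin (Nat.clog 2 ((p + 1) ^ 2)) → Bool) :
    -(p : ℤ) ≤ leftShift p b ∧ leftShift p b ≤ p := by
  have := colDigit_mem b
  rw [leftShift]; omega

lemma rightShift_mem (b : Fin (Nat.clog 2 ((p + 1) ^ 2)) → Bool) :
    -(p : ℤ) ≤ rightShift p b ∧ rightShift p b ≤ p := by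
  have := colDigit_mem b
  rw [rightShift]; omega

lemma outShift_mem (b : Fin (Nat.clog 2 ((p + 1) ^ 2)) → Bool) :
    -(p : ℤ) ≤ outShift p b ∧ outShift p b ≤ p := by
  have := colDigit_mem b
  have := rowDigit_mem b
  rw [outShift]; omega

lemma backShift_mem (b : Fin (Nat.clog 2 ((p + 1) ^ 2)) → Bool) :
    -(p : ℤ) ≤ backShift p b ∧ backShift p b ≤ p := by
  have := colDigit_mem b
  have := rowDigit_mem b
  rw [backShift]; omega

/-! ### Circuits for the masks -/

section Impl

variable {R : Type} [Fintype R] [DecidableEq R] {PL PR : Matrix.unitaryGroup (R → Bool) ℂ}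

lemma Impl.applyMask {Q : Type} [Fintype Q] [DecidableEq Q] {F : (Q → Bool) → Q → Bool}
    {t : Q → Bool} (hF : ∀ q, t q = false → ∀ x, F x q = false) {k : ℕ}
    (h : Comp {q | t q = false} ∅ {f | ∃ q, t q = true ∧ f = fun x => F x q} k) :
    Impl PL PR (basisMap (QuFEM.applyMask F)) (4 * k + Fintype.card Q) 0 := by
  obtain ⟨L, h1, h2, h3⟩ := h.program
  have := Impl.xorMask (PL := PL) (PR := PR) h1 (Finset.univ.filter fun q => t q = true)
    (by simp) F (fun q hq => h3 _ ⟨q, (Finset.mem_filter.1 hq).2, rfl⟩)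
    (fun q hq => hF q (by simpa using hq))
  exact this.mono (Nat.add_le_add (Nat.mul_le_mul_left 4 h2) (Finset.card_filter_le _ _)) le_rfl

lemma Impl.linkMask (hp : 0 < p) (hn : 0 < n) :
    Impl PL PR (basisMap (QuFEM.applyMask (QuFEM.linkMask (d := d) (n := n) (p := p) (G := G)
      (M := M)))) (4 * (d * (431 * (n * p ^ 2))) + Fintype.card (MainWire d n p G M)) 0 := by
  refine Impl.applyMask (t := isLinked) ?_ ?_
  · intro q hq x
    cases q <;> first | rfl | simp [isLinked] at hq
  · have key := fun i : Fin d => by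
      have hS : ∀ r, (lcu (i, .inr r) : MainWire d n p G M) ∈
        {q : MainWire d n p G M | isLinked q = false} := fun _ => rfl
      have hw : ∀ r, (sys i r : MainWire d n p G M) ∈
        {q : MainWire d n p G M | isLinked q = false} := fun _ => rfl
      have h1 := Comp.shiftedBits (H := ∅) hp hn hS hw leftShift_mem
      have h2 := Comp.shiftedBits (H := ∅) hp hn hS hw rightShift_mem
      have h3 := Comp.shiftedBits (H := ∅) hp hn hS hw outShift_mem
      have h4 := Comp.shiftedDvd (H := ∅) hp hn hS hw leftShift_mem
      have h5 := ((h1.union h2).union h3).union h4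
      have h6 := h5.trans (Comp.and (f := fun x => decide (InRange n (sysShift i (leftShift p) x)))
        (g := fun x => decide (InRange n (sysShift i (rightShift p) x)))
        (Or.inr (Or.inl (Or.inl (Or.inl (Or.inr rfl)))))
        (Or.inr (Or.inl (Or.inl (Or.inr (Or.inr rfl))))))
      have h7 := h6.trans (Comp.and (f := fun x =>
        decide (InRange n (sysShift i (leftShift p) x)) &&
          decide (InRange n (sysShift i (rightShift p) x)))
        (g := fun x => decide ((p : ℤ) ∣ sysShift i (leftShift p) x))
        (Or.inr (Or.inr rfl)) (Or.inr (Or.inl (Or.inr rfl))))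
      exact h7.trans (Comp.not (f := validNode i) (Or.inr (Or.inr rfl)))
    have h := Comp.iUnion key
    rw [Fintype.card_fin] at h
    refine h.mono subset_rfl ?_ (Nat.mul_le_mul_left d ?_)
    · rintro f ⟨q, hq, rfl⟩
      cases q <;> simp only [isLinked, reduceCtorEq] at hq
      · exact Set.mem_iUnion.2 ⟨_, Or.inl (Or.inl (Or.inl (Or.inl (Or.inl (Or.inl
          (Or.inl (Set.mem_iUnion.2 ⟨_, rfl⟩)))))))⟩
      · exact Set.mem_iUnion.2 ⟨_, Or.inl (Or.inl (Or.inl (Or.inl (Or.inl (Or.inr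
          (Or.inl (Set.mem_iUnion.2 ⟨_, rfl⟩)))))))⟩
      · exact Set.mem_iUnion.2 ⟨_, Or.inl (Or.inl (Or.inl (Or.inl (Or.inr
          (Or.inl (Set.mem_iUnion.2 ⟨_, rfl⟩))))))⟩
      · exact Set.mem_iUnion.2 ⟨_, Or.inr rfl⟩
    -- `431 = 3 * 113 + 88 + 4`: three shifted numbers, one divisibility test, and four steps for
    -- two conjunctions and a negation.
    · have : 0 < n * p ^ 2 := by positivity
      omega

lemma Impl.endsMask (hp : 0 < p) (hn : 0 < n) :
    Impl PL PR (basisMap (QuFEM.applyMask (QuFEM.endsMask (d := d) (n := n) (p := p) (G := G)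
      (M := M)))) (4 * (d * (431 * (n * p ^ 2))) + Fintype.card (MainWire d n p G M)) 0 := by
  refine Impl.applyMask (t := fun q => match q with
    | left _ _ => true
    | right _ _ => true
    | _ => false) ?_ ?_
  · intro q hq x
    cases q <;> first | rfl | simp at hq
  · have key := fun i : Fin d => by
      have hS : ∀ r, (lcu (i, .inr r) : MainWire d n p G M) ∈
        {q : MainWire d n p G M | (match q with
          | left _ _ => true
          | right _ _ => true
          | _ => false) = false} := fun _ => rfl
      have hw : ∀ r, (sys i r : MainWire d n p G M) ∈
        {q : MainWire d n p G M | (match q with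
          | left _ _ => true
          | right _ _ => true
          | _ => false) = false} := fun _ => rfl
      have h1 := Comp.shiftedBits (H := ∅) hp hn hS hw leftShift_mem
      have h2 := Comp.shiftedBits (H := ∅) hp hn hS hw rightShift_mem
      exact h1.union h2
    have h := Comp.iUnion key
    rw [Fintype.card_fin] at h
    refine h.mono subset_rfl ?_ (Nat.mul_le_mul_left d (by omega))
    rintro f ⟨q, hq, rfl⟩
    cases q <;> simp only [reduceCtorEq] at hq
    · exact Set.mem_iUnion.2 ⟨_, Or.inl (Or.inl (Set.mem_iUnion.2 ⟨_, rfl⟩))⟩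
    · exact Set.mem_iUnion.2 ⟨_, Or.inr (Or.inl (Set.mem_iUnion.2 ⟨_, rfl⟩))⟩

lemma Impl.moveMask (hp : 0 < p) (hn : 0 < n) :
    Impl PL PR (basisMap (QuFEM.applyMask (QuFEM.moveMask (d := d) (n := n) (p := p) (G := G)
      (M := M)))) (4 * (d * (115 * (n * p ^ 2))) + Fintype.card (MainWire d n p G M)) 0 := by
  refine Impl.applyMask (t := fun q => match q with
    | sys _ _ => true
    | _ => false) ?_ ?_
  · intro q hq x
    cases q <;> first | rfl | simp at hq
  · have key := fun i : Fin d => by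
      have hS : ∀ r, (lcu (i, .inr r) : MainWire d n p G M) ∈
        {q : MainWire d n p G M | (match q with
          | sys _ _ => true
          | _ => false) = false} := fun _ => rfl
      have hw : ∀ r, (out i r : MainWire d n p G M) ∈
        {q : MainWire d n p G M | (match q with
          | sys _ _ => true
          | _ => false) = false} := fun _ => rfl
      have h1 := Comp.shiftedBits (H := ∅) hp hn hS hw backShift_mem
      refine h1.trans' (Comp.iUnion (T := fun r : Fin n => {fun x => Bool.xor (x (out i r))
        (intBit (wireNum (out i) x + backShift p (pairBits i x)) r)}) (k := 1 + 1) fun r => ?_)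
      refine (Comp.var (hw r)).trans' (Comp.xor (f := fun x => x (out i r))
        (g := fun x => intBit (wireNum (out i) x + backShift p (pairBits i x)) r) (Or.inr rfl)
        (Or.inl (Or.inr (Or.inl (Set.mem_iUnion.2 ⟨r, rfl⟩)))))
    have h := Comp.iUnion key
    rw [Fintype.card_fin, Fintype.card_fin] at h
    refine h.mono subset_rfl ?_ (Nat.mul_le_mul_left d ?_)
    · rintro f ⟨q, hq, rfl⟩
      cases q <;> simp only [reduceCtorEq] at hq
      exact Set.mem_iUnion.2 ⟨_, Set.mem_iUnion.2 ⟨_, rfl⟩⟩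
    · have : n ≤ n * p ^ 2 := Nat.le_mul_of_pos_right _ (by positivity)
      omega

lemma Impl.copyMask :
    Impl PL PR (basisMap (QuFEM.applyMask (QuFEM.copyMask (d := d) (n := n) (p := p) (G := G)
      (M := M)))) (4 * (d * n) + Fintype.card (MainWire d n p G M)) 0 := by
  refine Impl.applyMask (t := fun q => match q with
    | out _ _ => true
    | _ => false) ?_ ?_
  · intro q hq x
    cases q <;> first | rfl | simp at hq
  · have h := Comp.iUnion (S := {q : MainWire d n p G M | (match q with
      | out _ _ => true
      | _ => false) = false}) (H := ∅) (T := fun ir : Fin d × Fin n =>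
        {fun x : MainWire d n p G M → Bool => x (sys ir.1 ir.2)}) (k := 1) fun ir => Comp.var rfl
    rw [Fintype.card_prod, Fintype.card_fin, Fintype.card_fin] at h
    refine h.mono subset_rfl ?_ (by omega)
    rintro f ⟨q, hq, rfl⟩
    cases q <;> simp only [reduceCtorEq] at hq
    exact Set.mem_iUnion.2 ⟨(_, _), rfl⟩

lemma Impl.flagMask :
    Impl PL PR (basisMap (QuFEM.applyMask (QuFEM.flagMask (d := d) (n := n) (p := p) (G := G)
      (M := M)))) (17 * Fintype.card (MainWire d n p G M) + 12) 0 := by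
  have ht : ∀ q : MainWire d n p G M, isChecked q = true → (match q with
    | flag => true
    | _ => false) = false := by
    intro q hq
    cases q <;> first | rfl | simp [isChecked] at hq
  refine (Impl.applyMask (k := 4 * Fintype.card (MainWire d n p G M) + 3)
    (t := fun q => match q with
    | flag => true
    | _ => false) ?_ ?_).mono (by omega) le_rfl
  · intro q hq x
    cases q <;> first | rfl | simp at hq
  · set s := Finset.univ.filter fun q : MainWire d n p G M => isChecked q = true with hs
    have h1 := Comp.biUnion (S := {q : MainWire d n p G M | (match q with
      | flag => true
      | _ => false) = false}) (H := ∅) s (T := fun q =>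
        {fun x : MainWire d n p G M → Bool => x q}) (k := fun _ => 1) fun q hq =>
        Comp.var (ht q (Finset.mem_filter.1 hq).2)
    have h2 := Comp.any (S := {q : MainWire d n p G M | (match q with
      | flag => true
      | _ => false) = false}) (H := ∅ ∪ ⋃ q ∈ s, {fun x : MainWire d n p G M → Bool => x q})
      (s := s) (f := fun q x => x q) fun q hq => Or.inr (Set.mem_biUnion (x := q) hq rfl)
    have h3 : s.card ≤ Fintype.card (MainWire d n p G M) := Finset.card_filter_le _ _
    refine (h1.trans' h2).mono subset_rfl ?_ ?_
    · rintro f ⟨q, hq, rfl⟩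
      cases q <;> simp only [reduceCtorEq] at hq
      rw [Set.mem_singleton_iff]
      funext x
      exact decide_eq_decide.2 Iff.rfl
    · rw [Finset.sum_const, smul_eq_mul]; omega

end Impl

end Masks

/-! ## The entries of the block-encoded matrix -/

section Entries

open MainWire Polynomial

variable {d n p E G M : ℕ}

/-- The basis state with a node in the system and a value of the register for the coefficients. -/
def mainState (K : Fin d → Fin (2 ^ n)) (s : LCUWires d p G → Bool) :
    MainWire d n p G M → Bool
  | sys i r => (K i : ℕ).testBit r
  | lcu q => s q
  | _ => false

/-- The map that replaces the column node by the row node. -/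
def coreMap (x : MainWire d n p G M → Bool) : MainWire d n p G M → Bool :=
  applyMask copyMask (applyMask moveMask (applyMask endsMask x))

/-- The shift back from the output node reproduces the old system node. When this is the content of
the system register, the two cancel and the output node remains there; the copy in `out` can then be
cleared. -/
lemma coreMap_sys (x : MainWire d n p G M → Bool) (i : Fin d) (r : Fin n) :
    coreMap x (sys i r) = Bool.xor (x (sys i r)) (Bool.xor (x (out i r))
      (intBit (wireNum (out i) x + backShift p (pairBits i x)) r)) := by
  have h : pairBits i (applyMask endsMask x) = pairBits i x := by
    funext r; simp [pairBits, applyMask, endsMask]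
  simp [coreMap, applyMask, copyMask, moveMask, endsMask, wireNum, ← h]

lemma coreMap_out (x : MainWire d n p G M → Bool) (i : Fin d) (r : Fin n) :
    coreMap x (out i r) = Bool.xor (x (out i r)) (coreMap x (sys i r)) := by
  simp [coreMap, applyMask, copyMask, moveMask, endsMask]

lemma coreMap_left (x : MainWire d n p G M → Bool) (i : Fin d) (r : Fin n) :
    coreMap x (left i r) = Bool.xor (x (left i r)) (intBit (sysShift i (leftShift p) x) r) := by
  simp [coreMap, applyMask, copyMask, moveMask, endsMask]

lemma coreMap_right (x : MainWire d n p G M → Bool) (i : Fin d) (r : Fin n) :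
    coreMap x (right i r) = Bool.xor (x (right i r)) (intBit (sysShift i (rightShift p) x) r) := by
  simp [coreMap, applyMask, copyMask, moveMask, endsMask]

lemma coreMap_fixed (x : MainWire d n p G M → Bool) {q : MainWire d n p G M}
    (h : ∀ x : MainWire d n p G M → Bool, endsMask x q = false ∧ moveMask x q = false ∧
      copyMask x q = false) : coreMap x q = x q := by
  simp [coreMap, applyMask, (h _).1, (h _).2.1, (h _).2.2]

lemma wireNum_mainState (K : Fin d → Fin (2 ^ n)) (s : LCUWires d p G → Bool) (i : Fin d) :
    wireNum (sys i) (mainState (M := M) K s) = K i :=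
  wireNum_eq (K i).2 fun _ => rfl

lemma digits_lcuState (ℓ : Fin d → Fin G) (j k : Fin d → Fin (p + 1)) (i : Fin d) :
    rowDigit p (fun r => lcuState ℓ j k (i, .inr r)) = (j i : ℕ) ∧
      colDigit p (fun r => lcuState ℓ j k (i, .inr r)) = (k i : ℕ) := by
  have hlt : (j i : ℕ) * (p + 1) + (k i : ℕ) < 2 ^ Nat.clog 2 ((p + 1) ^ 2) := by
    refine lt_of_lt_of_le ?_ (Nat.le_pow_clog one_lt_two _)
    have h1 := (j i).2
    have h2 := (k i).2
    nlinarith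
  have h : Nat.ofBits (fun r : Fin (Nat.clog 2 ((p + 1) ^ 2)) => lcuState ℓ j k (i, .inr r)) =
      (j i : ℕ) * (p + 1) + (k i : ℕ) :=
    wireNum_eq (w := fun r => (i, Sum.inr r)) (x := lcuState ℓ j k) hlt fun _ => rfl
  rw [rowDigit, colDigit, h, add_comm, Nat.add_mul_div_right _ _ (Nat.succ_pos p),
    Nat.add_mul_mod_self_right, Nat.mod_eq_of_lt (k i).2, Nat.div_eq_of_lt (k i).2, zero_add,
    Nat.mod_eq_of_lt (j i).2]
  exact ⟨rfl, rfl⟩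

lemma lcuState_injective : Function.Injective
    fun a : (Fin d → Fin G) × (Fin d → Fin (p + 1)) × (Fin d → Fin (p + 1)) =>
      lcuState a.1 a.2.1 a.2.2 := by
  rintro ⟨ℓ, j, k⟩ ⟨ℓ', j', k'⟩ h
  have h' : lcuState ℓ j k = lcuState ℓ' j' k' := h
  have hℓ : ℓ = ℓ' := by
    funext i
    have hlt : ∀ a : Fin G, (a : ℕ) < 2 ^ Nat.clog 2 G := fun a =>
      a.2.trans_le (Nat.le_pow_clog one_lt_two G)
    refine Fin.ext ?_
    rw [← wireNum_eq (w := fun r => (i, Sum.inl r)) (x := lcuState ℓ j k) (hlt (ℓ i)) fun _ => rfl,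
      h', wireNum_eq (w := fun r => (i, Sum.inl r)) (x := lcuState ℓ' j' k') (hlt (ℓ' i))
      fun _ => rfl]
  have hjk : ∀ i, j i = j' i ∧ k i = k' i := by
    intro i
    have h1 := digits_lcuState ℓ j k i
    have h2 := digits_lcuState ℓ' j' k' i
    rw [h'] at h1
    exact ⟨Fin.ext (by exact_mod_cast h1.1.symm.trans h2.1),
      Fin.ext (by exact_mod_cast h1.2.symm.trans h2.2)⟩
  rw [hℓ, show j = j' from funext fun i => (hjk i).1, show k = k' from funext fun i => (hjk i).2]

/-- The state after the computation of the end nodes, the output node and the validity. -/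
def linkedState (M : ℕ) (K : Fin d → Fin (2 ^ n)) (ℓ : Fin d → Fin G) (j k : Fin d → Fin (p + 1)) :
    MainWire d n p G M → Bool := applyMask linkMask (mainState K (lcuState ℓ j k))

/-! ### Correctness of the node arithmetic -/

section Linked

variable {J K : Fin d → Fin (2 ^ n)} {ℓ : Fin d → Fin G} {j k : Fin d → Fin (p + 1)}

lemma sysShift_mainState (φ : (Fin (Nat.clog 2 ((p + 1) ^ 2)) → Bool) → ℤ) (i : Fin d) :
    sysShift (M := M) i φ (mainState K (lcuState ℓ j k)) =
      (K i : ℕ) + φ fun r => lcuState ℓ j k (i, .inr r) := by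
  rw [sysShift, wireNum_mainState]; rfl

lemma sysShift_linkedState (φ : (Fin (Nat.clog 2 ((p + 1) ^ 2)) → Bool) → ℤ) (i : Fin d) :
    sysShift i φ (linkedState M K ℓ j k) =
      sysShift (M := M) i φ (mainState K (lcuState ℓ j k)) := by
  have h : pairBits i (linkedState M K ℓ j k) =
      pairBits (M := M) i (mainState K (lcuState ℓ j k)) := by
    funext r; simp [pairBits, linkedState, applyMask, linkMask]
  rw [sysShift, h]
  simp [sysShift, linkedState, applyMask, linkMask, wireNum]

/-- Whether the node `K` is the local node `k` of an element in direction `i`. -/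
lemma validNode_iff (hE : E * p + 1 = 2 ^ n) (hp : 0 < p) (i : Fin d) :
    validNode (M := M) i (mainState K (lcuState ℓ j k)) = true ↔
      ∃ e : Fin E, (K i : ℕ) = (e : ℕ) * p + (k i : ℕ) := by
  have hdig := digits_lcuState ℓ j k i
  simp only [validNode, Bool.and_eq_true, decide_eq_true_eq, InRange, sysShift_mainState,
    leftShift, rightShift, hdig]
  have hK : ((K i : ℕ) : ℤ) < 2 ^ n := by exact_mod_cast (K i).2
  have hE' : (E : ℤ) * p + 1 = 2 ^ n := by exact_mod_cast hE
  have hp' : (0 : ℤ) < p := by exact_mod_cast hp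
  constructor
  · rintro ⟨⟨⟨h1, h2⟩, h3, h4⟩, e, he⟩
    have he0 : 0 ≤ e := by
      by_contra hneg
      have : e + 1 ≤ 0 := by omega
      nlinarith
    have heE : e < E := by
      by_contra hge
      have : (E : ℤ) ≤ e := by omega
      nlinarith
    lift e to ℕ using he0
    refine ⟨⟨e, by exact_mod_cast heE⟩, ?_⟩
    have : ((K i : ℕ) : ℤ) = e * p + (k i : ℕ) := by linarith
    exact_mod_cast this
  · rintro ⟨e, he⟩
    have he' : ((K i : ℕ) : ℤ) = (e : ℕ) * p + (k i : ℕ) := by exact_mod_cast he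
    have heE : ((e : ℕ) : ℤ) + 1 ≤ E := by exact_mod_cast e.2
    have h0 : (0 : ℤ) ≤ (e : ℕ) * p := by positivity
    rw [he']
    refine ⟨⟨⟨by linarith, by linarith⟩, by linarith, ?_⟩, ⟨(e : ℕ), by ring⟩⟩
    nlinarith

lemma linked_left {e : Fin d → Fin E} (hK : IsConn e k K) (i : Fin d)
    (r : Fin n) : linkedState M K ℓ j k (left i r) = ((e i : ℕ) * p).testBit r := by
  have h1 : linkedState M K ℓ j k (left i r) =
      intBit (sysShift (M := M) i (leftShift p) (mainState K (lcuState ℓ j k))) r := by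
    simp [linkedState, applyMask, linkMask, mainState]
  rw [h1, sysShift_mainState, leftShift, (digits_lcuState ℓ j k i).2, ← intBit_natCast, hK i]
  congr 1
  push_cast
  ring

lemma linked_right {e : Fin d → Fin E} (hK : IsConn e k K) (i : Fin d)
    (r : Fin n) : linkedState M K ℓ j k (right i r) = (((e i : ℕ) + 1) * p).testBit r := by
  have h1 : linkedState M K ℓ j k (right i r) =
      intBit (sysShift (M := M) i (rightShift p) (mainState K (lcuState ℓ j k))) r := by
    simp [linkedState, applyMask, linkMask, mainState]
  rw [h1, sysShift_mainState, rightShift, (digits_lcuState ℓ j k i).2, ← intBit_natCast, hK i]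
  congr 1
  push_cast
  ring

lemma linked_out {e : Fin E} {i : Fin d}
    (hK : (K i : ℕ) = (e : ℕ) * p + (k i : ℕ)) (r : Fin n) :
    linkedState M K ℓ j k (out i r) = ((e : ℕ) * p + (j i : ℕ)).testBit r := by
  have h1 : linkedState M K ℓ j k (out i r) =
      intBit (sysShift (M := M) i (outShift p) (mainState K (lcuState ℓ j k))) r := by
    simp [linkedState, applyMask, linkMask, mainState]
  rw [h1, sysShift_mainState, outShift, (digits_lcuState ℓ j k i).1, (digits_lcuState ℓ j k i).2,
    ← intBit_natCast, hK]
  congr 1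
  push_cast
  ring

lemma node_lt (hE : E * p + 1 = 2 ^ n) (e : Fin E) (j : Fin (p + 1)) :
    (e : ℕ) * p + (j : ℕ) < 2 ^ n := by
  have h1 := e.2
  have h2 := j.2
  nlinarith

lemma coreMap_linked_sys (hE : E * p + 1 = 2 ^ n) {e : Fin E} {i : Fin d}
    (hK : (K i : ℕ) = (e : ℕ) * p + (k i : ℕ)) (r : Fin n) :
    coreMap (linkedState M K ℓ j k) (sys i r) = ((e : ℕ) * p + (j i : ℕ)).testBit r := by
  have h1 : linkedState M K ℓ j k (sys i r) = (K i : ℕ).testBit r := by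
    simp [linkedState, applyMask, linkMask, mainState]
  have h2 : wireNum (out i) (linkedState M K ℓ j k) = (e : ℕ) * p + (j i : ℕ) :=
    wireNum_eq (node_lt hE e (j i)) fun r => linked_out hK r
  have h3 : pairBits i (linkedState M K ℓ j k) = fun r => lcuState ℓ j k (i, .inr r) := by
    funext r
    simp [pairBits, linkedState, applyMask, linkMask, mainState]
  have h4 : (((e : ℕ) * p + (j i : ℕ) : ℕ) : ℤ) + (((k i : ℕ) : ℤ) - ((j i : ℕ) : ℤ)) =
      ((K i : ℕ) : ℤ) := by
    rw [hK]; push_cast; ring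
  rw [coreMap_sys, h1, linked_out hK, h2, h3, backShift, (digits_lcuState ℓ j k i).1,
    (digits_lcuState ℓ j k i).2, h4, intBit_natCast]
  cases (K i : ℕ).testBit r <;> cases ((e : ℕ) * p + (j i : ℕ)).testBit r <;> rfl

/-- The column node is replaced by the row node, and everything is cleaned up, if and only if both
are nodes of the same element. -/
lemma mainState_eq_coreMap_iff (hE : E * p + 1 = 2 ^ n) (hp : 0 < p) :
    mainState J (lcuState ℓ j k) = coreMap (linkedState M K ℓ j k) ↔
      ∃ e : Fin d → Fin E, IsConn e j J ∧ IsConn e k K := by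
  constructor
  · intro h
    have hval : ∀ i, ∃ e : Fin E, (K i : ℕ) = (e : ℕ) * p + (k i : ℕ) := by
      intro i
      rw [← validNode_iff (M := M) (ℓ := ℓ) (j := j) hE hp i]
      -- The wire `bad i` is never cleared, so agreement with a state in which it is zero forces `K`
      -- to be a node of the required form.
      have h1 := congrFun h (bad i)
      rw [coreMap_fixed _ fun _ => ⟨rfl, rfl, rfl⟩] at h1
      simpa [linkedState, applyMask, linkMask, mainState] using h1
    choose e he using hval
    refine ⟨e, fun i => ?_, he⟩
    refine Nat.eq_of_testBit_eq fun t => ?_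
    by_cases ht : t < n
    · have h1 := congrFun h (sys i ⟨t, ht⟩)
      rwa [coreMap_linked_sys hE (he i)] at h1
    · have hle : 2 ^ n ≤ 2 ^ t := Nat.pow_le_pow_right two_pos (by omega)
      rw [Nat.testBit_eq_false_of_lt ((J i).2.trans_le hle),
        Nat.testBit_eq_false_of_lt ((node_lt hE (e i) (j i)).trans_le hle)]
  · rintro ⟨e, hJ, hK⟩
    funext q
    cases q with
    | sys i r => rw [coreMap_linked_sys hE (hK i), ← hJ i]; rfl
    | out i r =>
      rw [coreMap_out, coreMap_linked_sys hE (hK i), linked_out (hK i), Bool.xor_self]; rfl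
    | left i r =>
      rw [coreMap_left, sysShift_linkedState]
      simp [linkedState, applyMask, linkMask, mainState]
    | right i r =>
      rw [coreMap_right, sysShift_linkedState]
      simp [linkedState, applyMask, linkMask, mainState]
    | bad i =>
      have h1 := (validNode_iff (M := M) (ℓ := ℓ) (j := j) (K := K) hE hp i).2 ⟨e i, hK i⟩
      rw [coreMap_fixed _ fun _ => ⟨rfl, rfl, rfl⟩]
      simp [linkedState, applyMask, linkMask, mainState, h1]
    | lcu q =>
      rw [coreMap_fixed _ fun _ => ⟨rfl, rfl, rfl⟩]
      simp [linkedState, applyMask, linkMask, mainState]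
    | place i r =>
      rw [coreMap_fixed _ fun _ => ⟨rfl, rfl, rfl⟩]
      simp [linkedState, applyMask, linkMask, mainState]
    | gauss i l =>
      rw [coreMap_fixed _ fun _ => ⟨rfl, rfl, rfl⟩]
      simp [linkedState, applyMask, linkMask, mainState]
    | signal i =>
      rw [coreMap_fixed _ fun _ => ⟨rfl, rfl, rfl⟩]
      simp [linkedState, applyMask, linkMask, mainState]
    | node a =>
      rw [coreMap_fixed _ fun _ => ⟨rfl, rfl, rfl⟩]
      simp [linkedState, applyMask, linkMask, mainState]
    | flag =>
      rw [coreMap_fixed _ fun _ => ⟨rfl, rfl, rfl⟩]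
      simp [linkedState, applyMask, linkMask, mainState]

end Linked

/-! ### The circuit -/

lemma actsIn_basisMap {Q : Type} {S : Set Q} {g : (Q → Bool) → Q → Bool}
    (h : ∀ x, ∀ q ∉ S, g x q = x q) : ActsIn S (basisMap g) := by
  intro x y hxy q hq
  simp only [basisMap, ne_eq, ite_eq_right_iff, Classical.not_imp] at hxy
  rw [hxy.1, h y q hq]

/-- The operator between the two queries. -/
def coreMat (I : Matrix (MainWire d n p G M → Bool) (MainWire d n p G M → Bool) ℂ) :
    Matrix (MainWire d n p G M → Bool) (MainWire d n p G M → Bool) ℂ :=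
  basisMap coreMap * I * basisMap (applyMask linkMask)

/-- The wires of the register of the state-preparation pair. -/
def lcuEmb : LCUWires d p G ↪ MainWire d n p G M := ⟨lcu, fun _ _ h => by injection h⟩

/-- The block-encoding operator. -/
def blockMat (PL PR : Matrix.unitaryGroup (LCUWires d p G → Bool) ℂ)
    (I : Matrix (MainWire d n p G M → Bool) (MainWire d n p G M → Bool) ℂ) :
    Matrix (MainWire d n p G M → Bool) (MainWire d n p G M → Bool) ℂ :=
  basisMap (applyMask flagMask) *
    (actOn lcuEmb PL.1.conjTranspose * coreMat I * actOn lcuEmb PR.1)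

variable {I : Matrix (MainWire d n p G M → Bool) (MainWire d n p G M → Bool) ℂ}

lemma coreMap_coin (x : MainWire d n p G M → Bool) {q : MainWire d n p G M}
    (hq : q.isCoin = true) : coreMap x q = x q := by
  refine coreMap_fixed x fun x => ?_
  cases q <;> first | exact ⟨rfl, rfl, rfl⟩ | simp [isCoin] at hq

/-- The coefficient register is only read, so the two queries give a weighted sum over its contents;
the flag is untouched until the final test. -/
lemma actsIn_coreMat (hI : ActsIn {q | q.isCoin = true} I) :
    ActsIn {q | q ∉ Set.range (lcu : _ → MainWire d n p G M) ∧ q ≠ flag} (coreMat I) := by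
  refine (((actsIn_basisMap ?_).mul (hI.mono ?_)).mul (actsIn_basisMap ?_))
  · intro x q hq
    refine coreMap_fixed x fun x => ?_
    cases q <;> first | exact ⟨rfl, rfl, rfl⟩ | simp at hq
  · intro q hq
    refine ⟨?_, ?_⟩
    · rintro ⟨_, rfl⟩; exact Bool.false_ne_true hq
    · rintro rfl; exact Bool.false_ne_true hq
  · intro x q hq
    have h : linkMask x q = false := by
      cases q with
      | lcu q => rfl
      | flag => rfl
      | _ => exact hq.elim (by simp)
    rw [applyMask, h, Bool.xor_false]

/-- The maps before and after `I` fix the coins and `I` changes nothing else. If the coins are zero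
at both ends, then `I` can only return the linked state to itself, so just its diagonal entry
enters. -/
lemma coreMat_apply (hI : ActsIn {q | q.isCoin = true} I) {x y : MainWire d n p G M → Bool}
    (hx : ∀ q, q.isCoin = true → x q = false) (hy : ∀ q, q.isCoin = true → y q = false)
    [Decidable (x = coreMap (applyMask linkMask y))] :
    coreMat I x y = if x = coreMap (applyMask linkMask y) then
      I (applyMask linkMask y) (applyMask linkMask y) else 0 := by
  rw [coreMat, mul_basisMap_apply, Matrix.mul_apply]
  set κ := applyMask linkMask y with hκ
  have hκ0 : ∀ q, q.isCoin = true → κ q = false := by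
    intro q hq
    have : linkMask y q = false := by cases q <;> first | rfl | simp [isCoin] at hq
    rw [hκ, applyMask, this, hy q hq]; rfl
  rw [Finset.sum_eq_single κ]
  · simp only [basisMap, ← hκ]
    split_ifs <;> simp
  · intro z _ hz
    by_contra h0
    have h1 := left_ne_zero_of_mul h0
    simp only [basisMap, ne_eq, ite_eq_right_iff, Classical.not_imp] at h1
    apply hz
    funext q
    by_cases hq : q.isCoin = true
    · rw [hκ0 q hq, ← coreMap_coin z hq, ← h1.1, hx q hq]
    · exact hI z κ (right_ne_zero_of_mul h0) q hq
  · simp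

/-- `W` does not change the flag and the flag is not among the tested wires, so the mask is an
involution. Finding the flag at `0` projects onto the states in which all tested wires are zero. -/
lemma flagMask_mul_apply {W : Matrix (MainWire d n p G M → Bool) (MainWire d n p G M → Bool) ℂ}
    (hW : ActsIn {q | q ≠ flag} W) {x y : MainWire d n p G M → Bool} (hx : x flag = false)
    (hy : y flag = false) [Decidable (∀ q, isChecked q = true → x q = false)] :
    (basisMap (applyMask flagMask) * W :
      Matrix (MainWire d n p G M → Bool) (MainWire d n p G M → Bool) ℂ) x y =
      if ∀ q, isChecked q = true → x q = false then W x y else 0 := by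
  have hinv : ∀ z : MainWire d n p G M → Bool, applyMask flagMask (applyMask flagMask z) = z := by
    intro z
    have h1 : ∀ q, isChecked q = true → applyMask flagMask z q = z q := by
      intro q hq
      cases q <;> first | (simp [applyMask, flagMask]; done) | simp [isChecked] at hq
    have h2 : flagMask (applyMask flagMask z) = flagMask z := by
      funext q
      cases q <;> try rfl
      refine decide_eq_decide.2 (exists_congr fun q => and_congr_right fun hq => ?_)
      rw [h1 q (Finset.mem_filter.1 hq).2]
    funext q
    rw [applyMask, h2]
    simp [applyMask]
  have hval : (basisMap (applyMask flagMask) * W :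
      Matrix (MainWire d n p G M → Bool) (MainWire d n p G M → Bool) ℂ) x y =
        W (applyMask flagMask x) y := by
    rw [Matrix.mul_apply, Finset.sum_eq_single (applyMask flagMask x)]
    · simp [basisMap, hinv]
    · intro z _ hz
      rw [basisMap, if_neg, zero_mul]
      rintro rfl
      exact hz (hinv z).symm
    · simp
  rw [hval]
  split_ifs with h
  · congr 1
    funext q
    have h2 : flagMask x q = false := by
      cases q <;> try rfl
      simp only [flagMask, decide_eq_false_iff_not]
      rintro ⟨q, hq, hq'⟩
      rw [h q (Finset.mem_filter.1 hq).2] at hq'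
      exact Bool.false_ne_true hq'
    rw [applyMask, h2, Bool.xor_false]
  · by_contra h0
    have h1 := hW _ _ h0 flag (by simp)
    rw [hy, applyMask, hx, Bool.false_xor] at h1
    apply h
    intro q hq
    by_contra hne
    have h2 : flagMask x flag = true := by
      simp only [flagMask, decide_eq_true_eq]
      exact ⟨q, by simp [hq], by simpa using hne⟩
    rw [h2] at h1
    exact Bool.noConfusion h1

lemma overwrite_mainState (s t : LCUWires d p G → Bool) (K : Fin d → Fin (2 ^ n)) :
    overwrite (lcuEmb (M := M)) s (mainState K t) = mainState K s := by
  refine overwrite_eq (lcuEmb (n := n) (M := M)).injective (fun q hq => ?_) ?_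
  · cases q with
    | lcu q => exact absurd ⟨q, rfl⟩ hq
    | _ => rfl
  · rfl

/-- The operator vanishes unless all wires that must be zero are zero. -/
lemma blockMat_apply_eq_zero (hI : ActsIn {q | q.isCoin = true} I)
    (PL PR : Matrix.unitaryGroup (LCUWires d p G → Bool) ℂ) {x y : MainWire d n p G M → Bool}
    (hx : x flag = false) (hy : y flag = false) (h : ∃ q, isChecked q = true ∧ x q = true) :
    blockMat PL PR I x y = 0 := by
  classical
  have hl : ∀ u, ActsIn {q : MainWire d n p G M | q ≠ flag} (actOn lcuEmb u) := fun u =>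
    (actsIn_actOn _ u).mono (by rintro _ ⟨q, rfl⟩; simp [lcuEmb])
  rw [blockMat, flagMask_mul_apply (((hl _).mul ((actsIn_coreMat hI).mono fun q hq => hq.2)).mul
    (hl _)) hx hy, if_neg]
  intro h'
  obtain ⟨q, h1, h2⟩ := h
  rw [h' q h1] at h2
  exact Bool.noConfusion h2

lemma blockMat_apply (hI : ActsIn {q | q.isCoin = true} I)
    (PL PR : Matrix.unitaryGroup (LCUWires d p G → Bool) ℂ) (J K : Fin d → Fin (2 ^ n)) :
    blockMat PL PR I (mainState J fun _ => false) (mainState K fun _ => false) =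
      ∑ s, star (PL.1 s fun _ => false) * (PR.1 s fun _ => false) *
        coreMat I (mainState J s) (mainState K s) := by
  classical
  have hl : ∀ u, ActsIn {q : MainWire d n p G M | q ≠ flag} (actOn lcuEmb u) := fun u =>
    (actsIn_actOn _ u).mono (by rintro _ ⟨q, rfl⟩; simp [lcuEmb])
  rw [blockMat, flagMask_mul_apply (((hl _).mul ((actsIn_coreMat hI).mono fun q hq => hq.2)).mul
    (hl _)) rfl rfl, if_pos, sandwich_apply lcuEmb.injective]
  · refine Finset.sum_congr rfl fun s _ => ?_
    rw [overwrite_mainState, overwrite_mainState]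
    rfl
  · intro x y hxy
    funext q
    exact actsIn_coreMat hI x y hxy (lcu q) fun h => h.1 ⟨q, rfl⟩
  · intro q hq
    cases q <;> first | rfl | simp [isChecked] at hq

/-- The entries of the block-encoded matrix. -/
theorem blockMat_eq_assemble (hE : E * p + 1 = 2 ^ n) (hp : 0 < p) (hE0 : 0 < E)
    (hI : ActsIn {q | q.isCoin = true} I) {g : (Fin d → ℝ) → ℝ}
    (hg : ∀ (κ : MainWire d n p G M → Bool) (ℓ : Fin d → Fin G) (A B : Fin d → ℕ),
        (∀ q, q.isCoin = true → κ q = false) →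
        (∀ i r, κ (lcu (i, .inl r)) = (ℓ i : ℕ).testBit r) →
        (∀ i, A i < 2 ^ n) → (∀ i, B i < 2 ^ n) →
        (∀ i r, κ (left i r) = (A i).testBit r) → (∀ i r, κ (right i r) = (B i).testBit r) →
        (M : ℂ) * I κ κ = ((g fun i => ((1 - unitNode G (ℓ i)) * A i + unitNode G (ℓ i) * B i) /
          (2 ^ n - 1) : ℝ) : ℂ))
    {PL PR : Matrix.unitaryGroup (LCUWires d p G → Bool) ℂ}
    {y : (Fin d → Fin G) → (Fin d → Fin (p + 1)) → (Fin d → Fin (p + 1)) → ℝ}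
    (hP : IsStatePrepPair PL PR y) (J K : Fin d → Fin (2 ^ n)) :
    ((M * ∑ ℓ, ∑ j, ∑ k, |y ℓ j k| : ℝ) : ℂ) *
        blockMat PL PR I (mainState J fun _ => false) (mainState K fun _ => false) =
      assemble n (fun (e : Fin d → Fin E) j k => ∑ ℓ, y ℓ j k * g (quadPoint e ℓ)) J K := by
  classical
  have hcore : ∀ ℓ j k, (M : ℂ) * coreMat I (mainState J (lcuState ℓ j k))
      (mainState K (lcuState ℓ j k)) = ∑ e : Fin d → Fin E,
        if IsConn e j J ∧ IsConn e k K then ((g (quadPoint e ℓ) : ℝ) : ℂ) else 0 := by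
    intro ℓ j k
    have h0 : ∀ J : Fin d → Fin (2 ^ n), ∀ q : MainWire d n p G M, q.isCoin = true →
        mainState J (lcuState ℓ j k) q = false := by
      intro J q hq
      cases q <;> first | rfl | simp [isCoin] at hq
    rw [coreMat_apply hI (h0 J) (h0 K)]
    by_cases h : ∃ e : Fin d → Fin E, IsConn e j J ∧ IsConn e k K
    · have h1 := (mainState_eq_coreMap_iff (M := M) (ℓ := ℓ) hE hp).2 h
      rw [linkedState] at h1
      obtain ⟨e, hJ, hK⟩ := h
      rw [if_pos h1, Finset.sum_eq_single e, if_pos ⟨hJ, hK⟩]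
      · rw [hg _ ℓ (fun i => (e i : ℕ) * p) (fun i => ((e i : ℕ) + 1) * p) ?_ ?_ ?_ ?_ ?_ ?_]
        · congr 2
          funext i
          -- With `2^n - 1 = E p` the factor `p` of the end nodes cancels, and the convex
          -- combination is the Gauss point `(e + t) / E`.
          have h2 : (2 : ℝ) ^ n - 1 = E * p := by
            have : (E : ℝ) * p + 1 = 2 ^ n := by exact_mod_cast hE
            linarith
          have hp' : (p : ℝ) ≠ 0 := by exact_mod_cast hp.ne'
          have hE' : (E : ℝ) ≠ 0 := by exact_mod_cast hE0.ne'
          rw [h2, quadPoint, ← unitNode]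
          push_cast
          field_simp
          ring
        · intro q hq
          have h3 : linkMask (mainState K (lcuState ℓ j k)) q = false := by
            cases q <;> first | rfl | simp [isCoin] at hq
          rw [applyMask, h3, h0 K q hq]; rfl
        · intro i r
          simp [applyMask, linkMask, mainState, lcuState]
        · intro i
          exact lt_of_le_of_lt (Nat.le_add_right _ _) (node_lt hE (e i) 0)
        · intro i
          have h3 := (e i).2
          nlinarith
        · exact fun i r => linked_left hK i r
        · exact fun i r => linked_right hK i r
      · intro e' _ hne
        exact if_neg fun h => hne (h.1.ext hp hJ)
      · simp
    · have h1 : ¬ mainState J (lcuState ℓ j k) = coreMap (linkedState M K ℓ j k) := fun h1 =>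
        h ((mainState_eq_coreMap_iff hE hp).1 h1)
      rw [linkedState] at h1
      rw [if_neg h1, mul_zero, Finset.sum_eq_zero]
      exact fun e _ => if_neg fun h' => h ⟨e, h'⟩
  rw [blockMat_apply hI, ← Fintype.sum_of_injective (fun a : (Fin d → Fin G) ×
    (Fin d → Fin (p + 1)) × (Fin d → Fin (p + 1)) => lcuState a.1 a.2.1 a.2.2) lcuState_injective
    (fun a => star (PL.1 (lcuState a.1 a.2.1 a.2.2) fun _ => false) *
      (PR.1 (lcuState a.1 a.2.1 a.2.2) fun _ => false) *
        coreMat I (mainState J (lcuState a.1 a.2.1 a.2.2))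
          (mainState K (lcuState a.1 a.2.1 a.2.2)))]
  · rw [Finset.mul_sum, assemble]
    have h1 : ∀ a : (Fin d → Fin G) × (Fin d → Fin (p + 1)) × (Fin d → Fin (p + 1)),
        ((M * ∑ ℓ, ∑ j, ∑ k, |y ℓ j k| : ℝ) : ℂ) *
          (star (PL.1 (lcuState a.1 a.2.1 a.2.2) fun _ => false) *
            (PR.1 (lcuState a.1 a.2.1 a.2.2) fun _ => false) *
            coreMat I (mainState J (lcuState a.1 a.2.1 a.2.2))
              (mainState K (lcuState a.1 a.2.1 a.2.2))) =
        ∑ e : Fin d → Fin E, if IsConn e a.2.1 J ∧ IsConn e a.2.2 K then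
          ((y a.1 a.2.1 a.2.2 * g (quadPoint e a.1) : ℝ) : ℂ) else 0 := by
      rintro ⟨ℓ, j, k⟩
      have h2 := hP.1 ℓ j k
      have h3 := hcore ℓ j k
      calc _ = (((∑ ℓ, ∑ j, ∑ k, |y ℓ j k| : ℝ) : ℂ) *
            (star (PL.1 (lcuState ℓ j k) fun _ => false) * PR.1 (lcuState ℓ j k) fun _ => false)) *
            ((M : ℂ) * coreMat I (mainState J (lcuState ℓ j k))
              (mainState K (lcuState ℓ j k))) := by
            rw [Complex.ofReal_mul, Complex.ofReal_natCast]
            ring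
        _ = _ := by
          rw [h2, h3, Finset.mul_sum]
          refine Finset.sum_congr rfl fun e _ => ?_
          rw [mul_ite, mul_zero, Complex.ofReal_mul]
    rw [Finset.sum_congr rfl fun a _ => h1 a, Finset.sum_comm]
    refine Finset.sum_congr rfl fun e _ => ?_
    rw [Fintype.sum_prod_type, Finset.sum_comm, Fintype.sum_prod_type]
    refine Finset.sum_congr rfl fun j _ => Finset.sum_congr rfl fun k _ => ?_
    split_ifs with h
    · rw [Complex.ofReal_sum]
    · exact Finset.sum_const_zero
  · intro s hs
    rw [hP.2 s fun ℓ j k h => hs ⟨(ℓ, j, k), h.symm⟩, zero_mul]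
  · exact fun _ => rfl

end Entries

/-! ## The circuit of the block-encoding -/

section Circuit

open MainWire Polynomial

variable {d n p G M : ℕ} {PL PR : Matrix.unitaryGroup (LCUWires d p G → Bool) ℂ}

/-- The system wires are placed on the system, the flag is placed on an ancilla, and all other
wires are placed on work qubits. -/
def placeWire {W : Type} {a w : ℕ} (ha : 0 < a) (φ : MainWire d n p G M ⊕ W ≃ Fin w) :
    MainWire d n p G M ⊕ W → Wires d n a w
  | .inl (sys i r) => .inl (i, r)
  | .inl flag => .inr (.inl ⟨0, ha⟩)
  | q => .inr (.inr (φ q))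

lemma placeWire_of_isChecked {W : Type} {a w : ℕ} (ha : 0 < a)
    (φ : MainWire d n p G M ⊕ W ≃ Fin w) {q : MainWire d n p G M} (hq : isChecked q = true) :
    placeWire ha φ (.inl q) = .inr (.inr (φ (.inl q))) := by
  cases q <;> first | rfl | simp [isChecked] at hq

lemma placeWire_injective {W : Type} {a w : ℕ} (ha : 0 < a)
    (φ : MainWire d n p G M ⊕ W ≃ Fin w) : Function.Injective (placeWire ha φ) := by
  intro q q' h
  rcases q with (_ | _ | _ | _ | _ | _ | _ | _ | _ | _ | _) | _ <;>
  rcases q' with (_ | _ | _ | _ | _ | _ | _ | _ | _ | _ | _) | _ <;>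
  simp_all [placeWire]

/-- An operator on the main wires that returns the checked wires clean yields a circuit on the
system, the ancilla qubits and the work qubits. -/
theorem Impl.exists_circuit
    {A : Matrix (MainWire d n p G M → Bool) (MainWire d n p G M → Bool) ℂ} {k m : ℕ}
    (h : Impl PL PR A k m) (hA : ∀ x y, x flag = false → y flag = false →
      (∃ q, isChecked q = true ∧ x q = true) → A x y = 0) {a : ℕ} (ha : 0 < a) :
    ∃ (w : ℕ) (c : List (Gate (LCUWires d p G) (Wires d n a w))), c.length ≤ k ∧
      queryCount c ≤ m ∧
      (∀ (J K : Fin d → Fin (2 ^ n)) (z : Fin w → Bool), z ≠ (fun _ => false) →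
        circuitMat PL PR c (basisState J z) (basisState K fun _ => false) = 0) ∧
      ∀ J K, topBlock (circuitMat PL PR c) J K =
        A (mainState J fun _ => false) (mainState K fun _ => false) := by
  obtain ⟨W, _, _, c, hk, hm, hc⟩ := h
  set φ := Fintype.equivFin (MainWire d n p G M ⊕ W)
  set r : MainWire d n p G M ⊕ W ↪ Wires d n a _ := ⟨placeWire ha φ, placeWire_injective ha φ⟩
  have hK : ∀ K : Fin d → Fin (2 ^ n),
      basisState K (fun _ => false) ∘ r = withZero W (mainState K fun _ => false) := by
    intro K
    funext q
    rcases q with (_ | _ | _ | _ | _ | _ | _ | _ | _ | _ | _) | _ <;> rfl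
  refine ⟨_, c.map (Gate.map r), by rwa [List.length_map], by rwa [queryCount_map], ?_, ?_⟩
  · intro J K z hz
    rw [circuitMat_map]
    by_contra h0
    have hoff := agree_of_actOn_ne_zero h0
    rw [actOn_apply_of_agree _ hoff, hK, hc] at h0
    have hW : (basisState J z ∘ r) ∘ Sum.inr = fun _ => false := by
      by_contra h1
      exact h0 (if_neg h1)
    rw [if_pos hW] at h0
    -- A checked wire that is not zero at the end would have set the flag; so it is zero whenever
    -- the ancilla qubits are.
    have hch : ∀ q, isChecked q = true → z (φ (.inl q)) = false := by
      intro q hq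
      by_contra h1
      refine h0 (hA _ _ rfl rfl ⟨q, hq, ?_⟩)
      have h2 : r (.inl q) = .inr (.inr (φ (.inl q))) := placeWire_of_isChecked ha φ hq
      have h3 : (basisState J z ∘ r) (.inl q) = z (φ (.inl q)) := by
        rw [Function.comp_apply, h2]; rfl
      exact h3.trans (by simpa using h1)
    apply hz
    funext v
    obtain ⟨q, rfl⟩ := φ.surjective v
    rcases q with q | v
    · by_cases hq : isChecked q = true
      · exact hch q hq
      -- The equivalence `φ` numbers all wires, including the system and the flag, which are placed
      -- elsewhere. Their places among the work qubits stay idle and keep the value `0`.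
      · refine hoff (.inr (.inr (φ (.inl q)))) ?_
        rintro ⟨q', hq'⟩
        have h1 : q' = .inl q := by
          rcases q' with (_ | _ | _ | _ | _ | _ | _ | _ | _ | _ | _) | _ <;>
          first
          | exact φ.injective (Sum.inr.inj (Sum.inr.inj hq'))
          | cases hq'
        subst h1
        cases q <;> first | exact hq rfl | cases hq'
    · exact congrFun hW v
  · intro J K
    have hagree : ∀ q, q ∉ Set.range r →
        basisState J (fun _ => false) q = basisState K (fun _ => false) q := by
      intro q hq
      rcases q with ⟨i, t⟩ | q | q
      · exact absurd ⟨.inl (sys i t), rfl⟩ hq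
      · rfl
      · rfl
    rw [topBlock, circuitMat_map, actOn_apply_of_agree _ hagree, hK, hK, hc]
    exact if_pos rfl

/-- `3908 = 4 * (431 + 431 + 115)` for the link, end and move masks; the factor `21` is one for each
of these and the copy mask and `17` for the flag; `14` contains the two queries. -/
lemma Impl.blockMat (hp : 0 < p) (hn : 0 < n)
    {I : Matrix (MainWire d n p G M → Bool) (MainWire d n p G M → Bool) ℂ} {k : ℕ}
    (hI : Impl PL PR I k 0) :
    Impl PL PR (QuFEM.blockMat PL PR I)
      (k + 3908 * (d * (n * p ^ 2)) + 4 * (d * n) + 21 * Fintype.card (MainWire d n p G M) + 14)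
      2 := by
  have hcore : basisMap (QuFEM.coreMap (d := d) (n := n) (p := p) (G := G) (M := M)) =
      basisMap (QuFEM.applyMask QuFEM.copyMask) * basisMap (QuFEM.applyMask QuFEM.moveMask) *
        basisMap (QuFEM.applyMask QuFEM.endsMask) := by
    rw [basisMap_mul, basisMap_mul]; rfl
  have h1 : d * (115 * (n * p ^ 2)) = 115 * (d * (n * p ^ 2)) := by ring
  have h2 : d * (431 * (n * p ^ 2)) = 431 * (d * (n * p ^ 2)) := by ring
  rw [QuFEM.blockMat, QuFEM.coreMat, hcore]
  exact (Impl.flagMask.mul (((Impl.prepLAdj lcuEmb).mul ((((Impl.copyMask.mul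
    (Impl.moveMask hp hn)).mul (Impl.endsMask hp hn)).mul hI).mul (Impl.linkMask hp hn))).mul
      (Impl.prepR lcuEmb))).mono (by rw [h1, h2]; omega) (by omega)

/-- The estimate of the total number of gates. -/
lemma cost_le {d n p D G c : ℕ} (hd : 0 < d) (hn : 0 < n) (hp : 0 < p) (hD : 0 < D) (hG : 0 < G)
    (hc : c ≤ d * (5 * n + (Nat.clog 2 G + Nat.clog 2 ((p + 1) ^ 2)) + G + 2) + D ^ (d - 1) + 1) :
    2 * D ^ (d - 1) + d * (3 * (D - 1) * (138 * G + 122 * n + 90) +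
        (2 * (D - 1) + 1) * (84 * D ^ (d - 1) + 18)) +
      3908 * (d * (n * p ^ 2)) + 4 * (d * n) + 21 * c + 14 ≤
    4000 * (d * n * (D ^ d * G ^ d + p ^ (2 * d) * Nat.clog 2 (p + 1))) := by
  have hm : 1 ≤ Nat.clog 2 (p + 1) := Nat.clog_pos one_lt_two (by omega)
  -- There are `D^(d-1)` phase choices in each of about `2 D` rotations, and this product gives the
  -- power `D^d`.
  have hMD : D ^ (d - 1) * D = D ^ d := by rw [← pow_succ, Nat.sub_add_cancel hd]
  have hGd : G ≤ G ^ d := Nat.le_self_pow hd.ne' G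
  have hDd : D ≤ D ^ d := Nat.le_self_pow hd.ne' D
  have hG1 : 1 ≤ G ^ d := Nat.one_le_pow _ _ hG
  have hD1 : 1 ≤ D ^ d := Nat.one_le_pow _ _ hD
  set X := D ^ d * G ^ d with hX
  set Y := p ^ (2 * d) * Nat.clog 2 (p + 1) with hY
  set M := D ^ (d - 1)
  have hX1 : 1 ≤ X := Nat.mul_pos hD1 hG1
  have hDG : D * G ≤ X := Nat.mul_le_mul hDd hGd
  have hDX : D ≤ X := hDd.trans (Nat.le_mul_of_pos_right _ hG1)
  have hGX : G ≤ X := hGd.trans (Nat.le_mul_of_pos_left _ hD1)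
  have hMDX : M * D ≤ X := hMD.le.trans (Nat.le_mul_of_pos_right _ hG1)
  have hMX : M ≤ X := (Nat.le_mul_of_pos_right _ hD).trans hMDX
  have hpY : p ^ 2 ≤ Y := (Nat.pow_le_pow_right hp (by omega)).trans (Nat.le_mul_of_pos_right _ hm)
  have hclogG : Nat.clog 2 G ≤ G :=
    Nat.clog_le_of_le_pow Nat.lt_two_pow_self.le
  have hclogp : Nat.clog 2 ((p + 1) ^ 2) ≤ 4 * Y := by
    have h1 : Nat.clog 2 ((p + 1) ^ 2) ≤ (p + 1) ^ 2 :=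
      Nat.clog_le_of_le_pow Nat.lt_two_pow_self.le
    have h2 : p ≤ p ^ 2 := Nat.le_self_pow two_ne_zero p
    have h3 : (p + 1) ^ 2 = p ^ 2 + 2 * p + 1 := by ring
    omega
  have hdn : 1 ≤ d * n := Nat.mul_pos hd hn
  have hddn : d ≤ d * n := Nat.le_mul_of_pos_right _ hn
  have hle : ∀ t, t ≤ d * n * t := fun t => Nat.le_mul_of_pos_left _ hdn
  have e1 : 2 * M ≤ d * n * (2 * X) := (Nat.mul_le_mul_left 2 hMX).trans (hle _)
  have e2 : d * (3 * (D - 1) * (138 * G + 122 * n + 90)) ≤ d * n * (1050 * X) := by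
    have h1 : (D - 1) * (138 * G + 122 * n + 90) ≤ n * (350 * X) := by
      calc (D - 1) * (138 * G + 122 * n + 90) ≤ D * (138 * G + 122 * n + 90) :=
            Nat.mul_le_mul_right _ (Nat.sub_le _ _)
        _ = 138 * (D * G) + D * (122 * n + 90) := by ring
        _ ≤ 138 * (n * X) + X * (122 * n + 90 * n) := by
            refine Nat.add_le_add (Nat.mul_le_mul_left _
              (hDG.trans (Nat.le_mul_of_pos_left _ hn))) (Nat.mul_le_mul hDX (by omega))
        _ = n * (350 * X) := by ring
    calc _ = d * 3 * ((D - 1) * (138 * G + 122 * n + 90)) := by ring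
      _ ≤ d * 3 * (n * (350 * X)) := Nat.mul_le_mul_left _ h1
      _ = _ := by ring
  have e3 : d * ((2 * (D - 1) + 1) * (84 * M + 18)) ≤ d * n * (204 * X) := by
    have h1 : (2 * (D - 1) + 1) * (84 * M + 18) ≤ 204 * X := by
      calc (2 * (D - 1) + 1) * (84 * M + 18) ≤ 2 * D * (84 * M + 18) :=
            Nat.mul_le_mul_right _ (by omega)
        _ = 168 * (M * D) + 36 * D := by ring
        _ ≤ _ := by omega
    exact Nat.mul_le_mul hddn h1
  have e4 : 3908 * (d * (n * p ^ 2)) ≤ d * n * (3908 * Y) := by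
    calc _ = d * n * (3908 * p ^ 2) := by ring
      _ ≤ _ := Nat.mul_le_mul_left _ (Nat.mul_le_mul_left _ hpY)
  have e5 : c ≤ d * n * (11 * X + 4 * Y) := by
    have h1 : 5 * n + (Nat.clog 2 G + Nat.clog 2 ((p + 1) ^ 2)) + G + 2 ≤ n * (9 * X + 4 * Y) := by
      calc _ ≤ 5 * n + 2 * X + 4 * Y + 2 := by omega
        _ ≤ n * (5 * X) + n * (2 * X) + n * (4 * Y) + n * (2 * X) := by
            have a1 : n * 5 ≤ n * (5 * X) := Nat.mul_le_mul_left _ (by omega)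
            have a2 : ∀ t, t ≤ n * t := fun t => Nat.le_mul_of_pos_left _ hn
            have := a2 (2 * X)
            have := a2 (4 * Y)
            omega
        _ = _ := by ring
    have h2 := Nat.mul_le_mul_left d h1
    have h3 : M + 1 ≤ d * n * (2 * X) := (by omega : M + 1 ≤ 2 * X).trans (hle _)
    calc c ≤ d * (n * (9 * X + 4 * Y)) + d * n * (2 * X) := by omega
      _ = _ := by ring
  have e6 : 4 * (d * n) ≤ d * n * (4 * X) := by
    rw [mul_comm 4]; exact Nat.mul_le_mul_left _ (by omega)
  have e7 : 14 ≤ d * n * (14 * X) := (by omega : 14 ≤ 14 * X).trans (hle _)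
  calc _ ≤ d * n * (2 * X) + (d * n * (1050 * X) + d * n * (204 * X)) + d * n * (3908 * Y) +
        d * n * (4 * X) + 21 * (d * n * (11 * X + 4 * Y)) + d * n * (14 * X) := by
        rw [Nat.mul_add d]
        omega
    _ = d * n * (1505 * X + 3992 * Y) := by ring
    _ ≤ d * n * (4000 * (X + Y)) := Nat.mul_le_mul_left _ (by omega)
    _ = _ := by ring

end Circuit

/-! ## Block-encodings of arrays that are weighted with a polynomial -/

section Main

open Polynomial

variable {d n p E G D : ℕ}

lemma assemble_sub (a b : (Fin d → Fin E) → (Fin d → Fin (p + 1)) → (Fin d → Fin (p + 1)) → ℝ) :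
    assemble n a - assemble n b = assemble n fun e j k => a e j k - b e j k := by
  ext J K
  simp only [assemble, Matrix.sub_apply, ← Finset.sum_sub_distrib]
  refine Finset.sum_congr rfl fun e _ => Finset.sum_congr rfl fun j _ =>
    Finset.sum_congr rfl fun k _ => ?_
  split_ifs <;> simp

lemma smul_assemble (r : ℝ)
    (a : (Fin d → Fin E) → (Fin d → Fin (p + 1)) → (Fin d → Fin (p + 1)) → ℝ) :
    (r : ℂ) • assemble n a = assemble n fun e j k => r * a e j k := by
  ext J K
  simp only [assemble, Matrix.smul_apply, smul_eq_mul, Finset.mul_sum, mul_ite, mul_zero,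
    Complex.ofReal_mul]

lemma assemble_zero :
    assemble n (fun (_ : Fin d → Fin E) (_ _ : Fin d → Fin (p + 1)) => (0 : ℝ)) = 0 := by
  ext J K
  simp [assemble]

/-- The circuit for coefficients with a state-preparation pair and a polynomial bounded by one. -/
theorem exists_polynomial_blockEncoding (hd : 0 < d) (hp : 0 < p) (hE : E * p + 1 = 2 ^ n)
    (hE0 : 0 < E) (hG : 0 < G) {q : MvPolynomial (Fin d) ℝ} (hq : ∀ i, q.degreeOf i < D)
    (hb : ∀ x ∈ unitCube d, |MvPolynomial.eval x q| ≤ 1)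
    {PL PR : Matrix.unitaryGroup (LCUWires d p G → Bool) ℂ}
    {y : (Fin d → Fin G) → (Fin d → Fin (p + 1)) → (Fin d → Fin (p + 1)) → ℝ}
    (hP : IsStatePrepPair PL PR y) {a : ℕ} (ha : 0 < a) :
    ∃ (w : ℕ) (c : List (Gate (LCUWires d p G) (Wires d n a w))),
      c.length ≤ 4000 * (d * n * (D ^ d * G ^ d + p ^ (2 * d) * Nat.clog 2 (p + 1))) ∧
      queryCount c ≤ 2 ∧
      (∀ (J K : Fin d → Fin (2 ^ n)) (z : Fin w → Bool), z ≠ (fun _ => false) →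
        circuitMat PL PR c (basisState J z) (basisState K fun _ => false) = 0) ∧
      (((D : ℝ) ^ (d - 1) * ∑ ℓ, ∑ j, ∑ k, |y ℓ j k| : ℝ) : ℂ) • topBlock (circuitMat PL PR c) =
        assemble n fun (e : Fin d → Fin E) j k =>
          ∑ ℓ, y ℓ j k * MvPolynomial.eval (quadPoint e ℓ) q := by
  have hn : 0 < n := by
    rcases Nat.eq_zero_or_pos n with rfl | h
    · have := Nat.mul_pos hE0 hp
      omega
    · exact h
  obtain ⟨d', rfl⟩ : ∃ d', d = d' + 1 := ⟨d - 1, by omega⟩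
  have hD : 0 < D := lt_of_le_of_lt (Nat.zero_le _) (hq 0)
  obtain ⟨P, hdeg, hPb, heval⟩ := exists_sum_prod_eq q hq hb
  set σ : Fin (D ^ d') ≃ (Fin d' → Fin D) := finFunctionFinEquiv.symm
  obtain ⟨I, hI, hImpl, hIval⟩ := exists_polynomial_circuit (d := d' + 1) (n := n) (p := p)
    (G := G) (M := D ^ d') PL PR hn hG (pow_pos hD _) (N := D - 1) (P := fun a => P (σ a))
    (fun a i => Nat.le_sub_one_of_lt (hdeg _ i)) (fun a i => hPb _ i) (unitNode_mem G)
  obtain ⟨w, c, h1, h2, h3, h4⟩ := (Impl.blockMat hp hn hImpl).exists_circuit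
    (fun x y hx hy h => blockMat_apply_eq_zero hI PL PR hx hy h) ha
  refine ⟨w, c, h1.trans (cost_le hd hn hp hD hG MainWire.card_le), h2, h3, ?_⟩
  ext J K
  rw [Matrix.smul_apply, h4, smul_eq_mul, ← blockMat_eq_assemble hE hp hE0 hI
    (g := fun x => MvPolynomial.eval x q) (fun κ ℓ A B hκ hℓ hA hB
    hl hr => ?_) hP J K]
  · simp
  · rw [hIval κ ℓ A B hκ hℓ hA hB hl hr, heval,
      ← Equiv.sum_comp σ fun a => ∏ i, (P a i).eval _]

/-- A circuit of a single gate that encodes the zero matrix. -/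
lemma exists_zero_blockEncoding (PL PR : Matrix.unitaryGroup (LCUWires d p G → Bool) ℂ) {a : ℕ}
    (ha : 0 < a) :
    ∃ (w : ℕ) (c : List (Gate (LCUWires d p G) (Wires d n a w))),
      c.length = 1 ∧ queryCount c = 0 ∧
      (∀ (J K : Fin d → Fin (2 ^ n)) (z : Fin w → Bool), z ≠ (fun _ => false) →
        circuitMat PL PR c (basisState J z) (basisState K fun _ => false) = 0) ∧
      topBlock (circuitMat PL PR c) = 0 := by
  -- Flipping one ancilla makes every amplitude with all ancilla qubits zero vanish.
  have h0 : ∀ (J K : Fin d → Fin (2 ^ n)) (z : Fin 0 → Bool),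
      circuitMat PL PR [Gate.single (.inr (.inl ⟨0, ha⟩)) pauliX]
        (basisState J z) (basisState K fun _ => false) = 0 := by
    intro J K z
    rw [circuitMat_singleton, mat_pauliX, basisMap, if_neg]
    intro h
    have h1 := congrFun h (.inr (.inl ⟨0, ha⟩))
    simp [basisState] at h1
  exact ⟨0, _, rfl, rfl, fun J K z _ => h0 J K z, by ext J K; exact h0 J K _⟩

/-- Blocks that agree with an array up to elementwise errors. -/
lemma isBlockEncoding_of_le (hp : 0 < p) {a w : ℕ} {α ε : ℝ}
    {U : Matrix (Wires d n a w → Bool) (Wires d n a w → Bool) ℂ}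
    (hU : U ∈ Matrix.unitaryGroup (Wires d n a w → Bool) ℂ) (hα : 0 < α)
    (hz : ∀ (J K : Fin d → Fin (2 ^ n)) (z : Fin w → Bool), z ≠ (fun _ => false) →
      U (basisState J z) (basisState K fun _ => false) = 0)
    {a₀ a₁ : (Fin d → Fin E) → (Fin d → Fin (p + 1)) → (Fin d → Fin (p + 1)) → ℝ}
    (h₀ : (α : ℂ) • topBlock U = assemble n a₀)
    {b : (Fin d → Fin (p + 1)) → (Fin d → Fin (p + 1)) → ℝ} (hb : ∀ j k, 0 ≤ b j k)
    (hab : ∀ e j k, |a₁ e j k - a₀ e j k| ≤ b j k) (hε : ∑ j, ∑ k, b j k ≤ ε) :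
    IsBlockEncoding α ε U (assemble n a₁) := by
  refine ⟨hU, hα, hz, ?_⟩
  rw [h₀, assemble_sub]
  exact (norm_assemble_le hp _ b hab hb).trans hε

end Main

/-! ### The norm of the coefficient vector -/

section Coefficients

variable {d p E G : ℕ} {V : Submodule ℝ ((Fin d → ℝ) → ℝ)}
  {B : V →ₗ[ℝ] V →ₗ[ℝ] ((Fin d → ℝ) → ℝ)}
  {hV : ∀ (e : Fin d → Fin E) (j : Fin d → Fin (p + 1)), elemBasis p e j ∈ V}

lemma sum_const_nodes (r : ℝ) :
    ∑ _j : Fin d → Fin (p + 1), ∑ _k : Fin d → Fin (p + 1), r = ((p : ℝ) + 1) ^ (2 * d) * r := by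
  simp only [Finset.sum_const, Finset.card_univ, Fintype.card_pi, Fintype.card_fin,
    Finset.prod_const, nsmul_eq_mul]
  push_cast
  ring

/-- The norm of the coefficients is bounded by the integrals of the absolute values. -/
lemma sum_abs_quadCoeff_le {e : Fin d → Fin E} {η : ℝ}
    (h : ∀ j k, abs ((∫ x in element e, |basisForm B hV e j k x|) -
      ∑ ℓ : Fin d → Fin G, quadWeight E ℓ * |basisForm B hV e j k (quadPoint e ℓ)|) ≤ η) :
    ∑ ℓ, ∑ j, ∑ k, |quadCoeff G B hV e ℓ j k| ≤
      absMass B hV e + ((p : ℝ) + 1) ^ (2 * d) * η := by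
  rw [← sum_const_nodes, absMass, ← Finset.sum_add_distrib, Finset.sum_comm]
  refine Finset.sum_le_sum fun j _ => ?_
  rw [← Finset.sum_add_distrib, Finset.sum_comm]
  refine Finset.sum_le_sum fun k _ => ?_
  -- Nonnegative weights pass through the absolute value, so the sum is the quadrature of the
  -- absolute values of the form.
  have h1 : ∀ ℓ, |quadCoeff G B hV e ℓ j k| =
      quadWeight E ℓ * |basisForm B hV e j k (quadPoint e ℓ)| := fun ℓ => by
    rw [quadCoeff, abs_mul, abs_of_nonneg (quadWeight_nonneg E ℓ)]
  rw [Finset.sum_congr rfl fun ℓ _ => h1 ℓ]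
  linarith [(abs_le.1 (h j k)).1]

end Coefficients

end QuFEM

end

/-! ### The main theorem -/

theorem theorem4p2 :
    ∃ C : ℝ, 0 < C ∧
      -- dimension, qubits per direction, order, elements per direction, Gauss points, degree
      ∀ d n p E G D : ℕ, 0 < d → 0 < p → E * p + 1 = 2 ^ n → 0 < G →
      -- the bilinear map `B`, defined on a space of functions that has the basis functions
      ∀ (V : Submodule ℝ ((Fin d → ℝ) → ℝ))
        (hV : ∀ (e : Fin d → Fin E) (j : Fin d → Fin (p + 1)), QuFEM.elemBasis p e j ∈ V)
        (B : V →ₗ[ℝ] V →ₗ[ℝ] ((Fin d → ℝ) → ℝ)),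
      (∀ u v : V, IntegrableOn (B u v) (QuFEM.unitCube d)) →
      -- the basis function evaluations at the quadrature points are constant
      (∀ (e e' : Fin d → Fin E) (j k : Fin d → Fin (p + 1)) (ℓ : Fin d → Fin G),
        QuFEM.basisForm B hV e j k (QuFEM.quadPoint e ℓ) =
          QuFEM.basisForm B hV e' j k (QuFEM.quadPoint e' ℓ)) →
      ∀ e₀ : Fin d → Fin E, 0 < QuFEM.absMass B hV e₀ →
      ∀ f : (Fin d → ℝ) → ℝ,
        AEStronglyMeasurable f (volume.restrict (QuFEM.unitCube d)) → 0 < QuFEM.supNorm f →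
      -- `f` is approximated by a polynomial of degree less than `D` in each variable
      ∀ (q : MvPolynomial (Fin d) ℝ) (ε : ℝ), (∀ i, q.degreeOf i < D) →
        (∀ x ∈ QuFEM.unitCube d, |f x - MvPolynomial.eval x q| ≤ ε) →
      -- tolerances for the numerical integration of `f B` and of `|B|`
      ∀ δ η : ℝ,
        (∀ e j k, |QuFEM.elemArray B hV f e j k - QuFEM.quadArray G B hV f e j k| ≤ δ) →
        (∀ j k, abs ((∫ x in QuFEM.element e₀, abs (QuFEM.basisForm B hV e₀ j k x)) -
          ∑ ℓ : Fin d → Fin G, QuFEM.quadWeight E ℓ *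
            abs (QuFEM.basisForm B hV e₀ j k (QuFEM.quadPoint e₀ ℓ))) ≤ η) →
      -- access to a state-preparation pair for the precomputed LCU coefficients
      ∀ PL PR : Matrix.unitaryGroup (QuFEM.LCUWires d p G → Bool) ℂ,
        QuFEM.IsStatePrepPair PL PR (QuFEM.quadCoeff G B hV e₀) →
      ∃ (w : ℕ)
        (c : List (QuFEM.Gate (QuFEM.LCUWires d p G)
          (QuFEM.Wires d n
            (d * (Nat.clog 2 n + Nat.clog 2 G + Nat.clog 2 ((p + 1) ^ 2) + 3)) w)))
        (α : ℝ),
        α ≤ ((D : ℝ) + 2) ^ (d - 1) * QuFEM.supNorm f *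
          (QuFEM.absMass B hV e₀ + ((p : ℝ) + 1) ^ (2 * d) * η) ∧
        (c.length : ℝ) ≤ C * (d * n * ((D : ℝ) ^ d * (G : ℝ) ^ d +
          (p : ℝ) ^ (2 * d) * (Nat.clog 2 (p + 1) : ℝ))) ∧
        QuFEM.queryCount c ≤ 2 ∧
        QuFEM.IsBlockEncoding α
          (2 * ε * (QuFEM.absMass B hV e₀ + ((p : ℝ) + 1) ^ (2 * d) * η))
          (QuFEM.circuitMat PL PR c)
          (QuFEM.assemble n (QuFEM.quadArray G B hV f)) ∧
        QuFEM.IsBlockEncoding α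
          (2 * ε * (QuFEM.absMass B hV e₀ + ((p : ℝ) + 1) ^ (2 * d) * η) +
            ((p : ℝ) + 1) ^ (2 * d) * δ)
          (QuFEM.circuitMat PL PR c)
          (QuFEM.assemble n (QuFEM.elemArray B hV f)) := by
  refine ⟨4000, by norm_num, ?_⟩
  intro d n p E G D hd hp hE hG V hV B _ hB e₀ hS f _ hF q ε hq hfq δ η hδ hη PL PR hP
  have hE0 : 0 < E := (e₀ ⟨0, hd⟩).pos
  have hD : 0 < D := lt_of_le_of_lt (Nat.zero_le _) (hq ⟨0, hd⟩)
  have hn : 0 < n := by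
    rcases Nat.eq_zero_or_pos n with rfl | h
    · have := Nat.mul_pos hE0 hp
      omega
    · exact h
  have hε : 0 ≤ ε := (abs_nonneg _).trans (hfq 0 ⟨le_rfl, zero_le_one⟩)
  have hη0 : 0 ≤ η := (abs_nonneg _).trans (hη 0 0)
  have hδ0 : 0 ≤ δ := (abs_nonneg _).trans (hδ e₀ 0 0)
  set F := QuFEM.supNorm f
  set y := QuFEM.quadCoeff G B hV e₀ with hy
  set β := ∑ ℓ, ∑ j, ∑ k, |y ℓ j k| with hβ
  set T := QuFEM.absMass B hV e₀ + ((p : ℝ) + 1) ^ (2 * d) * η with hT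
  have hβT : β ≤ T := QuFEM.sum_abs_quadCoeff_le hη
  have hT0 : 0 < T := by positivity
  have hβ0 : 0 ≤ β := Finset.sum_nonneg fun _ _ => Finset.sum_nonneg fun _ _ =>
    Finset.sum_nonneg fun _ _ => abs_nonneg _
  have hFε : 0 < F + ε := by positivity
  have hyB : ∀ e ℓ j k, QuFEM.quadCoeff G B hV e ℓ j k = y ℓ j k := fun e ℓ j k => by
    rw [hy, QuFEM.quadCoeff, QuFEM.quadCoeff, hB e e₀]
  have hqb := QuFEM.abs_eval_le_supNorm_add hF hfq
  -- The polynomial is divided by `F + ε`, its bound on the cube, but multiplied back by `F` only.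
  -- This keeps `ε` out of the normalization and adds the error `ε |r| ≤ ε` to the approximation
  -- error.
  set r : MvPolynomial (Fin d) ℝ := MvPolynomial.C (F + ε)⁻¹ * q with hr
  have hreval : ∀ x, MvPolynomial.eval x r = (F + ε)⁻¹ * MvPolynomial.eval x q := fun x => by
    rw [hr, map_mul, MvPolynomial.eval_C]
  have hrdeg : ∀ i, r.degreeOf i < D := fun i =>
    (MvPolynomial.degreeOf_C_mul_le q i _).trans_lt (hq i)
  have hrb : ∀ x ∈ QuFEM.unitCube d, |MvPolynomial.eval x r| ≤ 1 := fun x hx => by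
    rw [hreval, abs_mul, abs_inv, abs_of_pos hFε, inv_mul_le_iff₀ hFε, mul_one]
    exact hqb x hx
  have hfr : ∀ x ∈ QuFEM.unitCube d, |f x - F * MvPolynomial.eval x r| ≤ 2 * ε := fun x hx => by
    have h1 : f x - F * MvPolynomial.eval x r =
        (f x - MvPolynomial.eval x q) + ε * MvPolynomial.eval x r := by
      rw [hreval]
      field_simp
      ring
    rw [h1]
    refine (abs_add_le _ _).trans ?_
    rw [abs_mul, abs_of_nonneg hε]
    nlinarith [hfq x hx, hrb x hx]
  set a := d * (Nat.clog 2 n + Nat.clog 2 G + Nat.clog 2 ((p + 1) ^ 2) + 3) with ha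
  have ha0 : 0 < a := Nat.mul_pos hd (by omega)
  have hDpow : (D : ℝ) ^ (d - 1) ≤ ((D : ℝ) + 2) ^ (d - 1) := by
    gcongr
    linarith
  obtain ⟨w, c, α, hα0, hα, hlen, hquery, hz, htop⟩ : ∃ (w : ℕ)
      (c : List (QuFEM.Gate (QuFEM.LCUWires d p G) (QuFEM.Wires d n a w))) (α : ℝ), 0 < α ∧
      α ≤ ((D : ℝ) + 2) ^ (d - 1) * F * T ∧
      c.length ≤ 4000 * (d * n * (D ^ d * G ^ d + p ^ (2 * d) * Nat.clog 2 (p + 1))) ∧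
      QuFEM.queryCount c ≤ 2 ∧
      (∀ (J K : Fin d → Fin (2 ^ n)) (z : Fin w → Bool), z ≠ (fun _ => false) →
        QuFEM.circuitMat PL PR c (QuFEM.basisState J z)
          (QuFEM.basisState K fun _ => false) = 0) ∧
      (α : ℂ) • QuFEM.topBlock (QuFEM.circuitMat PL PR c) =
        QuFEM.assemble n fun (e : Fin d → Fin E) j k =>
          ∑ ℓ, y ℓ j k * (F * MvPolynomial.eval (QuFEM.quadPoint e ℓ) r) := by
    -- If all coefficients vanish, the natural normalization would be zero, which is not allowed.
    -- The zero block is then encoded with the upper bound itself as `α`.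
    rcases hβ0.eq_or_lt with h | h
    · obtain ⟨w, c, h1, h2, h3, h4⟩ := QuFEM.exists_zero_blockEncoding (n := n) PL PR ha0
      have hy0 : ∀ ℓ j k, y ℓ j k = 0 := by
        intro ℓ j k
        have e1 := (Finset.sum_eq_zero_iff_of_nonneg fun ℓ _ => Finset.sum_nonneg fun j _ =>
          Finset.sum_nonneg fun k _ => abs_nonneg (y ℓ j k)).1 h.symm ℓ (Finset.mem_univ _)
        have e2 := (Finset.sum_eq_zero_iff_of_nonneg fun j _ =>
          Finset.sum_nonneg fun k _ => abs_nonneg (y ℓ j k)).1 e1 j (Finset.mem_univ _)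
        exact abs_eq_zero.1 ((Finset.sum_eq_zero_iff_of_nonneg fun k _ =>
          abs_nonneg (y ℓ j k)).1 e2 k (Finset.mem_univ _))
      refine ⟨w, c, _, ?_, le_rfl, ?_, by omega, h3, ?_⟩
      · positivity
      · rw [h1]
        have h5 : 0 < d * n * (D ^ d * G ^ d + p ^ (2 * d) * Nat.clog 2 (p + 1)) :=
          Nat.mul_pos (Nat.mul_pos hd hn) (Nat.add_pos_left
            (Nat.mul_pos (pow_pos hD _) (pow_pos hG _)) _)
        omega
      · rw [h4, smul_zero, ← QuFEM.assemble_zero (p := p) (E := E)]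
        congr 1
        funext e j k
        exact (Finset.sum_eq_zero fun ℓ _ => by rw [hy0, zero_mul]).symm
    · obtain ⟨w, c, h1, h2, h3, h4⟩ :=
        QuFEM.exists_polynomial_blockEncoding hd hp hE hE0 hG hrdeg hrb hP ha0
      -- The normalization is the product of the scale `F`, the number `D^(d-1)` of products and the
      -- norm `β` of the coefficients.
      refine ⟨w, c, F * ((D : ℝ) ^ (d - 1) * β), ?_, ?_, h1, h2, h3, ?_⟩
      · have hD' : (0 : ℝ) < D := by exact_mod_cast hD
        positivity
      · calc F * ((D : ℝ) ^ (d - 1) * β) ≤ F * (((D : ℝ) + 2) ^ (d - 1) * T) := by gcongr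
          _ = _ := by ring
      · rw [Complex.ofReal_mul, mul_smul, h4, QuFEM.smul_assemble]
        congr 1
        funext e j k
        rw [Finset.mul_sum]
        exact Finset.sum_congr rfl fun ℓ _ => by ring
  have herr : ∀ e j k, |QuFEM.quadArray G B hV f e j k -
      ∑ ℓ, y ℓ j k * (F * MvPolynomial.eval (QuFEM.quadPoint e ℓ) r)| ≤
        2 * ε * ∑ ℓ, |y ℓ j k| := by
    intro e j k
    rw [QuFEM.quadArray, ← Finset.sum_sub_distrib, Finset.mul_sum]
    refine (Finset.abs_sum_le_sum_abs _ _).trans (Finset.sum_le_sum fun ℓ _ => ?_)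
    rw [hyB, ← mul_sub, abs_mul, mul_comm]
    exact mul_le_mul_of_nonneg_right (hfr _ (QuFEM.quadPoint_mem e ℓ)) (abs_nonneg _)
  have hsum : ∑ j : Fin d → Fin (p + 1), ∑ k : Fin d → Fin (p + 1),
      2 * ε * ∑ ℓ, |y ℓ j k| = 2 * ε * β := by
    have h1 : β = ∑ j, ∑ k, ∑ ℓ, |y ℓ j k| :=
      Finset.sum_comm.trans (Finset.sum_congr rfl fun _ _ => Finset.sum_comm)
    simp only [h1, Finset.mul_sum]
  have hεβ : 2 * ε * β ≤ 2 * ε * T := by gcongr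
  have hnonneg : ∀ j k, 0 ≤ 2 * ε * ∑ ℓ, |y ℓ j k| := fun j k =>
    mul_nonneg (by positivity) (Finset.sum_nonneg fun _ _ => abs_nonneg _)
  have hU := QuFEM.circuitMat_mem_unitary PL PR c
  refine ⟨w, c, α, hα, by exact_mod_cast hlen, hquery,
    QuFEM.isBlockEncoding_of_le hp hU hα0 hz htop hnonneg herr (hsum.le.trans hεβ),
    QuFEM.isBlockEncoding_of_le hp hU hα0 hz htop
      (b := fun j k => 2 * ε * ∑ ℓ, |y ℓ j k| + δ)
      (fun j k => add_nonneg (hnonneg j k) hδ0) (fun e j k => ?_) ?_⟩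
  · rw [← sub_add_sub_cancel _ (QuFEM.quadArray G B hV f e j k), add_comm]
    exact (abs_add_le _ _).trans (add_le_add (herr e j k) (hδ e j k))
  · simp only [Finset.sum_add_distrib]
    rw [hsum, QuFEM.sum_const_nodes]
    linarith
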